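/- **Theorem (Approximate Sparsitron).** Let $\sigma:\mathbb R\to[0,1]$ be non-decreasing and $1$-Lipschitz, let $N\ge 1$, $\lambda\ge 0$ and $\epsilon,\delta\in(0,1)$. Let $\mathcal D$ be a probability distribution on $[-1,1]^N\times\{0,1\}$ such that $\mathbb E[Y\mid X]=\sigma(w\cdot X)$ for $(X,Y)\sim\mathcal D$, where $w\in\mathbb R^N$, and let $\varepsilon(v)=\mathbb E_{(X,Y)\sim\mathcal D}\big[(\sigma(v\cdot X)-\sigma(w\cdot X))^2\big]$ be the risk of $v\in\mathbb R^N$. *The algorithm.* Input: a first training set $(x^{(t)},y^{(t)})$, $t=1,\dots,T$, a second training set $(a^{(m)},b^{(m)})$, $m=1,\dots,M$, and parameters $\sigma,\lambda,\epsilon,\delta'$ and $\beta$. In dimension $n$ (that is, for feature vectors in $\mathbb R^n$) it starts with $w^{(1)}=(1/n,\dots,1/n)$. In round $t$ it computes $p^{(t)}=w^{(t)}/\|w^{(t)}\|_1$, the loss $l^{(t)}=\frac12\big(\vec 1+(\sigma(\lambda p^{(t)}\cdot x^{(t)})-y^{(t)})x^{(t)}\big)$ and the weights $w^{(t+1)}_j=w^{(t)}_j\beta^{l^{(t)}_j}$.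 It prepares a data structure for sampling indices $j$ with probability $p^{(t)}_j$. For each $m$ it estimates $p^{(t)}\cdot a^{(m)}$ to accuracy $\epsilon/(16\lambda)$ with success probability $1-\delta'/(MT)$ by a number $z^{(t,m)}$, the median of $\lceil 6\log (MT/\delta')\rceil$ means of $\max(1,\lceil \frac92(16\lambda/\epsilon)^2\rceil)$ samples $a^{(m)}_j$, $j\sim p^{(t)}$. It then computes the approximate empirical risk $\frac1M\sum_{m}(\sigma(\lambda z^{(t,m)})-b^{(m)})^2$. The output is $\lambda p^{(t')}$ for the (first) round $t'$ with the smallest approximate empirical risk. The parameters are set to $\beta=1-\sqrt{\log n/T}$ and $\delta'=\delta/3$. There are universal constants $C,C'>0$ and $k\in\mathbb N$ such that the following holds. Call $(T,M)$ *admissible in dimension $n$* if $T>\log n$ (so that $\beta>0$), $T\ge C\lambda^2\log(n/(\delta\epsilon))/\epsilon^2$ and $M\ge C\log(T/\delta)/\epsilon^2$. 1. (Number of samples.) There are $T,M$, admissible in both dimensions $N$ and $2N+1$, with $M\le C'\log(2T/\delta)/\epsilon^2$ and with both $T$ and $T+M$ at most $C'\max(1,\lambda)^2\log(2N/(\delta\epsilon))/\epsilon^2$.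 2. (Learning.) If $w\ge 0$, $\|w\|_1=\lambda$ and $(T,M)$ is admissible in dimension $N$, then the algorithm, run on $T+M$ independent samples of $\mathcal D$, outputs a vector $v$ with $\varepsilon(v)\le\epsilon$ with probability at least $1-\delta$ over the samples and its internal randomness. If only $\|w\|_1\le\lambda$ and $(T,M)$ is admissible in dimension $2N+1$, the same holds for the algorithm run in dimension $n=2N+1$ on the features $(x,-x,0)$, with $v_j=u_j-u_{N+j}$ computed from its output $u$. 3. (Run time.) On a randomized real RAM (unit-cost arithmetic, powers, logarithm, rounding up, comparison, array access, index operations, evaluation of $\sigma$, random numbers), for all $T\ge1$, all $M$ and all training sets, both versions take at most $C'\log^k\!\big(2+N+T+M+\lambda+\tfrac1\epsilon+\tfrac1\delta\big)\cdot T\Big(N+\frac{M\max(1,\lambda)^4\max(1,\log\frac1\delta)}{\epsilon^2}\Big)$ steps. For $\lambda\ge1$ and $\delta\le 1/e$ this is $\tilde O\big(T(N+\frac{M\lambda^4}{\epsilon^2}\log\frac1\delta)\big)$, where $\tilde O$ hides factors polylogarithmic in any of the variables. 4. (Online.) Both versions can be run online: the state (weights, best approximate empirical risk so far, corresponding vector)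 after $t+1$ rounds is obtained from the state after $t$ rounds by one update that uses only the $(t+1)$-st example of the first training set (and the second training set). For $T\ge1$, each update costs at most the bound in 3 divided by $T$. -/

import Mathlib

open MeasureTheory
open scoped ENNReal NNReal

noncomputable section

namespace Sparsitron

/-! ### A randomized real RAM

A computation is represented by the joint law of its result and of the number of instructions that
it has executed.  The only source of cost is `RAM.exec`, which executes one instruction of the list
`Instr` and adds one to the step count. -/

/-- The instructions of the machine, indexed by the type of the value they return. -/
inductive Instr : Type → Type
  /-- arithmetic on real registers -/
  | add (a b : ℝ) : Instr ℝ
  | sub (a b : ℝ) : Instr ℝ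
  | mul (a b : ℝ) : Instr ℝ
  | div (a b : ℝ) : Instr ℝ
  | pow (a b : ℝ) : Instr ℝ
  | log (a : ℝ) : Instr ℝ
  | ceil (a : ℝ) : Instr ℕ
  /-- comparison of two real registers -/
  | less (a b : ℝ) : Instr Bool
  /-- one evaluation of the activation function -/
  | call (f : ℝ → ℝ) (z : ℝ) : Instr ℝ
  /-- load one real number from the input -/
  | load (a : ℝ) : Instr ℝ
  /-- read one cell of an array -/
  | read {n : ℕ} (A : Fin n → ℝ) (i : Fin n) : Instr ℝ
  /-- overwrite one cell of an array -/
  | write {n : ℕ} (A : Fin n → ℝ) (i : Fin n) (a : ℝ) : Instr (Fin n → ℝ)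
  /-- one operation on integer words: increment, halving, comparison or jump -/
  | index : Instr Unit
  /-- draw a uniform random number of `[0,1]` and test whether it is below `p` -/
  | coin (p : ℝ) : Instr Bool

open Classical in
/-- The law of the value that an instruction returns. -/
def Instr.eval {α : Type} : Instr α → PMF α
  | .add a b => PMF.pure (a + b)
  | .sub a b => PMF.pure (a - b)
  | .mul a b => PMF.pure (a * b)
  | .div a b => PMF.pure (a / b)
  | .pow a b => PMF.pure (a ^ b)
  | .log a => PMF.pure (Real.log a)
  | .ceil a => PMF.pure ⌈a⌉₊
  | .less a b => PMF.pure (decide (a < b))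
  | .call f z => PMF.pure (f z)
  | .load a => PMF.pure a
  | .read A i => PMF.pure (A i)
  | .write A i a => PMF.pure (Function.update A i a)
  | .index => PMF.pure ()
  | .coin p => PMF.ofFintype
      (fun b => cond b (ENNReal.ofReal (min p 1)) (1 - ENNReal.ofReal (min p 1))) (by
        simp [add_tsub_cancel_of_le])

/-- A randomized computation with result in `α`, given by the joint law of the result and of the
number of executed instructions. -/
@[ext]
structure RAM (α : Type) : Type where
  law : PMF (α × ℕ)

namespace RAM

instance : Monad RAM where
  pure a := ⟨PMF.pure (a, 0)⟩
  bind c f := ⟨c.law.bind fun r => (f r.1).law.map fun s => (s.1, r.2 + s.2)⟩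

/-- Execute one instruction, at cost one. -/
def exec {α : Type} (i : Instr α) : RAM α := ⟨i.eval.map fun a => (a, 1)⟩

/-- `for i = 0, …, n - 1 do s ← body i s`; every iteration is charged one extra instruction. -/
def loop {s : Type} : (n : ℕ) → (Fin n → s → RAM s) → s → RAM s
  | 0, _, st => pure st
  | n + 1, body, st => do
      let st' ← loop n (fun i => body i.castSucc) st
      exec .index
      body (Fin.last n) st'

end RAM

open RAM

/-! ### Vector subroutines -/

/-- `w / ‖w‖₁` for an array of nonnegative weights. -/
def normalizeWeights {n : ℕ} (w : Fin n → ℝ) : RAM (Fin n → ℝ) := do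
  let s ← loop n (fun j s => do
    let a ← exec (.read w j)
    exec (.add s a)) 0
  loop n (fun j p => do
    let a ← exec (.read w j)
    let b ← exec (.div a s)
    exec (.write p j b)) (fun _ => 0)

/-- The inner product of an array with a vector that is given by query access. -/
def innerProduct {n : ℕ} (p : Fin n → ℝ) (query : Fin n → RAM ℝ) : RAM ℝ :=
  loop n (fun j s => do
    let a ← exec (.read p j)
    let b ← query j
    let c ← exec (.mul a b)
    exec (.add s c)) 0

/-- The vector `c • p`. -/
def scale {n : ℕ} (c : ℝ) (p : Fin n → ℝ) : RAM (Fin n → ℝ) :=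
  loop n (fun j v => do
    let a ← exec (.read p j)
    let b ← exec (.mul c a)
    exec (.write v j b)) (fun _ => 0)

/-- Multiplicative update `w ⊙ β ^ l` for the loss vector `l = (1 + g x) / 2`. -/
def updateWeights {n : ℕ} (beta g : ℝ) (query : Fin n → RAM ℝ) (w : Fin n → ℝ) :
    RAM (Fin n → ℝ) :=
  loop n (fun j w => do
    let x ← query j
    let a ← exec (.mul g x)
    let b ← exec (.add 1 a)
    let l ← exec (.div b 2)
    let c ← exec (.pow beta l)
    let d ← exec (.read w j)
    let e ← exec (.mul d c)
    exec (.write w j e)) w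

/-! ### Sampling from a probability vector and estimation of inner products -/

/-- The data structure for sampling from `p`: the array of partial sums `S i = ∑ j < i, p j`. -/
def prepareSampling {n : ℕ} (p : Fin n → ℝ) : RAM (Fin (n + 1) → ℝ) := do
  let S₀ ← exec (.write (fun _ => 0) 0 0)
  let r ← loop n (fun j (r : (Fin (n + 1) → ℝ) × ℝ) => do
    let a ← exec (.read p j)
    let c ← exec (.add r.2 a)
    let S ← exec (.write r.1 j.succ c)
    pure (S, c)) (S₀, 0)
  pure r.1

/-- Sample an index of `{lo, …, hi - 1}` with probability proportional to `p`, by bisection: go to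
the left half with the conditional probability of that half. -/
def sampleRange {n : ℕ} (S : Fin (n + 1) → ℝ) (lo hi : ℕ) (hlo : lo < hi) (hhi : hi ≤ n) :
    RAM (Fin n) :=
  if h : hi = lo + 1 then do
    exec .index
    pure ⟨lo, by omega⟩
  else do
    exec .index
    exec .index
    exec .index
    let a ← exec (.read S ⟨lo, by omega⟩)
    let b ← exec (.read S ⟨(lo + hi) / 2, by omega⟩)
    let c ← exec (.read S ⟨hi, by omega⟩)
    let left ← exec (.sub b a)
    let all ← exec (.sub c a)
    let q ← exec (.div left all)
    let goLeft ← exec (.coin q)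
    if goLeft then sampleRange S lo ((lo + hi) / 2) (by omega) (by omega)
    else sampleRange S ((lo + hi) / 2) hi (by omega) hhi
termination_by hi - lo

/-- One sample `j` with probability `p j`. -/
def sampleIndex {n : ℕ} [NeZero n] (S : Fin (n + 1) → ℝ) : RAM (Fin n) :=
  sampleRange S 0 n (Nat.pos_of_neZero n) le_rfl

/-- The mean of the values `x j` over `q` independent samples `j ∼ p`. -/
def sampleMean {n : ℕ} [NeZero n] (S : Fin (n + 1) → ℝ) (query : Fin n → RAM ℝ) (q : ℕ) :
    RAM ℝ := do
  let s ← loop q (fun _ s => do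
    let j ← sampleIndex S
    let a ← query j
    exec (.add s a)) 0
  exec (.div s q)

/-- A median of the entries of an array: an entry `a` such that at most half of the entries are
`< a` and at least half of the entries are `≤ a`. -/
def median {K : ℕ} (Z : Fin K → ℝ) : RAM ℝ :=
  loop K (fun i cur => do
    let a ← exec (.read Z i)
    let c ← loop K (fun k (c : ℕ × ℕ) => do
      let b ← exec (.read Z k)
      let isLt ← exec (.less b a)
      let isGt ← exec (.less a b)
      exec .index
      exec .index
      pure (if isLt then c.1 + 1 else c.1, if isGt then c.2 else c.2 + 1)) (0, 0)
    exec .index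
    exec .index
    pure (if 2 * c.1 ≤ K ∧ K ≤ 2 * c.2 then a else cur)) 0

/-- Estimate of `p · x`: the median of `K` means of `q` samples each. -/
def estimateInner {n : ℕ} [NeZero n] (S : Fin (n + 1) → ℝ) (query : Fin n → RAM ℝ) (K q : ℕ) :
    RAM ℝ := do
  let Z ← loop K (fun i (Z : Fin K → ℝ) => do
    let z ← sampleMean S query q
    exec (.write Z i z)) (fun _ => 0)
  median Z

/-! ### The approximate Sparsitron -/

/-- The parameters of the algorithm. -/
structure Params where
  /-- the activation function `σ` -/
  act : ℝ → ℝ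
  /-- the bound `λ` on the `ℓ₁`-norm -/
  lam : ℝ
  /-- the accuracy `ε` -/
  eps : ℝ
  /-- the confidence parameter `δ` -/
  delta : ℝ
  /-- the update parameter `β` -/
  beta : ℝ

/-- A labelled example `(x, y)`. -/
abbrev Example (N : ℕ) : Type := (Fin N → ℝ) × ℝ

/-- The number `⌈6 log (1 / (δ / (M T)))⌉` of repetitions, for success probability
`1 - δ / (M T)` of one estimate. -/
def repetitions (P : Params) (T M : ℕ) : RAM ℕ := do
  let a ← exec (.mul M T)
  let b ← exec (.div a P.delta)
  let c ← exec (.log b)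
  let d ← exec (.mul 6 c)
  exec (.ceil d)

/-- The number `⌈9 / (2 η ^ 2)⌉` (and at least one) of samples in one mean, for the accuracy
`η = ε / (16 λ)` of one estimate. -/
def batchSize (P : Params) : RAM ℕ := do
  let a ← exec (.mul 16 P.lam)
  let b ← exec (.div a P.eps)
  let c ← exec (.mul b b)
  let d ← exec (.mul (9 / 2) c)
  let q ← exec (.ceil d)
  exec .index
  pure (max 1 q)

/-- What the algorithm stores between two rounds: the weights `w`, and (after the first round) the
smallest approximate empirical risk so far together with the vector `λ p` that attains it. -/
structure State (n : ℕ) where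
  weights : Fin n → ℝ
  best : Option (ℝ × (Fin n → ℝ))

/-- The initial state, with the weights `1 / n`. -/
def initState (n : ℕ) : RAM (State n) := do
  let c ← exec (.div 1 n)
  let w ← loop n (fun j w => exec (.write w j c)) (fun _ => 0)
  pure ⟨w, none⟩

/-- The approximate empirical risk `(1/M) ∑ m, (σ (λ z m) - b m) ^ 2` on the second training set,
where `z m` is an estimate of `p · a m` by sampling from `p`. -/
def approxRisk {N n M : ℕ} [NeZero n] (access : (Fin N → ℝ) → Fin n → RAM ℝ) (P : Params)
    (T : ℕ) (test : Fin M → Example N) (p : Fin n → ℝ) : RAM ℝ := do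
  let S ← prepareSampling p
  let K ← repetitions P T M
  let q ← batchSize P
  let total ← loop M (fun m s => do
    let z ← estimateInner S (access (test m).1) K q
    let u ← exec (.mul P.lam z)
    let o ← exec (.call P.act u)
    let b ← exec (.load (test m).2)
    let d ← exec (.sub o b)
    let d2 ← exec (.mul d d)
    exec (.add s d2)) 0
  exec (.div total M)

/-- One round of the algorithm, on the example `ex` of the first training set.  The learner works
in dimension `n` and reads the coordinates of the feature vectors through `access`. -/
def oneRound {N n M : ℕ} [NeZero n] (access : (Fin N → ℝ) → Fin n → RAM ℝ) (P : Params) (T : ℕ)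
    (test : Fin M → Example N) (ex : Example N) (st : State n) : RAM (State n) := do
  let p ← normalizeWeights st.weights
  let h ← innerProduct p (access ex.1)
  let u ← exec (.mul P.lam h)
  let o ← exec (.call P.act u)
  let y ← exec (.load ex.2)
  let g ← exec (.sub o y)
  let w ← updateWeights P.beta g (access ex.1) st.weights
  let risk ← approxRisk access P T test p
  exec .index
  let better ← match st.best with
    | none => pure true
    | some b => exec (.less risk b.1)
  if better then do
    let v ← scale P.lam p
    pure ⟨w, some (risk, v)⟩
  else pure ⟨w, st.best⟩

/-- The state after the rounds on the examples `train 0, …, train (t - 1)`.  The number `T` is the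
planned number of rounds. -/
def stateAfter {N n M : ℕ} [NeZero n] (access : (Fin N → ℝ) → Fin n → RAM ℝ) (P : Params)
    (T : ℕ) (test : Fin M → Example N) {t : ℕ} (train : Fin t → Example N) : RAM (State n) := do
  let s ← initState n
  loop t (fun i st => oneRound access P T test (train i) st) s

/-- The algorithm: `T` rounds, then output the stored vector. -/
def learn {N n T M : ℕ} [NeZero n] (access : (Fin N → ℝ) → Fin n → RAM ℝ) (P : Params)
    (train : Fin T → Example N) (test : Fin M → Example N) : RAM (Fin n → ℝ) := do
  let s ← stateAfter access P T test train
  exec .index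
  match s.best with
    | none => pure (fun _ => 0)
    | some b => pure b.2

/-- Direct query access to the coordinates of a feature vector. -/
def plainAccess {N : ℕ} (x : Fin N → ℝ) (j : Fin N) : RAM ℝ := exec (.read x j)

/-- Query access to the coordinates of the vector `(x, -x, 0)`. -/
def signedAccess {N : ℕ} (x : Fin N → ℝ) (j : Fin (2 * N + 1)) : RAM ℝ := do
  exec .index
  exec .index
  if h : j.val < N then exec (.read x ⟨j.val, h⟩)
  else if h' : j.val < 2 * N then do
    exec .index
    let a ← exec (.read x ⟨j.val - N, by omega⟩)
    exec (.sub 0 a)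
  else pure 0

/-- The approximate Sparsitron; it outputs a vector `λ p` with `p` a probability vector. -/
def sparsitron {N T M : ℕ} [NeZero N] (P : Params) (train : Fin T → Example N)
    (test : Fin M → Example N) : RAM (Fin N → ℝ) :=
  learn plainAccess P train test

/-- The approximate Sparsitron for weight vectors of arbitrary signs and of `ℓ₁`-norm at most `λ`:
run the algorithm on the features `(x, -x, 0)`, in dimension `2 N + 1`, and return
`v j = u j - u (N + j)` for its output `u`. -/
def sparsitronSigned {N T M : ℕ} (P : Params) (train : Fin T → Example N)
    (test : Fin M → Example N) : RAM (Fin N → ℝ) := do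
  let u ← learn (n := 2 * N + 1) signedAccess P train test
  loop N (fun j v => do
    exec .index
    let a ← exec (.read u ⟨j.val, by omega⟩)
    let b ← exec (.read u ⟨N + j.val, by omega⟩)
    let c ← exec (.sub a b)
    exec (.write v j c)) (fun _ => 0)

/-- The parameters for `T` rounds in dimension `n` with overall failure probability `δ`:
`β = 1 - √(log n / T)`, and a third of the failure probability goes to the estimates. -/
def parameters (act : ℝ → ℝ) (lam eps delta : ℝ) (n T : ℕ) : Params where
  act := act
  lam := lam
  eps := eps
  delta := delta / 3
  beta := 1 - Real.sqrt (Real.log n / T)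

/-! ### The learning problem -/

/-- `D` is a distribution on `[-1,1]^N × {0,1}` with `E[Y | X] = σ (w · X)`. -/
structure IsGLM {N : ℕ} (act : ℝ → ℝ) (w : Fin N → ℝ) (D : Measure (Example N)) : Prop where
  isProbabilityMeasure : IsProbabilityMeasure D
  features_mem : ∀ᵐ s ∂D, ∀ j, s.1 j ∈ Set.Icc (-1 : ℝ) 1
  label_mem : ∀ᵐ s ∂D, s.2 = 0 ∨ s.2 = 1
  condExp_eq : D[fun s => s.2 | MeasurableSpace.comap Prod.fst inferInstance] =ᵐ[D]
    fun s => act (w ⬝ᵥ s.1)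

/-- The risk `E (σ (v · X) - σ (w · X)) ^ 2`. -/
def risk {N : ℕ} (act : ℝ → ℝ) (w : Fin N → ℝ) (D : Measure (Example N)) (v : Fin N → ℝ) : ℝ :=
  ∫ s, (act (v ⬝ᵥ s.1) - act (w ⬝ᵥ s.1)) ^ 2 ∂D

/-- The probability, over `T + M` independent samples of `D` and the internal randomness of the
algorithm, that the output lies in `good`. -/
def successProb {N : ℕ} (D : Measure (Example N)) (T M : ℕ)
    (alg : (Fin T → Example N) → (Fin M → Example N) → RAM (Fin N → ℝ))
    (good : Set (Fin N → ℝ)) : ℝ≥0∞ :=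
  ∫⁻ s, (alg s.1 s.2).law.toOuterMeasure {r | r.1 ∈ good}
    ∂((Measure.pi fun _ : Fin T => D).prod (Measure.pi fun _ : Fin M => D))

/-- Sizes of the two training sets that suffice in dimension `n`, up to the constant `C`; the
condition `log n < T` says that `β = 1 - √(log n / T)` is positive. -/
def SampleSizes (C : ℝ) (n : ℕ) (lam eps delta : ℝ) (T M : ℕ) : Prop :=
  Real.log n < T ∧
  C * lam ^ 2 * Real.log (n / (delta * eps)) / eps ^ 2 ≤ T ∧
  C * Real.log (T / delta) / eps ^ 2 ≤ M

/-- `c` takes at most `b` steps, whatever its random choices are. -/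
def StepsLE {α : Type} (c : RAM α) (b : ℝ) : Prop := ∀ r ∈ c.law.support, (r.2 : ℝ) ≤ b

/-- `C (log (all parameters))^k`, the factor hidden in the soft-O. -/
def polylog (C : ℝ) (k N T M : ℕ) (lam eps delta : ℝ) : ℝ :=
  C * Real.log (2 + N + T + M + lam + 1 / eps + 1 / delta) ^ k

/-- `N + M λ⁴ log (1/δ) / ε²`, where `λ` and `log (1/δ)` are replaced by `1` if they are smaller. -/
def roundCost (N M : ℕ) (lam eps delta : ℝ) : ℝ :=
  N + M * max 1 lam ^ 4 * max 1 (Real.log (1 / delta)) / eps ^ 2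

end Sparsitron

end

open Sparsitron

/-!
The algorithm is Hedge on the simplex, so its regret is at most `6 λ √(T log n)`. The loss of a
round is, up to affine rescaling, the linear form `p ↦ (σ(λ p⁽ᵗ⁾ · x) - y) (λ p · x)`; monotonicity
and the Lipschitz property of `σ` bound the risk of `λ p⁽ᵗ⁾` by the conditional expectation of its
excess over `w`. By Azuma's inequality the sum of these expectations is close to the sum of the
observed excesses, which is the regret; hence some visited vector has risk at most `ε / 2`.
Hoeffding's inequality over the second training set shows that, simultaneously for all rounds, the
empirical risk is close to the risk plus a constant. A mean of samples of `a j`, `j ∼ p`, is within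
`ε / (16 λ)` of `p · a` with probability at least `7 / 9` by Chebyshev's inequality, and the
median of `K` means fails with probability at most `exp (-K / 6)`; so the minimiser of the
approximate empirical risk is as good as the best visited vector up to `ε / 2`. For `λ ≤ ε / 2` or
`n = 1` every point of the scaled simplex is good, and the case `‖w‖₁ ≤ λ` is reduced to the other
one by splitting `w` into its positive part, its negative part and a slack.
-/

namespace Sparsitron

/-! ### Expectations and guarantees of randomized computations -/

section PMF

variable {α β : Type*}

lemma tsum_bind_mul (p : PMF α) (f : α → PMF β) (g : β → ℝ≥0∞) :
    ∑' b, p.bind f b * g b = ∑' a, p a * ∑' b, f a b * g b := by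
  simp only [PMF.bind_apply, ← ENNReal.tsum_mul_right, ← ENNReal.tsum_mul_left]
  rw [ENNReal.tsum_comm]
  simp only [mul_assoc]

lemma tsum_pure_mul (a : α) (g : α → ℝ≥0∞) : ∑' b, PMF.pure a b * g b = g a := by
  rw [tsum_eq_single a fun b hb => by simp [PMF.pure_apply, hb]]
  simp

lemma tsum_map_mul (p : PMF α) (f : α → β) (g : β → ℝ≥0∞) :
    ∑' b, p.map f b * g b = ∑' a, p a * g (f a) := by
  rw [← PMF.bind_pure_comp, tsum_bind_mul]
  simp only [Function.comp_apply, tsum_pure_mul]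

end PMF

namespace RAM

variable {α β s : Type}

lemma law_pure (a : α) : (pure a : RAM α).law = PMF.pure (a, 0) := rfl

lemma law_bind (c : RAM α) (f : α → RAM β) :
    (c >>= f).law = c.law.bind fun r => (f r.1).law.map fun t => (t.1, r.2 + t.2) := rfl

instance : LawfulMonad RAM := LawfulMonad.mk'
  (id_map := fun c => by
    change c >>= (pure ∘ id) = c
    ext1
    simp only [law_bind, Function.comp_apply, id_eq, law_pure, PMF.pure_map, add_zero,
      Prod.mk.eta, PMF.bind_pure])
  (pure_bind := fun a f => by
    ext1
    simp only [law_bind, law_pure, PMF.pure_bind, zero_add, Prod.mk.eta]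
    exact PMF.map_id _)
  (bind_assoc := fun c f g => by
    ext1
    simp only [law_bind, PMF.map_bind, PMF.bind_bind, PMF.bind_map, PMF.map_comp,
      Function.comp_def, add_assoc])

/-- The expectation of a nonnegative function of the result of a computation. -/
noncomputable def expect (c : RAM α) (g : α → ℝ≥0∞) : ℝ≥0∞ := ∑' r, c.law r * g r.1

@[simp]
lemma expect_pure (a : α) (g : α → ℝ≥0∞) : expect (pure a) g = g a := by
  simp only [expect, law_pure, tsum_pure_mul]

@[simp]
lemma expect_bind (c : RAM α) (f : α → RAM β) (g : β → ℝ≥0∞) :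
    expect (c >>= f) g = expect c fun a => expect (f a) g := by
  simp only [expect, law_bind]
  rw [tsum_bind_mul _ _ fun r : β × ℕ => g r.1]
  simp only [tsum_map_mul _ _ fun r : β × ℕ => g r.1]

lemma expect_exec (i : Instr α) (g : α → ℝ≥0∞) : expect (exec i) g = ∑' a, i.eval a * g a :=
  tsum_map_mul _ _ fun r : α × ℕ => g r.1

lemma expect_exec_of_eval_eq_pure {i : Instr α} {a : α} (hi : i.eval = PMF.pure a)
    (g : α → ℝ≥0∞) : expect (exec i) g = g a := by
  rw [expect_exec, hi, tsum_pure_mul]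

lemma expect_exec_coin (q : ℝ) (g : Bool → ℝ≥0∞) :
    expect (exec (.coin q)) g =
      ENNReal.ofReal (min q 1) * g true + (1 - ENNReal.ofReal (min q 1)) * g false := by
  rw [expect_exec, tsum_bool, add_comm]
  rfl

lemma expect_mono {c : RAM α} {g h : α → ℝ≥0∞} (hgh : ∀ a, g a ≤ h a) :
    expect c g ≤ expect c h :=
  ENNReal.tsum_le_tsum fun r => mul_le_mul_right (hgh r.1) _

lemma expect_const (c : RAM α) (x : ℝ≥0∞) : expect c (fun _ => x) = x := by
  rw [expect, ENNReal.tsum_mul_right, PMF.tsum_coe, one_mul]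

lemma expect_add (c : RAM α) (g h : α → ℝ≥0∞) :
    expect c (fun a => g a + h a) = expect c g + expect c h := by
  simp only [expect, mul_add, ENNReal.tsum_add]

lemma expect_const_mul (c : RAM α) (x : ℝ≥0∞) (g : α → ℝ≥0∞) :
    expect c (fun a => x * g a) = x * expect c g := by
  simp only [expect, ← ENNReal.tsum_mul_left, mul_left_comm]

/-- Whatever the random choices are, `c` takes at most `b` steps and its result satisfies `P`. -/
def Ensures (c : RAM α) (b : ℕ) (P : α → Prop) : Prop := ∀ r ∈ c.law.support, r.2 ≤ b ∧ P r.1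

lemma Ensures.mono {c : RAM α} {b b' : ℕ} {P Q : α → Prop} (hc : Ensures c b P) (hb : b ≤ b')
    (hPQ : ∀ a, P a → Q a) : Ensures c b' Q :=
  fun r hr => ⟨(hc r hr).1.trans hb, hPQ _ (hc r hr).2⟩

lemma Ensures.mono_cost {c : RAM α} {b b' : ℕ} {P : α → Prop} (hc : Ensures c b P)
    (hb : b ≤ b') : Ensures c b' P :=
  hc.mono hb fun _ h => h

lemma Ensures.stepsLE {c : RAM α} {b : ℕ} {P : α → Prop} (h : Ensures c b P) {x : ℝ}
    (hx : (b : ℝ) ≤ x) : StepsLE c x :=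
  fun r hr => (Nat.cast_le.2 (h r hr).1).trans hx

lemma Ensures.expect_le {c : RAM α} {b : ℕ} {P : α → Prop} (hc : Ensures c b P)
    {g : α → ℝ≥0∞} {x : ℝ≥0∞} (hg : ∀ a, P a → g a ≤ x) : expect c g ≤ x := by
  rw [← expect_const c x]
  refine ENNReal.tsum_le_tsum fun r => ?_
  by_cases hr : r ∈ c.law.support
  · exact mul_le_mul_right (hg _ (hc r hr).2) _
  · simp [(PMF.apply_eq_zero_iff _ _).2 hr]

lemma ensures_pure {a : α} {P : α → Prop} (h : P a) : Ensures (pure a) 0 P := by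
  intro r hr
  rw [law_pure, PMF.mem_support_pure_iff] at hr
  subst hr
  exact ⟨le_rfl, h⟩

lemma Ensures.bind {c : RAM α} {f : α → RAM β} {b b' : ℕ} {P : α → Prop} {Q : β → Prop}
    (hc : Ensures c b P) (hf : ∀ a, P a → Ensures (f a) b' Q) : Ensures (c >>= f) (b + b') Q := by
  intro r hr
  obtain ⟨r₁, hr₁, hr⟩ := (PMF.mem_support_bind_iff _ _ _).1 (law_bind c f ▸ hr)
  obtain ⟨r₂, hr₂, rfl⟩ := (PMF.mem_support_map_iff _ _ _).1 hr
  have hfst := hc r₁ hr₁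
  have hsnd := hf r₁.1 hfst.2 r₂ hr₂
  exact ⟨add_le_add hfst.1 hsnd.1, hsnd.2⟩

lemma ensures_exec (i : Instr α) : Ensures (exec i) 1 fun a => a ∈ i.eval.support := by
  intro r hr
  obtain ⟨a, ha, rfl⟩ := (PMF.mem_support_map_iff _ _ _).1 hr
  exact ⟨le_rfl, ha⟩

lemma ensures_exec_of_eval_eq_pure {i : Instr α} {a : α} (hi : i.eval = PMF.pure a)
    {P : α → Prop} (h : P a) : Ensures (exec i) 1 P := by
  refine (ensures_exec i).mono le_rfl fun x hx => ?_
  rw [hi, PMF.mem_support_pure_iff] at hx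
  rwa [hx]

lemma Ensures.exec_bind {i : Instr α} {a : α} (hi : i.eval = PMF.pure a) {f : α → RAM β}
    {b : ℕ} {Q : β → Prop} (hf : Ensures (f a) b Q) : Ensures (exec i >>= f) (b + 1) Q := by
  rw [add_comm]
  exact (ensures_exec_of_eval_eq_pure (P := (· = a)) hi rfl).bind fun x hx => hx ▸ hf

section Loop

variable {n : ℕ} {body : Fin n → s → RAM s} {st : s}

lemma ensures_loop {b : ℕ} (I : ℕ → s → Prop) (h0 : I 0 st)
    (hbody : ∀ (i : Fin n) st, I i st → Ensures (body i st) b (I (i + 1))) :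
    Ensures (loop n body st) (n * (b + 1)) (I n) := by
  induction n with
  | zero => exact (ensures_pure h0).mono_cost (Nat.zero_le _)
  | succ n ih =>
    have hinit := ih (body := fun i => body i.castSucc) fun i st hi => hbody i.castSucc st hi
    have hlast (st') (h' : I n st') : Ensures (do exec .index; body (Fin.last n) st') (b + 1)
        (I (n + 1)) := Ensures.exec_bind rfl (hbody (Fin.last n) st' h')
    exact (hinit.bind hlast).mono_cost (by rw [add_one_mul])

lemma expect_loop_mul_le (Φ : ℕ → s → ℝ≥0∞) (x : ℝ≥0∞)
    (hbody : ∀ (i : Fin n) st, expect (body i st) (Φ (i + 1)) ≤ x * Φ i st) :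
    expect (loop n body st) (Φ n) ≤ x ^ n * Φ 0 st := by
  induction n with
  | zero => simp [loop]
  | succ n ih =>
    have hinit := ih (body := fun i => body i.castSucc) fun i st => hbody i.castSucc st
    simp only [loop, expect_bind, expect_exec_of_eval_eq_pure (i := .index) rfl]
    calc _ ≤ expect (loop n (fun i => body i.castSucc) st) fun st' => x * Φ n st' :=
          expect_mono fun st' => hbody (Fin.last n) st'
      _ ≤ x * (x ^ n * Φ 0 st) := by
          rw [expect_const_mul]
          exact mul_le_mul_right hinit _
      _ = x ^ (n + 1) * Φ 0 st := by ring

lemma expect_loop_add_le (Φ : ℕ → s → ℝ≥0∞) (x : ℝ≥0∞)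
    (hbody : ∀ (i : Fin n) st, expect (body i st) (Φ (i + 1)) ≤ Φ i st + x) :
    expect (loop n body st) (Φ n) ≤ Φ 0 st + n * x := by
  induction n with
  | zero => simp [loop]
  | succ n ih =>
    have hinit := ih (body := fun i => body i.castSucc) fun i st => hbody i.castSucc st
    simp only [loop, expect_bind, expect_exec_of_eval_eq_pure (i := .index) rfl]
    calc _ ≤ expect (loop n (fun i => body i.castSucc) st) fun st' => Φ n st' + x :=
          expect_mono fun st' => hbody (Fin.last n) st'
      _ ≤ (Φ 0 st + n * x) + x := by
          rw [expect_add, expect_const]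
          exact add_le_add_left hinit x
      _ = Φ 0 st + (n + 1 : ℕ) * x := by push_cast; ring

end Loop

open Classical in
/-- The probability that the result of a computation violates `P`. -/
noncomputable def failProb (c : RAM α) (P : α → Prop) : ℝ≥0∞ :=
  expect c fun a => if P a then 0 else 1

lemma failProb_le_one (c : RAM α) (P : α → Prop) : failProb c P ≤ 1 := by
  rw [← expect_const c 1]
  exact expect_mono fun a => by split_ifs <;> simp

lemma Ensures.failProb_eq_zero {c : RAM α} {b : ℕ} {P : α → Prop} (h : Ensures c b P) :
    failProb c P = 0 :=
  le_antisymm (h.expect_le fun a ha => by simp [ha]) bot_le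

lemma failProb_mono {c : RAM α} {P Q : α → Prop} (h : ∀ a, P a → Q a) :
    failProb c Q ≤ failProb c P := by
  refine expect_mono fun a => ?_
  by_cases hP : P a
  · simp [h a hP]
  · rw [if_neg hP]
    split_ifs <;> simp

lemma failProb_bind_le {c : RAM α} {f : α → RAM β} {P : α → Prop} {Q : β → Prop} {x : ℝ≥0∞}
    (hf : ∀ a, P a → failProb (f a) Q ≤ x) : failProb (c >>= f) Q ≤ failProb c P + x := by
  classical
  rw [failProb, expect_bind]
  refine (expect_mono (h := fun a => (if P a then 0 else 1) + x) fun a => ?_).trans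
    (by rw [expect_add, expect_const, failProb])
  by_cases hP : P a
  · rw [if_pos hP, zero_add]
    exact hf a hP
  · rw [if_neg hP]
    exact (failProb_le_one (f a) Q).trans le_self_add

lemma Ensures.failProb_bind_le {c : RAM α} {f : α → RAM β} {b : ℕ} {P : α → Prop}
    {Q : β → Prop} {x : ℝ≥0∞} (hc : Ensures c b P) (hf : ∀ a, P a → failProb (f a) Q ≤ x) :
    failProb (c >>= f) Q ≤ x := by
  simpa only [hc.failProb_eq_zero, zero_add] using RAM.failProb_bind_le (c := c) hf

lemma failProb_exec_bind {i : Instr α} {a : α} (hi : i.eval = PMF.pure a) {f : α → RAM β}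
    {Q : β → Prop} : failProb (exec i >>= f) Q = failProb (f a) Q := by
  rw [failProb, expect_bind, expect_exec_of_eval_eq_pure hi, failProb]

lemma failProb_loop_le {n : ℕ} {body : Fin n → s → RAM s} {st : s}
    (I : ℕ → s → Prop) (h0 : I 0 st) (x : ℝ≥0∞)
    (hbody : ∀ (i : Fin n) st, I i st → failProb (body i st) (I (i + 1)) ≤ x) :
    failProb (loop n body st) (I n) ≤ n * x := by
  classical
  refine (expect_loop_add_le (fun i a => if I i a then 0 else 1) x fun i st => ?_).trans
    (by simp [h0])
  by_cases hI : I i st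
  · rw [if_pos hI, zero_add]
    exact hbody i st hI
  · rw [if_neg hI]
    exact (failProb_le_one _ _).trans le_self_add

lemma one_sub_failProb_le (c : RAM α) (S : Set α) :
    1 - failProb c (· ∈ S) ≤ c.law.toOuterMeasure {r | r.1 ∈ S} := by
  classical
  rw [tsub_le_iff_right, PMF.toOuterMeasure_apply, failProb, expect, ← ENNReal.tsum_add,
    ← c.law.tsum_coe]
  refine ENNReal.tsum_le_tsum fun r => ?_
  by_cases h : r.1 ∈ S <;> simp [Set.indicator, h]

end RAM

open RAM

/-! ### Vector subroutines -/

section Vectors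

variable {n : ℕ}

/-- The sum of the entries `lo, …, hi - 1` of an array. -/
def blockSum {M : Type*} [AddCommMonoid M] (f : Fin n → M) (lo hi : ℕ) : M :=
  ∑ j with lo ≤ j.val ∧ j.val < hi, f j

section BlockSum

variable {M : Type*} [AddCommMonoid M] (f : Fin n → M)

@[simp]
lemma blockSum_self (lo : ℕ) : blockSum f lo lo = 0 :=
  Finset.sum_eq_zero fun j hj => by
    simp only [Finset.mem_filter, Finset.mem_univ, true_and] at hj
    omega

lemma blockSum_add_blockSum {lo mid hi : ℕ} (h₁ : lo ≤ mid) (h₂ : mid ≤ hi) :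
    blockSum f lo mid + blockSum f mid hi = blockSum f lo hi := by
  rw [blockSum, blockSum, ← Finset.sum_union]
  · exact Finset.sum_congr (by ext j; simp; omega) fun _ _ => rfl
  · refine Finset.disjoint_left.2 fun j hj hj' => ?_
    simp only [Finset.mem_filter, Finset.mem_univ, true_and] at hj hj'
    omega

lemma blockSum_succ_self (i : Fin n) : blockSum f i (i + 1) = f i := by
  have hsingle : (Finset.univ.filter fun j : Fin n => i.val ≤ j.val ∧ j.val < i + 1) = {i} := by
    ext j
    simp only [Finset.mem_filter, Finset.mem_univ, true_and, Finset.mem_singleton, Fin.ext_iff]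
    omega
  rw [blockSum, hsingle, Finset.sum_singleton]

lemma blockSum_zero_succ (i : Fin n) : blockSum f 0 (i + 1) = blockSum f 0 i + f i := by
  rw [← blockSum_add_blockSum f (Nat.zero_le i) (Nat.le_succ i), blockSum_succ_self]

@[simp]
lemma blockSum_zero_length : blockSum f 0 n = ∑ j, f j := by simp [blockSum]

end BlockSum

lemma blockSum_nonneg {p : Fin n → ℝ} (hp : ∀ j, 0 ≤ p j) (lo hi : ℕ) : 0 ≤ blockSum p lo hi :=
  Finset.sum_nonneg fun j _ => hp j

/-- The partial sums `∑ j < i, p j`, which is what `prepareSampling` computes. -/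
def prefixSums (p : Fin n → ℝ) (i : Fin (n + 1)) : ℝ := blockSum p 0 i

/-- The vector `w / ∑ i, w i`; this is `w / ‖w‖₁` for nonnegative `w`. -/
noncomputable def normalized (w : Fin n → ℝ) : Fin n → ℝ := fun j => w j / ∑ i, w i

/-- `query` gives access to the entries of `x`, at cost at most `a` per entry. -/
def Reads (query : Fin n → RAM ℝ) (a : ℕ) (x : Fin n → ℝ) : Prop :=
  ∀ j, Ensures (query j) a fun y => y = x j

lemma ensures_loop_write {body : Fin n → (Fin n → ℝ) → RAM (Fin n → ℝ)} {A₀ f : Fin n → ℝ}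
    {b : ℕ} (hbody : ∀ j A, A j = A₀ j →
      Ensures (body j A) b fun A' => A' = Function.update A j (f j)) :
    Ensures (loop n body A₀) (n * (b + 1)) fun A => A = f := by
  refine (ensures_loop (fun i A => ∀ j : Fin n, A j = if j.val < i then f j else A₀ j)
    (by simp) fun i A hA => ?_).mono le_rfl fun A hA => funext fun j => by simp [hA]
  refine (hbody i A (by simp [hA])).mono le_rfl ?_
  rintro _ rfl j
  rcases eq_or_ne j i with rfl | hji
  · simp
  · have hlt : j.val < i.val + 1 ↔ j.val < i.val := by
      have := Fin.val_ne_of_ne hji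
      omega
    simp only [Function.update_of_ne hji, hA, hlt]

lemma ensures_normalizeWeights (w : Fin n → ℝ) :
    Ensures (normalizeWeights w) (n * 3 + n * 4) fun p => p = normalized w := by
  refine Ensures.bind (P := fun s => s = ∑ i, w i) ?_ ?_
  · rw [← blockSum_zero_length]
    refine ensures_loop (fun i s => s = blockSum w 0 i) (by simp) ?_
    rintro i _ rfl
    refine Ensures.exec_bind rfl (ensures_exec_of_eval_eq_pure rfl ?_)
    rw [blockSum_zero_succ]
  · rintro _ rfl
    refine ensures_loop_write fun j A _ => ?_
    exact Ensures.exec_bind rfl (Ensures.exec_bind rfl (ensures_exec_of_eval_eq_pure rfl rfl))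

lemma ensures_innerProduct (p : Fin n → ℝ) {query : Fin n → RAM ℝ} {a : ℕ} {x : Fin n → ℝ}
    (hq : Reads query a x) :
    Ensures (innerProduct p query) (n * (a + 4)) fun s => s = p ⬝ᵥ x := by
  rw [dotProduct, ← blockSum_zero_length]
  refine ensures_loop (b := a + 3) (fun i s => s = blockSum (fun j => p j * x j) 0 i)
    (by simp) ?_
  rintro i _ rfl
  refine Ensures.exec_bind rfl ((hq i).bind ?_)
  rintro _ rfl
  refine Ensures.exec_bind rfl (ensures_exec_of_eval_eq_pure rfl ?_)
  rw [blockSum_zero_succ]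

lemma ensures_scale (c : ℝ) (p : Fin n → ℝ) :
    Ensures (scale c p) (n * 4) fun v => v = c • p :=
  ensures_loop_write fun _ _ _ =>
    Ensures.exec_bind rfl (Ensures.exec_bind rfl (ensures_exec_of_eval_eq_pure rfl rfl))

lemma ensures_updateWeights (beta g : ℝ) {query : Fin n → RAM ℝ} {a : ℕ} {x : Fin n → ℝ}
    (hq : Reads query a x) (w : Fin n → ℝ) :
    Ensures (updateWeights beta g query w) (n * (a + 8)) fun w' =>
      w' = fun j => w j * beta ^ ((1 + g * x j) / 2) := by
  refine ensures_loop_write (b := a + 7) fun j A hA => (hq j).bind ?_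
  rintro _ rfl
  iterate 6 refine Ensures.exec_bind rfl ?_
  refine ensures_exec_of_eval_eq_pure rfl ?_
  rw [hA]

lemma ensures_prepareSampling (p : Fin n → ℝ) :
    Ensures (prepareSampling p) (n * 4 + 1) fun S => S = prefixSums p := by
  refine Ensures.exec_bind rfl (Ensures.bind (b' := 0) (ensures_loop
    (fun k (r : (Fin (n + 1) → ℝ) × ℝ) =>
      (∀ i : Fin (n + 1), i.val ≤ k → r.1 i = prefixSums p i) ∧ r.2 = blockSum p 0 k)
    ⟨fun i hi => ?_, by simp⟩ ?_) ?_)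
  · obtain rfl : i = 0 := Fin.ext (Nat.le_zero.1 hi)
    simp [prefixSums]
  · rintro i ⟨S, c⟩ ⟨hS, rfl⟩
    iterate 3 refine Ensures.exec_bind (b := _) rfl ?_
    refine ensures_pure ⟨fun k hk => ?_, (blockSum_zero_succ p i).symm⟩
    rcases eq_or_ne k i.succ with rfl | hki
    · simp [prefixSums, blockSum_zero_succ]
    · have : k.val ≠ i.val + 1 := fun h => hki (Fin.ext h)
      simp only [Function.update_of_ne hki]
      exact hS k (by omega)
  · rintro r ⟨hr, -⟩
    exact ensures_pure (funext fun i => hr i (by omega))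

lemma ensures_initState (n : ℕ) :
    Ensures (initState n) (n * 2 + 1) fun s => s = ⟨fun _ => 1 / n, none⟩ := by
  refine Ensures.exec_bind rfl (Ensures.bind (b' := 0) (P := fun w => w = fun _ => 1 / (n : ℝ))
    (ensures_loop_write fun j A _ => ensures_exec_of_eval_eq_pure rfl rfl) ?_)
  rintro _ rfl
  exact ensures_pure rfl

end Vectors

/-! ### Sampling from a probability vector -/

section Sampling

variable {n : ℕ}

lemma ensures_sampleRange (S : Fin (n + 1) → ℝ) {d lo hi : ℕ} (hlo : lo < hi) (hhi : hi ≤ n)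
    (hd : hi - lo ≤ 2 ^ d) :
    Ensures (sampleRange S lo hi hlo hhi) (10 * d + 1) fun _ => True := by
  induction d generalizing lo hi with
  | zero =>
    rw [sampleRange, dif_pos (by rw [pow_zero] at hd; omega)]
    exact Ensures.exec_bind rfl (ensures_pure trivial)
  | succ d ih =>
    rw [pow_succ] at hd
    rw [sampleRange]
    split_ifs with hone
    · exact Ensures.mono_cost (b := 0 + 1) (Ensures.exec_bind rfl (ensures_pure trivial)) (by omega)
    · rw [show 10 * (d + 1) + 1 = (1 + (10 * d + 1)) + 9 by ring]
      iterate 9 refine Ensures.exec_bind rfl ?_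
      refine (ensures_exec _).bind fun goLeft _ => ?_
      cases goLeft <;> exact ih _ _ (by omega)

lemma ensures_sampleIndex [NeZero n] (S : Fin (n + 1) → ℝ) :
    Ensures (sampleIndex S) (10 * Nat.clog 2 n + 1) fun _ => True :=
  ensures_sampleRange S _ _ (Nat.le_pow_clog one_lt_two n)

lemma ensures_sampleMean [NeZero n] (S : Fin (n + 1) → ℝ) {query : Fin n → RAM ℝ} {a : ℕ}
    {x : Fin n → ℝ} (hq : Reads query a x) (q : ℕ) :
    Ensures (sampleMean S query q) (q * (10 * Nat.clog 2 n + 1 + (a + 1) + 1) + 1)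
      fun _ => True :=
  (ensures_loop (fun _ _ => True) trivial fun _ _ _ => (ensures_sampleIndex S).bind fun j _ =>
    (hq j).bind fun _ _ => ensures_exec_of_eval_eq_pure rfl trivial).bind
      fun _ _ => ensures_exec_of_eval_eq_pure rfl trivial

lemma ofReal_add_mul_coin {b c : ℝ} (hb : 0 ≤ b) (hc : 0 ≤ c) (x y : ℝ≥0∞) :
    ENNReal.ofReal (b + c) * (ENNReal.ofReal (min (b / (b + c)) 1) * x +
      (1 - ENNReal.ofReal (min (b / (b + c)) 1)) * y) =
    ENNReal.ofReal b * x + ENNReal.ofReal c * y := by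
  rcases (add_nonneg hb hc).eq_or_lt with hzero | hpos
  · simp [show b = 0 by linarith, show c = 0 by linarith]
  have hcompl : 1 - ENNReal.ofReal (b / (b + c)) = ENNReal.ofReal (c / (b + c)) := by
    rw [← ENNReal.ofReal_one, ← ENNReal.ofReal_sub _ (by positivity), one_sub_div hpos.ne',
      add_sub_cancel_left]
  rw [min_eq_left (div_le_one_of_le₀ (by linarith) hpos.le), hcompl, mul_add, ← mul_assoc,
    ← mul_assoc, ← ENNReal.ofReal_mul hpos.le, ← ENNReal.ofReal_mul hpos.le,
    mul_div_cancel₀ _ hpos.ne', mul_div_cancel₀ _ hpos.ne']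

/-- Multiplying by the mass of the range keeps the identity valid when that mass is zero. -/
lemma ofReal_blockSum_mul_expect_sampleRange {p : Fin n → ℝ} (hp : ∀ j, 0 ≤ p j)
    (g : Fin n → ℝ≥0∞) {lo hi : ℕ} (hlo : lo < hi) (hhi : hi ≤ n) :
    ENNReal.ofReal (blockSum p lo hi) * expect (sampleRange (prefixSums p) lo hi hlo hhi) g =
      blockSum (fun j => ENNReal.ofReal (p j) * g j) lo hi := by
  induction hlen : hi - lo using Nat.strong_induction_on generalizing lo hi with
  | _ len ih =>
    rw [sampleRange]
    split_ifs with hone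
    · subst hone
      rw [blockSum_succ_self p ⟨lo, hhi⟩, blockSum_succ_self _ ⟨lo, hhi⟩, expect_bind,
        expect_exec_of_eval_eq_pure rfl, expect_pure]
    · have hleft : lo < (lo + hi) / 2 := by omega
      have hright : (lo + hi) / 2 < hi := by omega
      have hprefix {i k : ℕ} (hik : i ≤ k) : blockSum p 0 k - blockSum p 0 i = blockSum p i k :=
        sub_eq_of_eq_add' (blockSum_add_blockSum p (Nat.zero_le i) hik).symm
      simp only [expect_bind, expect_exec_coin, if_true, Bool.false_eq_true, if_false]
      simp only [expect_exec, Instr.eval, tsum_pure_mul, prefixSums, hprefix hleft.le,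
        hprefix hlo.le]
      rw [← blockSum_add_blockSum p hleft.le hright.le,
        ofReal_add_mul_coin (blockSum_nonneg hp _ _) (blockSum_nonneg hp _ _),
        ih _ (by omega) hleft _ rfl, ih _ (by omega) hright hhi rfl,
        blockSum_add_blockSum _ hleft.le hright.le]

lemma expect_sampleIndex [NeZero n] {p : Fin n → ℝ} (hp : p ∈ stdSimplex ℝ (Fin n))
    (g : Fin n → ℝ≥0∞) :
    expect (sampleIndex (prefixSums p)) g = ∑ j, ENNReal.ofReal (p j) * g j := by
  simpa only [sampleIndex, blockSum_zero_length, hp.2, ENNReal.ofReal_one, one_mul] using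
    ofReal_blockSum_mul_expect_sampleRange hp.1 g (Nat.pos_of_neZero n) le_rfl

lemma sum_mul_sq_add_sub_dotProduct_le {ι : Type*} [Fintype ι] {p x : ι → ℝ}
    (hp : p ∈ stdSimplex ℝ ι) (hx : ∀ j, |x j| ≤ 1) (c : ℝ) :
    ∑ j, p j * (c + x j - p ⬝ᵥ x) ^ 2 ≤ c ^ 2 + 1 := by
  set μ := p ⬝ᵥ x with hμ
  have hsecond : ∑ j, p j * x j ^ 2 ≤ 1 := by
    rw [← hp.2]
    exact Finset.sum_le_sum fun j _ =>
      mul_le_of_le_one_right (hp.1 j) ((sq_le_one_iff_abs_le_one _).2 (hx j))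
  have hexpand : ∑ j, p j * (c + x j - μ) ^ 2 =
      (c - μ) ^ 2 * ∑ j, p j + 2 * (c - μ) * ∑ j, p j * x j + ∑ j, p j * x j ^ 2 := by
    simp only [Finset.mul_sum, ← Finset.sum_add_distrib]
    exact Finset.sum_congr rfl fun j _ => by ring
  rw [hexpand, hp.2, ← dotProduct, ← hμ]
  nlinarith only [hsecond, sq_nonneg μ]

variable [NeZero n] {p x : Fin n → ℝ} {query : Fin n → RAM ℝ} {a q : ℕ}

lemma expect_sampleMean_sq_sub_le (hp : p ∈ stdSimplex ℝ (Fin n)) (hq : Reads query a x)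
    (hx : ∀ j, |x j| ≤ 1) (hq0 : 0 < q) :
    expect (sampleMean (prefixSums p) query q) (fun z => ENNReal.ofReal ((z - p ⬝ᵥ x) ^ 2)) ≤
      ENNReal.ofReal (1 / q) := by
  set μ := p ⬝ᵥ x
  have : (0 : ℝ) < q := Nat.cast_pos.2 hq0
  have hstep (i : Fin q) (s : ℝ) :
      expect (do let j ← sampleIndex (prefixSums p); let a ← query j; exec (.add s a))
        (fun s => ENNReal.ofReal ((s - (i + 1 : ℕ) * μ) ^ 2)) ≤
      ENNReal.ofReal ((s - i * μ) ^ 2) + 1 := by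
    simp only [expect_bind, expect_sampleIndex hp]
    calc _ ≤ ∑ j, ENNReal.ofReal (p j) * ENNReal.ofReal (((s - i * μ) + x j - μ) ^ 2) := by
          refine Finset.sum_le_sum fun j _ => mul_le_mul_right ((hq j).expect_le ?_) _
          rintro _ rfl
          rw [expect_exec_of_eval_eq_pure rfl]
          refine le_of_eq (congrArg _ ?_)
          push_cast
          ring
      _ = ENNReal.ofReal (∑ j, p j * ((s - i * μ) + x j - μ) ^ 2) := by
          rw [ENNReal.ofReal_sum_of_nonneg fun j _ => mul_nonneg (hp.1 j) (sq_nonneg _)]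
          exact Finset.sum_congr rfl fun j _ => (ENNReal.ofReal_mul (hp.1 j)).symm
      _ ≤ ENNReal.ofReal ((s - i * μ) ^ 2 + 1) :=
          ENNReal.ofReal_le_ofReal (sum_mul_sq_add_sub_dotProduct_le hp hx _)
      _ = _ := by rw [ENNReal.ofReal_add (sq_nonneg _) zero_le_one, ENNReal.ofReal_one]
  have hloop := expect_loop_add_le (st := (0 : ℝ))
    (fun i s => ENNReal.ofReal ((s - i * μ) ^ 2)) 1 hstep
  have hdiv (s : ℝ) : ENNReal.ofReal ((s / q - μ) ^ 2) =
      ENNReal.ofReal (1 / q ^ 2) * ENNReal.ofReal ((s - q * μ) ^ 2) := by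
    rw [← ENNReal.ofReal_mul (by positivity)]
    congr 1
    field_simp
  rw [sampleMean, expect_bind]
  simp only [expect_exec, Instr.eval, tsum_pure_mul, hdiv, expect_const_mul]
  calc _ ≤ ENNReal.ofReal (1 / q ^ 2) * q := mul_le_mul_right (hloop.trans (by simp)) _
    _ = ENNReal.ofReal (1 / q) := by
        rw [← ENNReal.ofReal_natCast q, ← ENNReal.ofReal_mul (by positivity)]
        congr 1
        field_simp

lemma failProb_sampleMean_le (hp : p ∈ stdSimplex ℝ (Fin n)) (hq : Reads query a x)
    (hx : ∀ j, |x j| ≤ 1) (hq0 : 0 < q) {η : ℝ} (hη : 0 < η) :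
    failProb (sampleMean (prefixSums p) query q) (fun z => |z - p ⬝ᵥ x| ≤ η) ≤
      ENNReal.ofReal (1 / (q * η ^ 2)) := by
  calc _ ≤ expect (sampleMean (prefixSums p) query q) (fun z => ENNReal.ofReal (1 / η ^ 2) *
        ENNReal.ofReal ((z - p ⬝ᵥ x) ^ 2)) := by
        refine expect_mono fun z => ?_
        split_ifs with hz
        · exact zero_le
        · rw [← ENNReal.ofReal_mul (by positivity), ← ENNReal.ofReal_one]
          refine ENNReal.ofReal_le_ofReal ?_
          rw [one_div, ← div_eq_inv_mul, one_le_div (by positivity), sq_le_sq, abs_of_pos hη]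
          exact (not_le.1 hz).le
    _ ≤ ENNReal.ofReal (1 / η ^ 2) * ENNReal.ofReal (1 / q) := by
        rw [expect_const_mul]
        exact mul_le_mul_right (expect_sampleMean_sq_sub_le hp hq hx hq0) _
    _ = ENNReal.ofReal (1 / (q * η ^ 2)) := by
        rw [← ENNReal.ofReal_mul (by positivity), div_mul_div_comm, one_mul, mul_comm (η ^ 2)]

end Sampling

/-! ### The median of means -/

section Median

variable {K : ℕ}

/-- `a` splits the array `Z` like a median; `a` need not be an entry of `Z`. -/
def IsMedian (Z : Fin K → ℝ) (a : ℝ) : Prop :=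
  2 * (Finset.univ.filter fun k => Z k < a).card ≤ K ∧
    K ≤ 2 * (Finset.univ.filter fun k => Z k ≤ a).card

/-- The witness is the least entry `a` such that at least half of the entries are `≤ a`. -/
lemma exists_isMedian (Z : Fin K → ℝ) (hK : 0 < K) : ∃ j, IsMedian Z (Z j) := by
  have : Nonempty (Fin K) := ⟨⟨0, hK⟩⟩
  set A := Finset.univ.filter fun j => K ≤ 2 * (Finset.univ.filter fun k => Z k ≤ Z j).card
    with hA
  have hAne : A.Nonempty := by
    obtain ⟨j, -, hj⟩ := Finset.exists_max_image Finset.univ Z Finset.univ_nonempty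
    refine ⟨j, Finset.mem_filter.2 ⟨Finset.mem_univ _, ?_⟩⟩
    rw [Finset.filter_true_of_mem fun k hk => hj k hk, Finset.card_univ, Fintype.card_fin]
    omega
  obtain ⟨j, hjA, hleast⟩ := Finset.exists_min_image A Z hAne
  refine ⟨j, ?_, (Finset.mem_filter.1 hjA).2⟩
  rcases (Finset.univ.filter fun k => Z k < Z j).eq_empty_or_nonempty with hempty | hne
  · simp [hempty]
  · obtain ⟨i, hi, hmax⟩ := Finset.exists_max_image _ Z hne
    have hiA : i ∉ A := fun h => (hleast i h).not_gt (Finset.mem_filter.1 hi).2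
    have hminority : 2 * (Finset.univ.filter fun k => Z k ≤ Z i).card < K := by
      simpa [hA] using hiA
    have := Finset.card_le_card (show (Finset.univ.filter fun k => Z k < Z j) ⊆
      Finset.univ.filter fun k => Z k ≤ Z i from
        fun k hk => Finset.mem_filter.2 ⟨Finset.mem_univ _, hmax k hk⟩)
    omega

lemma IsMedian.abs_sub_le {Z : Fin K → ℝ} {a μ η : ℝ} (h : IsMedian Z a)
    (hbad : 2 * (Finset.univ.filter fun k => ¬ |Z k - μ| ≤ η).card < K) : |a - μ| ≤ η := by
  have hsum := Finset.card_filter_add_card_filter_not (s := (Finset.univ : Finset (Fin K)))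
    fun k => |Z k - μ| ≤ η
  rw [Finset.card_univ, Fintype.card_fin] at hsum
  by_contra! hcon
  rcases lt_abs.1 hcon with habove | hbelow
  · have hgood : (Finset.univ.filter fun k => |Z k - μ| ≤ η) ⊆
        Finset.univ.filter fun k => Z k < a :=
      Finset.monotone_filter_right _ fun k _ hk => by linarith [(abs_le.1 hk).2]
    have := Finset.card_le_card hgood
    have := h.1
    omega
  · have hgood : (Finset.univ.filter fun k => Z k ≤ a) ⊆
        Finset.univ.filter fun k => ¬ |Z k - μ| ≤ η :=
      Finset.monotone_filter_right _ fun k _ hk hk' => by linarith [(abs_le.1 hk').1]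
    have := Finset.card_le_card hgood
    have := h.2
    omega

/-- The number of entries below `i` of an array that satisfy `P`. -/
def countBelow {α : Type*} (P : α → Prop) [DecidablePred P] (Z : Fin K → α) (i : ℕ) : ℕ :=
  blockSum (fun k => if P (Z k) then 1 else 0) 0 i

section CountBelow

variable {α : Type*} (P : α → Prop) [DecidablePred P] (Z : Fin K → α)

lemma countBelow_zero : countBelow P Z 0 = 0 := by rw [countBelow, blockSum_self]

lemma countBelow_succ (i : Fin K) :
    countBelow P Z (i + 1) = countBelow P Z i + if P (Z i) then 1 else 0 :=
  blockSum_zero_succ _ i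

lemma countBelow_length : countBelow P Z K = (Finset.univ.filter fun k => P (Z k)).card := by
  rw [countBelow, blockSum_zero_length, Finset.card_filter]

lemma countBelow_update_succ (i : Fin K) (a : α) :
    countBelow P (Function.update Z i a) (i + 1) =
      countBelow P Z i + if P a then 1 else 0 := by
  have hbelow : countBelow P (Function.update Z i a) i = countBelow P Z i := by
    rw [countBelow, countBelow, blockSum, blockSum]
    refine Finset.sum_congr rfl fun k hk => ?_
    rw [Function.update_of_ne (Fin.ne_of_lt (Finset.mem_filter.1 hk).2.2)]
  rw [countBelow_succ, Function.update_self, hbelow]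

end CountBelow

lemma ensures_median (Z : Fin K → ℝ) :
    Ensures (median Z) (K * (6 * K + 4)) fun a => 0 < K → IsMedian Z a := by
  classical
  refine (ensures_loop (b := 6 * K + 3)
    (fun i cur => (∃ j : Fin K, j.val < i ∧ IsMedian Z (Z j)) → IsMedian Z cur)
    (by simp) fun i cur hcur => ?_).mono le_rfl fun a ha hK => ?_
  · refine Ensures.exec_bind (b := 6 * K + 2) rfl ((Ensures.bind (b := K * 6) (b' := 2)
      (ensures_loop (b := 5) (fun k (c : ℕ × ℕ) =>
        c = (countBelow (· < Z i) Z k, countBelow (· ≤ Z i) Z k))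
        (by simp only [countBelow_zero]) ?_) ?_).mono_cost (by omega))
    · rintro k _ rfl
      iterate 5 refine Ensures.exec_bind rfl ?_
      refine ensures_pure ?_
      simp only [countBelow_succ, decide_eq_true_eq, ← not_lt]
      split_ifs <;> rfl
    · rintro _ rfl
      iterate 2 refine Ensures.exec_bind rfl ?_
      refine ensures_pure ?_
      rintro ⟨j, hj, hjm⟩
      simp only [countBelow_length]
      split_ifs with hm
      · exact hm
      · have hne : j.val ≠ i.val := fun h => hm (Fin.ext h ▸ hjm)
        exact hcur ⟨j, by omega, hjm⟩
  · obtain ⟨j, hj⟩ := exists_isMedian Z hK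
    exact ha ⟨j, j.2, hj⟩

end Median

section EstimateInner

variable {n : ℕ} [NeZero n] {query : Fin n → RAM ℝ} {a : ℕ} {x : Fin n → ℝ}

/-- A step bound for `estimateInner` in dimension `n`, where reading one feature costs at most
`a`. -/
def estimateInnerCost (n a K q : ℕ) : ℕ := K * (q * (10 * Nat.clog 2 n + a + 3) + 6 * K + 7)

lemma ensures_estimateInner (S : Fin (n + 1) → ℝ) (hq : Reads query a x) (K q : ℕ) :
    Ensures (estimateInner S query K q) (estimateInnerCost n a K q) fun _ => True :=
  ((ensures_loop (fun _ _ => True) trivial fun _ _ _ => (ensures_sampleMean S hq q).bind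
    fun _ _ => ensures_exec_of_eval_eq_pure rfl trivial).bind
      fun Z _ => (ensures_median Z).mono le_rfl fun _ _ => trivial).mono_cost
        (by rw [estimateInnerCost]; exact le_of_eq (by ring))

/-- The exponential moment behind the Chernoff bound for the number of unsuccessful runs. -/
lemma expect_pow_countBelow_le {K : ℕ} {c : RAM ℝ} (P : ℝ → Prop) [DecidablePred P] {x : ℝ≥0∞}
    (hc : failProb c (fun z => ¬ P z) ≤ x) :
    expect (loop K (fun i Z => do let z ← c; exec (.write Z i z)) fun _ => 0)
      (fun Z => 4 ^ countBelow P Z K) ≤ (1 + 3 * x) ^ K := by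
  have hstep (i : Fin K) (Z : Fin K → ℝ) :
      expect (do let z ← c; exec (.write Z i z)) (fun Z => 4 ^ countBelow P Z (i + 1)) ≤
        (1 + 3 * x) * 4 ^ countBelow P Z i := by
    have hfactor (z : ℝ) : (4 : ℝ≥0∞) ^ countBelow P (Function.update Z i z) (i + 1) =
        4 ^ countBelow P Z i * (1 + 3 * if ¬ P z then 0 else 1) := by
      rw [countBelow_update_succ, pow_add]
      by_cases hz : P z
      · simp only [hz, if_true, not_true_eq_false, if_false]
        norm_num
      · simp [hz]
    simp only [expect_bind, expect_exec, Instr.eval, tsum_pure_mul, hfactor, expect_const_mul,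
      expect_add, expect_const]
    rw [mul_comm]
    refine mul_le_mul_left (add_le_add_right (mul_le_mul_right ?_ _) _) _
    convert hc using 1
    rw [failProb]
    congr!
  simpa only [countBelow_zero, pow_zero, mul_one] using
    expect_loop_mul_le (fun i Z => 4 ^ countBelow P Z i) _ hstep

lemma half_mul_pow_le_exp (K : ℕ) : (1 / 2 * (5 / 3) : ℝ) ^ K ≤ Real.exp (-(K / 6)) := by
  have hbase : (1 / 2 * (5 / 3) : ℝ) ≤ Real.exp (-(1 / 6)) := by
    linarith [Real.add_one_le_exp (-(1 / 6) : ℝ)]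
  calc (1 / 2 * (5 / 3) : ℝ) ^ K ≤ Real.exp (-(1 / 6)) ^ K := by gcongr
    _ = Real.exp (-(K / 6)) := by rw [← Real.exp_nat_mul]; ring_nf

/-- If the median is off, then at least `K / 2` of the means are off, so that
`(1 / 2) ^ K * 4 ^ #bad ≥ 1`; this quantity has expectation at most `(1 / 2 * 5 / 3) ^ K`. -/
lemma failProb_estimateInner_le {p : Fin n → ℝ} (hp : p ∈ stdSimplex ℝ (Fin n))
    (hq : Reads query a x) (hx : ∀ j, |x j| ≤ 1) {K : ℕ} (hK : 0 < K)
    {q : ℕ} {η : ℝ} (hη : 0 < η) (hqη : 9 / 2 / η ^ 2 ≤ q) :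
    failProb (estimateInner (prefixSums p) query K q) (fun z => |z - p ⬝ᵥ x| ≤ η) ≤
      ENNReal.ofReal (Real.exp (-(K / 6))) := by
  set μ := p ⬝ᵥ x
  have hq0 : (0 : ℝ) < q := lt_of_lt_of_le (by positivity) hqη
  have hmean : failProb (sampleMean (prefixSums p) query q) (fun z => ¬ ¬ |z - μ| ≤ η) ≤
      ENNReal.ofReal (2 / 9) := by
    simp only [not_not]
    refine (failProb_sampleMean_le hp hq hx (Nat.cast_pos.1 hq0) hη).trans
      (ENNReal.ofReal_le_ofReal ?_)
    rw [div_le_iff₀ (by positivity)] at hqη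
    rw [div_le_iff₀ (by positivity)]
    linarith
  have hmoment := expect_pow_countBelow_le (K := K) _ hmean
  have hmedian (Z : Fin K → ℝ) : failProb (median Z) (fun z => |z - μ| ≤ η) ≤
      ENNReal.ofReal ((1 / 2) ^ K) * 4 ^ countBelow (fun z => ¬ |z - μ| ≤ η) Z K := by
    refine (ensures_median Z).expect_le fun z hz => ?_
    split_ifs with hzη
    · exact zero_le
    have hbad := not_lt.1 fun h => hzη ((hz hK).abs_sub_le h)
    rw [countBelow_length, show (4 : ℝ≥0∞) = ENNReal.ofReal (2 ^ 2) by norm_num,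
      ← ENNReal.ofReal_pow (by positivity), ← ENNReal.ofReal_mul (by positivity), ← pow_mul,
      ← ENNReal.ofReal_one]
    refine ENNReal.ofReal_le_ofReal ?_
    calc (1 : ℝ) = (1 / 2) ^ K * 2 ^ K := by rw [← mul_pow]; norm_num
      _ ≤ _ := by gcongr; norm_num
  calc _ ≤ ENNReal.ofReal ((1 / 2) ^ K) * (1 + 3 * ENNReal.ofReal (2 / 9)) ^ K := by
        rw [failProb, estimateInner, expect_bind]
        refine (RAM.expect_mono hmedian).trans ?_
        rw [expect_const_mul]
        exact mul_le_mul_right hmoment _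
    _ = ENNReal.ofReal ((1 / 2 * (5 / 3)) ^ K) := by
        rw [← ENNReal.ofReal_one, show (3 : ℝ≥0∞) = ENNReal.ofReal 3 by norm_num,
          ← ENNReal.ofReal_mul (by norm_num), ← ENNReal.ofReal_add (by norm_num) (by norm_num),
          ← ENNReal.ofReal_pow (by norm_num), ← ENNReal.ofReal_mul (by positivity), ← mul_pow]
        norm_num
    _ ≤ _ := ENNReal.ofReal_le_ofReal (half_mul_pow_le_exp K)

end EstimateInner

/-! ### The rounds of the algorithm -/

section Rounds

variable {N n M : ℕ}

lemma normalized_mem_stdSimplex [NeZero n] {w : Fin n → ℝ} (hw : ∀ j, 0 < w j) :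
    normalized w ∈ stdSimplex ℝ (Fin n) := by
  have hpos : 0 < ∑ i, w i := Finset.sum_pos (fun i _ => hw i) Finset.univ_nonempty
  refine ⟨fun j => (div_pos (hw j) hpos).le, ?_⟩
  simp only [normalized, ← Finset.sum_div, div_self hpos.ne']

/-- The vector `λ p` that belongs to the weights `w`. -/
noncomputable def predictor (P : Params) (w : Fin n → ℝ) : Fin n → ℝ := P.lam • normalized w

/-- The loss vector `l^(t)` of a round on the example `ex` that starts with the weights `w`. -/
noncomputable def lossVec (P : Params) (φ : (Fin N → ℝ) → Fin n → ℝ) (w : Fin n → ℝ)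
    (ex : Example N) (j : Fin n) : ℝ :=
  (1 + (P.act (P.lam * (normalized w ⬝ᵥ φ ex.1)) - ex.2) * φ ex.1 j) / 2

/-- The weights after a round on the example `ex`, for the feature map `φ`. -/
noncomputable def nextWeights (P : Params) (φ : (Fin N → ℝ) → Fin n → ℝ) (w : Fin n → ℝ)
    (ex : Example N) : Fin n → ℝ :=
  fun j => w j * P.beta ^ lossVec P φ w ex j

/-- The weights `w^(t+1)` after the `t` rounds on the examples of `train`. -/
noncomputable def weightsAfter (P : Params) (φ : (Fin N → ℝ) → Fin n → ℝ) :
    (t : ℕ) → (Fin t → Example N) → Fin n → ℝ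
  | 0, _ => fun _ => 1 / n
  | t + 1, train =>
      nextWeights P φ (weightsAfter P φ t (Fin.init train)) (train (Fin.last t))

/-- The candidates for the output: the vectors `λ p` of all rounds. -/
def visited (P : Params) (φ : (Fin N → ℝ) → Fin n → ℝ) :
    (t : ℕ) → (Fin t → Example N) → Set (Fin n → ℝ)
  | 0, _ => ∅
  | t + 1, train =>
      insert (predictor P (weightsAfter P φ t (Fin.init train))) (visited P φ t (Fin.init train))

/-- The empirical risk of the linear form `u` in the features `φ` on the examples `test`. -/
noncomputable def empRisk (act : ℝ → ℝ) (φ : (Fin N → ℝ) → Fin n → ℝ) (test : Fin M → Example N)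
    (u : Fin n → ℝ) : ℝ :=
  (∑ m, (act (u ⬝ᵥ φ (test m).1) - (test m).2) ^ 2) / M

/-- The number of means whose median is taken. -/
noncomputable def numReps (P : Params) (T M : ℕ) : ℕ := ⌈6 * Real.log (M * T / P.delta)⌉₊

/-- The number of samples in one mean. -/
noncomputable def numSamples (P : Params) : ℕ :=
  max 1 ⌈9 / 2 * (16 * P.lam / P.eps * (16 * P.lam / P.eps))⌉₊

/-- A step bound for `approxRisk`, where reading one feature costs at most `a`. -/
noncomputable def approxRiskCost (P : Params) (n T M a : ℕ) : ℕ :=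
  4 * n + 13 + M * (estimateInnerCost n a (numReps P T M) (numSamples P) + 7)

/-- A step bound for `oneRound`, where reading one feature costs at most `a`. -/
noncomputable def oneRoundCost (P : Params) (n T M a : ℕ) : ℕ :=
  n * (2 * a + 23) + 6 + approxRiskCost P n T M a

lemma ensures_repetitions (P : Params) (T M : ℕ) :
    Ensures (repetitions P T M) 5 fun K => K = numReps P T M := by
  iterate 4 refine Ensures.exec_bind rfl ?_
  exact ensures_exec_of_eval_eq_pure rfl rfl

lemma ensures_batchSize (P : Params) : Ensures (batchSize P) 6 fun q => q = numSamples P := by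
  iterate 6 refine Ensures.exec_bind rfl ?_
  exact ensures_pure rfl

/-- The better one of the stored pair `best` and the new candidate `v` with approximate risk `r`. -/
noncomputable def updateBest (best : Option (ℝ × (Fin n → ℝ))) (r : ℝ) (v : Fin n → ℝ) :
    Option (ℝ × (Fin n → ℝ)) :=
  match best with
  | none => some (r, v)
  | some b => if r < b.1 then some (r, v) else some b

lemma updateBest_eq_or (best : Option (ℝ × (Fin n → ℝ))) (r : ℝ) (v : Fin n → ℝ) :
    updateBest best r v = some (r, v) ∨ best ≠ none ∧ updateBest best r v = best := by
  rcases best with _ | b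
  · exact Or.inl rfl
  · rw [updateBest]
    split_ifs
    exacts [Or.inl rfl, Or.inr ⟨Option.some_ne_none b, rfl⟩]

/-- The last part of `oneRound`: store the new candidate if it is better than the old one. -/
noncomputable def storeBetter (lam : ℝ) (p w : Fin n → ℝ) (best : Option (ℝ × (Fin n → ℝ)))
    (r : ℝ) : RAM (State n) := do
  exec .index
  let better ← match best with
    | none => pure true
    | some b => exec (.less r b.1)
  if better then do
    let v ← scale lam p
    pure ⟨w, some (r, v)⟩
  else pure ⟨w, best⟩

lemma ensures_storeBetter (lam : ℝ) (p w : Fin n → ℝ) (best : Option (ℝ × (Fin n → ℝ)))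
    (r : ℝ) : Ensures (storeBetter lam p w best r) (n * 4 + 2) fun s =>
      s = ⟨w, updateBest best r (lam • p)⟩ := by
  have hscale : Ensures (do let v ← scale lam p; pure (⟨w, some (r, v)⟩ : State n)) (n * 4)
      fun s => s = ⟨w, some (r, lam • p)⟩ := by
    refine (ensures_scale lam p).bind (b' := 0) ?_
    rintro _ rfl
    exact ensures_pure rfl
  refine Ensures.exec_bind rfl ?_
  rcases best with _ | b
  · simp only [pure_bind]
    exact hscale.mono_cost (Nat.le_succ _)
  · refine Ensures.exec_bind rfl ?_
    by_cases hr : r < b.1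
    · simpa only [updateBest, decide_eq_true hr, if_pos hr, if_true] using hscale
    · simpa only [updateBest, decide_eq_false hr, if_neg hr, Bool.false_eq_true, if_false] using
        (ensures_pure (P := (· = _)) rfl).mono_cost (Nat.zero_le _)

variable [NeZero n] {access : (Fin N → ℝ) → Fin n → RAM ℝ} {a : ℕ}
  {φ : (Fin N → ℝ) → Fin n → ℝ} {P : Params} {T : ℕ} {test : Fin M → Example N}

lemma ensures_approxRisk (hacc : ∀ x, Reads (access x) a (φ x)) (p : Fin n → ℝ) :
    Ensures (approxRisk access P T test p) (approxRiskCost P n T M a) fun _ => True := by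
  rw [show approxRiskCost P n T M a = (n * 4 + 1) + (5 + (6 +
    (M * (estimateInnerCost n a (numReps P T M) (numSamples P) + 6 + 1) + 1))) by
      rw [approxRiskCost]; ring]
  refine (ensures_prepareSampling p).bind fun S _ => (ensures_repetitions P T M).bind ?_
  rintro _ rfl
  refine (ensures_batchSize P).bind ?_
  rintro _ rfl
  refine Ensures.bind (P := fun _ => True) (ensures_loop (fun _ _ => True) trivial
    fun m s _ => ?_) fun s _ => ensures_exec_of_eval_eq_pure rfl trivial
  refine (ensures_estimateInner S (hacc _) _ _).bind fun z _ => ?_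
  iterate 5 refine Ensures.exec_bind rfl ?_
  exact ensures_exec_of_eval_eq_pure rfl trivial

lemma ensures_oneRound (hacc : ∀ x, Reads (access x) a (φ x)) (ex : Example N) (st : State n) :
    Ensures (oneRound access P T test ex st) (oneRoundCost P n T M a) fun s =>
      ∃ r, s = ⟨nextWeights P φ st.weights ex, updateBest st.best r (predictor P st.weights)⟩ := by
  rw [show oneRoundCost P n T M a = (n * 3 + n * 4) + (n * (a + 4) + (n * (a + 8) +
    (approxRiskCost P n T M a + (n * 4 + 2)) + 4)) by rw [oneRoundCost]; ring]
  refine (ensures_normalizeWeights _).bind ?_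
  rintro _ rfl
  refine (ensures_innerProduct _ (hacc _)).bind ?_
  rintro _ rfl
  iterate 4 refine Ensures.exec_bind rfl ?_
  refine (ensures_updateWeights _ _ (hacc _) _).bind ?_
  rintro _ rfl
  exact (ensures_approxRisk hacc _).bind fun r _ =>
    (ensures_storeBetter _ _ _ st.best r).mono le_rfl fun _ hs => ⟨r, hs⟩

lemma failProb_oneRound_le (hacc : ∀ x, Reads (access x) a (φ x)) (ex : Example N)
    (st : State n) (Q : ℝ → Prop) :
    failProb (oneRound access P T test ex st) (fun s => ∃ r, Q r ∧
      s = ⟨nextWeights P φ st.weights ex, updateBest st.best r (predictor P st.weights)⟩) ≤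
    failProb (approxRisk access P T test (normalized st.weights)) Q := by
  refine (ensures_normalizeWeights _).failProb_bind_le ?_
  rintro _ rfl
  refine (ensures_innerProduct _ (hacc _)).failProb_bind_le ?_
  rintro _ rfl
  iterate 4 rw [failProb_exec_bind rfl]
  refine (ensures_updateWeights _ _ (hacc _) _).failProb_bind_le ?_
  rintro _ rfl
  refine (failProb_bind_le fun r hr => ?_).trans_eq (add_zero _)
  exact (((ensures_storeBetter _ _ _ st.best r).mono le_rfl
    fun _ hs => ⟨r, hr, hs⟩).failProb_eq_zero).le

lemma stateAfter_succ (access : (Fin N → ℝ) → Fin n → RAM ℝ) (P : Params) (T : ℕ)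
    (test : Fin M → Example N) {t : ℕ} (train : Fin (t + 1) → Example N) :
    stateAfter access P T test train = (do
      let s ← stateAfter access P T test (Fin.init train)
      exec .index
      oneRound access P T test (train (Fin.last t)) s) := by
  simp only [stateAfter, loop, bind_assoc]
  rfl

lemma stateAfter_zero (access : (Fin N → ℝ) → Fin n → RAM ℝ) (P : Params) (T : ℕ)
    (test : Fin M → Example N) (train : Fin 0 → Example N) :
    stateAfter access P T test train = initState n :=
  bind_pure _

end Rounds

section Output

lemma abs_sq_sub_sub_sq_sub_le {s s' y : ℝ} (hs : s ∈ Set.Icc (0 : ℝ) 1)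
    (hs' : s' ∈ Set.Icc (0 : ℝ) 1) (hy : y ∈ Set.Icc (0 : ℝ) 1) :
    |(s - y) ^ 2 - (s' - y) ^ 2| ≤ 2 * |s - s'| := by
  have hsum : |s + s' - 2 * y| ≤ 2 :=
    abs_le.2 ⟨by linarith [hs.1, hs'.1, hy.2], by linarith [hs.2, hs'.2, hy.1]⟩
  calc |(s - y) ^ 2 - (s' - y) ^ 2| = |s + s' - 2 * y| * |s - s'| := by rw [← abs_mul]; ring_nf
    _ ≤ 2 * |s - s'| := mul_le_mul_of_nonneg_right hsum (abs_nonneg _)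

lemma abs_loss_sub_loss_le {act : ℝ → ℝ} (hlip : LipschitzWith 1 act)
    (hact : ∀ z, act z ∈ Set.Icc (0 : ℝ) 1) {y : ℝ} (hy : y ∈ Set.Icc (0 : ℝ) 1) (z z' : ℝ) :
    |(act z - y) ^ 2 - (act z' - y) ^ 2| ≤ 2 * |z - z'| := by
  have hdist := hlip.dist_le_mul z z'
  rw [Real.dist_eq, Real.dist_eq, NNReal.coe_one, one_mul] at hdist
  linarith [abs_sq_sub_sub_sq_sub_le (hact z) (hact z') hy]

lemma le_numSamples (P : Params) : 9 / 2 / (P.eps / (16 * P.lam)) ^ 2 ≤ (numSamples P : ℝ) := by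
  calc 9 / 2 / (P.eps / (16 * P.lam)) ^ 2
      = 9 / 2 * (16 * P.lam / P.eps * (16 * P.lam / P.eps)) := by
        rw [← sq, div_eq_mul_inv (9 / 2 : ℝ), ← inv_pow, inv_div]
    _ ≤ numSamples P := (Nat.le_ceil _).trans (Nat.cast_le.2 (le_max_right _ _))

variable {N n M : ℕ}

/-- The stored pair is a candidate of `V` together with an approximation of its risk `emp` up to an
error `τ`, and no candidate of `V` has a risk that is smaller by more than `τ`. -/
def Tracks (emp : (Fin n → ℝ) → ℝ) (τ : ℝ) (V : Set (Fin n → ℝ)) :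
    Option (ℝ × (Fin n → ℝ)) → Prop
  | none => V = ∅
  | some b => b.2 ∈ V ∧ |b.1 - emp b.2| ≤ τ ∧ ∀ u ∈ V, b.1 ≤ emp u + τ

lemma Tracks.insert_updateBest {emp : (Fin n → ℝ) → ℝ} {τ : ℝ} {V : Set (Fin n → ℝ)}
    {best : Option (ℝ × (Fin n → ℝ))} (h : Tracks emp τ V best) {r : ℝ} {v : Fin n → ℝ}
    (hr : |r - emp v| ≤ τ) : Tracks emp τ (insert v V) (updateBest best r v) := by
  have hrv : r ≤ emp v + τ := by linarith [(abs_le.1 hr).2]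
  rcases best with _ | b
  · obtain rfl : V = ∅ := h
    exact ⟨Set.mem_insert _ _, hr, Set.forall_mem_insert.2 ⟨hrv, fun u hu => hu.elim⟩⟩
  · obtain ⟨hmem, happrox, hmin⟩ := h
    rw [updateBest]
    split_ifs with hlt
    · exact ⟨Set.mem_insert _ _, hr,
        Set.forall_mem_insert.2 ⟨hrv, fun u hu => hlt.le.trans (hmin u hu)⟩⟩
    · exact ⟨Set.mem_insert_of_mem _ hmem, happrox,
        Set.forall_mem_insert.2 ⟨(not_lt.1 hlt).trans hrv, hmin⟩⟩

variable [NeZero n] {access : (Fin N → ℝ) → Fin n → RAM ℝ} {a : ℕ}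
  {φ : (Fin N → ℝ) → Fin n → ℝ} {P : Params} {T : ℕ} {test : Fin M → Example N}

lemma ensures_stateAfter (hacc : ∀ x, Reads (access x) a (φ x)) {t : ℕ}
    (train : Fin t → Example N) :
    Ensures (stateAfter access P T test train)
      (2 * n + 1 + t * (oneRoundCost P n T M a + 1)) fun s =>
      s.weights = weightsAfter P φ t train ∧
      (s.best = none ∧ t = 0 ∨ ∃ r, ∃ v ∈ visited P φ t train, s.best = some (r, v)) := by
  induction t with
  | zero =>
    rw [stateAfter_zero]
    refine (ensures_initState n).mono (by omega) ?_
    rintro _ rfl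
    exact ⟨rfl, Or.inl ⟨rfl, rfl⟩⟩
  | succ t ih =>
    rw [stateAfter_succ, show 2 * n + 1 + (t + 1) * (oneRoundCost P n T M a + 1) =
      2 * n + 1 + t * (oneRoundCost P n T M a + 1) + (oneRoundCost P n T M a + 1) by ring]
    refine (ih (Fin.init train)).bind ?_
    rintro ⟨w, best⟩ ⟨rfl, hbest⟩
    refine Ensures.exec_bind rfl ((ensures_oneRound hacc (train (Fin.last t)) _).mono le_rfl ?_)
    rintro _ ⟨r, rfl⟩
    refine ⟨rfl, Or.inr ?_⟩
    obtain hnew | ⟨hne, hold⟩ := updateBest_eq_or best r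
      (predictor P (weightsAfter P φ t (Fin.init train)))
    · exact ⟨r, _, Set.mem_insert _ _, hnew⟩
    · obtain ⟨hnone, -⟩ | ⟨r', v, hv, hsome⟩ := hbest
      · exact absurd hnone hne
      · exact ⟨r', v, Set.mem_insert_of_mem _ hv, hold.trans hsome⟩

lemma ensures_learn (hacc : ∀ x, Reads (access x) a (φ x)) (hT : 0 < T)
    (train : Fin T → Example N) :
    Ensures (learn access P train test) (2 * n + 2 + T * (oneRoundCost P n T M a + 1))
      fun u => u ∈ visited P φ T train := by
  refine Ensures.mono_cost (b := 2 * n + 1 + T * (oneRoundCost P n T M a + 1) + (0 + 1))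
    ((ensures_stateAfter hacc train).bind ?_) (by omega)
  rintro ⟨w, best⟩ ⟨-, ⟨-, h0⟩ | ⟨r, v, hv, rfl⟩⟩
  · exact absurd h0 hT.ne'
  · exact Ensures.exec_bind rfl (ensures_pure hv)

lemma failProb_approxRisk_le (hacc : ∀ x, Reads (access x) a (φ x))
    (hlip : LipschitzWith 1 P.act) (hact : ∀ z, P.act z ∈ Set.Icc (0 : ℝ) 1)
    (hlam : 0 < P.lam) (heps : 0 < P.eps) (hM : 0 < M) (hK : 0 < numReps P T M)
    (htest : ∀ m, (∀ j, |φ (test m).1 j| ≤ 1) ∧ (test m).2 ∈ Set.Icc (0 : ℝ) 1)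
    {p : Fin n → ℝ} (hp : p ∈ stdSimplex ℝ (Fin n)) :
    failProb (approxRisk access P T test p)
      (fun r => |r - empRisk P.act φ test (P.lam • p)| ≤ P.eps / 8) ≤
      M * ENNReal.ofReal (Real.exp (-(numReps P T M / 6))) := by
  set loss : Fin M → ℝ := fun m => (P.act ((P.lam • p) ⬝ᵥ φ (test m).1) - (test m).2) ^ 2
  have hM' : (0 : ℝ) < M := Nat.cast_pos.2 hM
  refine (ensures_prepareSampling p).failProb_bind_le ?_
  rintro _ rfl
  refine (ensures_repetitions P T M).failProb_bind_le ?_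
  rintro _ rfl
  refine (ensures_batchSize P).failProb_bind_le ?_
  rintro _ rfl
  refine (failProb_bind_le (P := fun s : ℝ => |s - blockSum loss 0 M| ≤ M * (P.eps / 8))
    fun s hs => ?_).trans ((add_zero _).trans_le
      (failProb_loop_le (fun i s => |s - blockSum loss 0 i| ≤ i * (P.eps / 8)) (by simp) _ ?_))
  · refine (ensures_exec_of_eval_eq_pure rfl ?_).failProb_eq_zero.le
    rw [blockSum_zero_length] at hs
    rw [empRisk, ← sub_div, abs_div, abs_of_pos hM', div_le_iff₀ hM']
    linarith
  intro m s hs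
  refine (failProb_bind_le fun z hz => ?_).trans ((add_zero _).trans_le
    (failProb_estimateInner_le hp (hacc (test m).1) (htest m).1 hK
      (η := P.eps / (16 * P.lam)) (by positivity) (le_numSamples P)))
  iterate 5 rw [failProb_exec_bind rfl]
  refine (ensures_exec_of_eval_eq_pure rfl ?_).failProb_eq_zero.le
  have hmargin : |P.lam * z - (P.lam • p) ⬝ᵥ φ (test m).1| ≤ P.eps / 16 := by
    rw [smul_dotProduct, smul_eq_mul, ← mul_sub, abs_mul, abs_of_pos hlam]
    calc P.lam * |z - p ⬝ᵥ φ (test m).1| ≤ P.lam * (P.eps / (16 * P.lam)) := by gcongr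
      _ = P.eps / 16 := by field_simp
  have hloss : |(P.act (P.lam * z) - (test m).2) ^ 2 - loss m| ≤ P.eps / 8 := by
    linarith [abs_loss_sub_loss_le hlip hact (htest m).2 (P.lam * z)
      ((P.lam • p) ⬝ᵥ φ (test m).1)]
  rw [blockSum_zero_succ, ← sq, add_sub_add_comm, Nat.cast_succ, add_one_mul]
  exact (abs_add_le _ _).trans (add_le_add hs hloss)

lemma failProb_stateAfter_le (hacc : ∀ x, Reads (access x) a (φ x)) {emp : (Fin n → ℝ) → ℝ}
    {τ : ℝ} {x : ℝ≥0∞} {t : ℕ}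
    (hx : ∀ (t : ℕ) (train : Fin t → Example N), failProb (approxRisk access P T test
      (normalized (weightsAfter P φ t train)))
      (fun r => |r - emp (predictor P (weightsAfter P φ t train))| ≤ τ) ≤ x)
    (train : Fin t → Example N) :
    failProb (stateAfter access P T test train) (fun s => s.weights = weightsAfter P φ t train ∧
      Tracks emp τ (visited P φ t train) s.best) ≤ t * x := by
  induction t with
  | zero =>
    rw [stateAfter_zero, ((ensures_initState n).mono (Q := fun s => s.weights = _ ∧ _)
      le_rfl ?_).failProb_eq_zero]
    · exact zero_le
    · rintro _ rfl
      exact ⟨rfl, rfl⟩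
  | succ t ih =>
    rw [stateAfter_succ, Nat.cast_succ, add_one_mul]
    refine (failProb_bind_le ?_).trans (add_le_add_left (ih (Fin.init train)) x)
    rintro ⟨_, best⟩ ⟨rfl, hbest⟩
    rw [failProb_exec_bind rfl]
    refine (failProb_mono ?_).trans
      ((failProb_oneRound_le hacc _ _ _).trans (hx t (Fin.init train)))
    rintro _ ⟨r, hr, rfl⟩
    exact ⟨rfl, hbest.insert_updateBest hr⟩

lemma failProb_learn_le (hacc : ∀ x, Reads (access x) a (φ x)) (hT : 0 < T)
    {train : Fin T → Example N} {emp : (Fin n → ℝ) → ℝ} {τ : ℝ} {x : ℝ≥0∞}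
    (hx : ∀ (t : ℕ) (train : Fin t → Example N), failProb (approxRisk access P T test
      (normalized (weightsAfter P φ t train)))
      (fun r => |r - emp (predictor P (weightsAfter P φ t train))| ≤ τ) ≤ x) :
    failProb (learn access P train test) (fun u => u ∈ visited P φ T train ∧
      ∀ v ∈ visited P φ T train, emp u ≤ emp v + 2 * τ) ≤ T * x := by
  refine (failProb_bind_le ?_).trans ((add_zero _).trans_le
    (failProb_stateAfter_le hacc hx train))
  rintro ⟨_, best⟩ ⟨-, hbest⟩
  rw [failProb_exec_bind rfl]
  rcases best with _ | b
  · obtain ⟨t, rfl⟩ := Nat.exists_eq_succ_of_ne_zero hT.ne'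
    exact absurd hbest (Set.insert_nonempty _ _).ne_empty
  · obtain ⟨hmem, happrox, hmin⟩ := hbest
    refine (ensures_pure ⟨hmem, fun v hv => ?_⟩).failProb_eq_zero.le
    linarith [hmin v hv, (abs_le.1 happrox).1]

end Output

/-! ### Run time -/

section RunTime

lemma one_le_log_of_three_le {x : ℝ} (hx : 3 ≤ x) : 1 ≤ Real.log x := by
  rw [Real.le_log_iff_exp_le (by linarith)]
  linarith [Real.exp_one_lt_d9]

lemma clog_two_le {n : ℕ} {x : ℝ} (h3 : 3 ≤ x) (hn : (n : ℝ) ≤ x ^ 2) :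
    (Nat.clog 2 n : ℝ) ≤ 5 * Real.log x := by
  have hlog := one_le_log_of_three_le h3
  rcases Nat.lt_or_ge 1 n with h1 | h1
  · obtain ⟨c, hc⟩ := Nat.exists_eq_succ_of_ne_zero (Nat.clog_pos one_lt_two h1).ne'
    have hlt : 2 ^ c < n := by simpa only [hc, Nat.pred_succ] using
      Nat.pow_pred_clog_lt_self one_lt_two h1
    have hpow : (2 : ℝ) ^ c ≤ x ^ 2 := le_trans (by exact_mod_cast hlt.le) hn
    have hlogpow := Real.log_le_log (by positivity) hpow
    rw [Real.log_pow, Real.log_pow, Nat.cast_ofNat] at hlogpow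
    have hc2 : (c : ℝ) * (1 / 2) ≤ c * Real.log 2 :=
      mul_le_mul_of_nonneg_left (by linarith [Real.log_two_gt_d9]) c.cast_nonneg
    rw [hc, Nat.cast_succ]
    linarith
  · rw [Nat.clog_of_right_le_one h1, Nat.cast_zero]
    linarith

section Bounds

variable {act : ℝ → ℝ} {lam eps delta : ℝ} {n N T M : ℕ}

lemma numReps_le (hT : 1 ≤ T) (hdelta : 0 < delta) {x : ℝ} (h3 : 3 ≤ x) (hTx : T ≤ x)
    (hMx : M ≤ x) (hdx : 1 / delta ≤ x) :
    (numReps (parameters act lam eps delta n T) T M : ℝ) ≤ 25 * Real.log x := by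
  have hlog := one_le_log_of_three_le h3
  have : (1 : ℝ) ≤ T := Nat.one_le_cast.2 hT
  have hlogle : Real.log (M * T / (delta / 3)) ≤ 4 * Real.log x := by
    rcases Nat.eq_zero_or_pos M with rfl | hM
    · simp only [Nat.cast_zero, zero_mul, zero_div, Real.log_zero]
      linarith
    · have : (1 : ℝ) ≤ M := Nat.one_le_cast.2 hM
      rw [show 4 * Real.log x = Real.log (x ^ 4) by rw [Real.log_pow, Nat.cast_ofNat]]
      refine Real.log_le_log (by positivity) ?_
      calc (M : ℝ) * T / (delta / 3) = M * T * (1 / delta) * 3 := by field_simp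
        _ ≤ x * x * x * x := by gcongr
        _ = x ^ 4 := by ring
  calc (numReps (parameters act lam eps delta n T) T M : ℝ) ≤ (⌈24 * Real.log x⌉₊ : ℝ) := by
        refine Nat.cast_le.2 (Nat.ceil_mono ?_)
        simp only [parameters]
        linarith
    _ ≤ 24 * Real.log x + 1 := (Nat.ceil_lt_add_one (by positivity)).le
    _ ≤ 25 * Real.log x := by linarith

lemma one_le_max_one_sq_div_sq (heps : 0 < eps) (heps1 : eps < 1) :
    1 ≤ max 1 lam ^ 2 / eps ^ 2 := by
  rw [one_le_div (by positivity)]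
  exact pow_le_pow_left₀ heps.le (heps1.le.trans (le_max_left _ _)) 2

lemma numSamples_le (hlam : 0 ≤ lam) (heps : 0 < eps) (heps1 : eps < 1) :
    (numSamples (parameters act lam eps delta n T) : ℝ) ≤ 1153 * (max 1 lam ^ 2 / eps ^ 2) := by
  have hone := one_le_max_one_sq_div_sq (lam := lam) heps heps1
  have hlam_le : lam ^ 2 / eps ^ 2 ≤ max 1 lam ^ 2 / eps ^ 2 := by
    gcongr
    exact le_max_right _ _
  simp only [numSamples, parameters, Nat.cast_max, Nat.cast_one]
  refine max_le (by linarith) ?_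
  calc (⌈9 / 2 * (16 * lam / eps * (16 * lam / eps))⌉₊ : ℝ)
      ≤ 9 / 2 * (16 * lam / eps * (16 * lam / eps)) + 1 :=
        (Nat.ceil_lt_add_one (by positivity)).le
    _ = 1152 * (lam ^ 2 / eps ^ 2) + 1 := by ring
    _ ≤ 1153 * (max 1 lam ^ 2 / eps ^ 2) := by linarith

lemma estimateInnerCost_add_le {K q : ℕ} {L B : ℝ} (hL : 1 ≤ L) (hB : 1 ≤ B) (hK : K ≤ 25 * L)
    (hq : q ≤ 1153 * B) (hd : Nat.clog 2 n ≤ 5 * L) :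
    (estimateInnerCost n 5 K q : ℝ) + 7 ≤ 2000000 * (L ^ 2 * B) := by
  have hLL : L ≤ L ^ 2 := le_self_pow₀ hL two_ne_zero
  have hLB : L ^ 2 ≤ L ^ 2 * B := le_mul_of_one_le_right (by positivity) hB
  rw [estimateInnerCost]
  push_cast
  calc (K : ℝ) * (q * (10 * Nat.clog 2 n + 5 + 3) + 6 * K + 7) + 7
      ≤ 25 * L * (1153 * B * (10 * (5 * L) + 5 * L + 3 * L) + 6 * (25 * L) + 7 * L) + 7 := by
        gcongr <;> linarith
    _ = 1671850 * (L ^ 2 * B) + 3925 * L ^ 2 + 7 := by ring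
    _ ≤ 2000000 * (L ^ 2 * B) := by linarith

/-- The summand `2 n + 3 + 6 N` pays for the initialization, for the loop counter and for reading
off the output in the signed version. -/
lemma oneRoundCost_add_le (hN : 1 ≤ N) (hnN : n ≤ 2 * N + 1) (hT : 1 ≤ T) (hlam : 0 ≤ lam)
    (heps : 0 < eps) (heps1 : eps < 1) (hdelta : 0 < delta) :
    (oneRoundCost (parameters act lam eps delta n T) n T M 5 : ℝ) + (2 * n + 3 + 6 * N) ≤
      polylog 2000000 2 N T M lam eps delta * roundCost N M lam eps delta := by
  have hN' : (1 : ℝ) ≤ N := Nat.one_le_cast.2 hN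
  have hnN' : (n : ℝ) ≤ 2 * N + 1 := by exact_mod_cast hnN
  have hM' : (0 : ℝ) ≤ M := M.cast_nonneg
  have : (0 : ℝ) ≤ T := T.cast_nonneg
  have heps' : 0 < 1 / eps := by positivity
  have hdelta' : 0 < 1 / delta := by positivity
  rw [polylog, roundCost]
  set x := 2 + (N : ℝ) + T + M + lam + 1 / eps + 1 / delta
  have h3 : 3 ≤ x := by simp only [x]; linarith
  have hnx : (n : ℝ) ≤ x ^ 2 := by
    have : N + 2 ≤ x := by simp only [x]; linarith
    nlinarith
  have hL := one_le_log_of_three_le h3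
  have hinner := estimateInnerCost_add_le hL (one_le_max_one_sq_div_sq (lam := lam) heps heps1)
    (numReps_le (act := act) (lam := lam) (eps := eps) (n := n) (M := M) hT hdelta h3
      (by simp only [x]; linarith) (by simp only [x]; linarith) (by simp only [x]; linarith))
    (numSamples_le (act := act) (delta := delta) (n := n) (T := T) hlam heps heps1)
    (clog_two_le h3 hnx)
  have hB : max 1 lam ^ 2 / eps ^ 2 ≤
      max 1 lam ^ 4 * max 1 (Real.log (1 / delta)) / eps ^ 2 := by
    gcongr
    calc max 1 lam ^ 2 ≤ max 1 lam ^ 4 := pow_le_pow_right₀ (le_max_left _ _) (by norm_num)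
      _ ≤ _ := le_mul_of_one_le_right (by positivity) (le_max_left _ _)
  have hlin : (N : ℝ) ≤ Real.log x ^ 2 * N :=
    le_mul_of_one_le_left N.cast_nonneg (one_le_pow₀ hL)
  rw [oneRoundCost, approxRiskCost]
  push_cast
  calc _ = (39 * n + 22 + 6 * N : ℝ) + M * (estimateInnerCost n 5
        (numReps (parameters act lam eps delta n T) T M)
        (numSamples (parameters act lam eps delta n T)) + 7) := by ring
    _ ≤ 2000000 * (Real.log x ^ 2 * N) + M * (2000000 * (Real.log x ^ 2 *
        (max 1 lam ^ 4 * max 1 (Real.log (1 / delta)) / eps ^ 2))) :=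
      add_le_add (by linarith) (mul_le_mul_of_nonneg_left (hinner.trans (by gcongr)) hM')
    _ = _ := by ring

lemma stepsLE_oneRound [NeZero n] (hN : 1 ≤ N) (hnN : n ≤ 2 * N + 1) (hT : 1 ≤ T)
    (hlam : 0 ≤ lam) (heps : 0 < eps) (heps1 : eps < 1) (hdelta : 0 < delta)
    {access : (Fin N → ℝ) → Fin n → RAM ℝ} {φ : (Fin N → ℝ) → Fin n → ℝ}
    (hacc : ∀ x, Reads (access x) 5 (φ x)) (test : Fin M → Example N) (ex : Example N)
    (s : State n) :
    StepsLE (oneRound access (parameters act lam eps delta n T) T test ex s)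
      (polylog 2000000 2 N T M lam eps delta * roundCost N M lam eps delta) :=
  (ensures_oneRound hacc ex s).stepsLE <| (le_add_of_nonneg_right (by positivity)).trans
    (oneRoundCost_add_le hN hnN hT hlam heps heps1 hdelta)

lemma total_cost_le (hN : 1 ≤ N) (hnN : n ≤ 2 * N + 1) (hT : 1 ≤ T) (hlam : 0 ≤ lam)
    (heps : 0 < eps) (heps1 : eps < 1) (hdelta : 0 < delta) :
    ((2 * n + 2 + T * (oneRoundCost (parameters act lam eps delta n T) n T M 5 + 1) + N * 6 : ℕ) :
      ℝ) ≤ polylog 2000000 2 N T M lam eps delta * (T * roundCost N M lam eps delta) := by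
  have hround := mul_le_mul_of_nonneg_left (oneRoundCost_add_le (act := act) (M := M) hN hnN hT
    hlam heps heps1 hdelta) T.cast_nonneg
  have hoverhead : (2 * n + 2 + 6 * N : ℝ) ≤ T * (2 * n + 2 + 6 * N) :=
    le_mul_of_one_le_left (by positivity) (Nat.one_le_cast.2 hT)
  push_cast
  linarith

end Bounds

variable {N : ℕ}

/-- The feature vector `(x, -x, 0)`. -/
def signedFeatures (x : Fin N → ℝ) (j : Fin (2 * N + 1)) : ℝ :=
  if h : j.val < N then x ⟨j.val, h⟩
  else if h' : j.val < 2 * N then -x ⟨j.val - N, by omega⟩ else 0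

/-- The coefficients on `x` of a linear form in the features `(x, -x, 0)`. -/
def unsigned (u : Fin (2 * N + 1) → ℝ) (j : Fin N) : ℝ :=
  u ⟨j.val, by omega⟩ - u ⟨N + j.val, by omega⟩

lemma reads_plainAccess (x : Fin N → ℝ) : Reads (plainAccess x) 5 x :=
  fun _ => Ensures.mono_cost (b := 1) (ensures_exec_of_eval_eq_pure rfl rfl) (by norm_num)

lemma reads_signedAccess (x : Fin N → ℝ) : Reads (signedAccess x) 5 (signedFeatures x) := by
  intro j
  rw [signedAccess, signedFeatures]
  iterate 2 refine Ensures.exec_bind rfl ?_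
  split_ifs
  · exact Ensures.mono_cost (b := 1) (ensures_exec_of_eval_eq_pure rfl rfl) (by norm_num)
  · iterate 2 refine Ensures.exec_bind rfl ?_
    exact ensures_exec_of_eval_eq_pure rfl (zero_sub _)
  · exact Ensures.mono_cost (b := 0) (ensures_pure rfl) (by norm_num)

lemma ensures_unsignedLoop (u : Fin (2 * N + 1) → ℝ) :
    Ensures (loop N (fun j v => do
      exec .index
      let a ← exec (.read u ⟨j.val, by omega⟩)
      let b ← exec (.read u ⟨N + j.val, by omega⟩)
      let c ← exec (.sub a b)
      exec (.write v j c)) (fun _ => 0)) (N * 6) fun v => v = unsigned u := by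
  refine ensures_loop_write fun j A _ => ?_
  iterate 4 refine Ensures.exec_bind rfl ?_
  exact ensures_exec_of_eval_eq_pure rfl rfl

variable {act : ℝ → ℝ} {lam eps delta : ℝ} {T M : ℕ} [NeZero N]

lemma stepsLE_sparsitron (hT : 1 ≤ T) (hlam : 0 ≤ lam) (heps : 0 < eps) (heps1 : eps < 1)
    (hdelta : 0 < delta) (train : Fin T → Example N) (test : Fin M → Example N) :
    StepsLE (sparsitron (parameters act lam eps delta N T) train test)
      (polylog 2000000 2 N T M lam eps delta * (T * roundCost N M lam eps delta)) :=
  (ensures_learn reads_plainAccess hT train).stepsLE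
    ((Nat.cast_le.2 (Nat.le_add_right _ (N * 6))).trans
      (total_cost_le (Nat.pos_of_neZero N) (by omega) hT hlam heps heps1 hdelta))

lemma stepsLE_sparsitronSigned (hT : 1 ≤ T) (hlam : 0 ≤ lam) (heps : 0 < eps) (heps1 : eps < 1)
    (hdelta : 0 < delta) (train : Fin T → Example N) (test : Fin M → Example N) :
    StepsLE (sparsitronSigned (parameters act lam eps delta (2 * N + 1) T) train test)
      (polylog 2000000 2 N T M lam eps delta * (T * roundCost N M lam eps delta)) :=
  ((ensures_learn reads_signedAccess hT train).bind fun u _ => ensures_unsignedLoop u |>.mono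
    (Q := fun _ => True) le_rfl fun _ _ => trivial).stepsLE
    (total_cost_le (Nat.pos_of_neZero N) le_rfl hT hlam heps heps1 hdelta)

end RunTime

/-! ### Number of samples -/

section SampleSizes

lemma exists_nat_ge_log_div {eps : ℝ} (heps : 0 < eps) (heps1 : eps < 1) {x : ℝ} (hx : 1 ≤ x) :
    ∃ M : ℕ, 1024 * Real.log x / eps ^ 2 ≤ M ∧ (M : ℝ) ≤ 1026 * Real.log (2 * x) / eps ^ 2 := by
  have hlog : 0 ≤ Real.log x := Real.log_nonneg hx
  have heps2 : eps ^ 2 ≤ 1 := pow_le_one₀ heps.le heps1.le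
  refine ⟨⌈1024 * Real.log x / eps ^ 2⌉₊, Nat.le_ceil _, ?_⟩
  refine (Nat.ceil_lt_add_one (by positivity)).le.trans ?_
  rw [div_add_one (by positivity), Real.log_mul two_ne_zero (by linarith)]
  gcongr
  linarith [Real.log_two_gt_d9]

variable {N : ℕ} (hN : 1 ≤ N)

include hN

lemma log_two_le_log_two_mul_div {c : ℝ} (hc : 0 < c) (hc1 : c < 1) :
    Real.log 2 ≤ Real.log (2 * N / c) := by
  have hN' : (1 : ℝ) ≤ N := Nat.one_le_cast.2 hN
  refine Real.log_le_log two_pos ?_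
  rw [le_div_iff₀ hc]
  linarith

lemma log_div_le_two_mul_log_div {n : ℕ} (hn : 1 ≤ n) (hnN : n ≤ 2 * N + 1) {c : ℝ} (hc : 0 < c)
    (hc1 : c < 1) : Real.log (n / c) ≤ 2 * Real.log (2 * N / c) := by
  have : (1 : ℝ) ≤ n := Nat.one_le_cast.2 hn
  have hN' : (1 : ℝ) ≤ N := Nat.one_le_cast.2 hN
  have hnN' : (n : ℝ) ≤ 2 * N + 1 := by exact_mod_cast hnN
  have hsq : 2 * Real.log (2 * N / c) = Real.log ((2 * N / c) ^ 2) := by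
    rw [Real.log_pow, Nat.cast_two]
  rw [hsq]
  refine Real.log_le_log (by positivity) ?_
  calc (n : ℝ) / c ≤ (2 * N) ^ 2 / c := by
        gcongr
        nlinarith
    _ ≤ (2 * N) ^ 2 / c ^ 2 := by
        gcongr
        nlinarith
    _ = _ := by rw [div_pow]

variable {lam eps delta : ℝ} (heps : 0 < eps) (heps1 : eps < 1) (hdelta : 0 < delta)
  (hdelta1 : delta < 1)

include heps heps1 hdelta hdelta1

lemma sampleSizes_of_le {n : ℕ} (hn : 1 ≤ n) (hnN : n ≤ 2 * N + 1) {C : ℝ} (hC : 1 ≤ C)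
    (hlam : 0 ≤ lam) {T M : ℕ}
    (hT : 2 * C * (max 1 lam ^ 2 * Real.log (2 * N / (delta * eps)) / eps ^ 2) ≤ T)
    (hM : C * Real.log (T / delta) / eps ^ 2 ≤ M) : SampleSizes C n lam eps delta T M := by
  have hde : 0 < delta * eps := mul_pos hdelta heps
  have hde1 : delta * eps < 1 := mul_lt_one_of_nonneg_of_lt_one_left hdelta.le hdelta1 heps1.le
  have hlog := log_div_le_two_mul_log_div hN hn hnN hde hde1
  have hlogN := log_two_le_log_two_mul_div hN hde hde1
  set ℓ := Real.log (2 * N / (delta * eps))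
  have hℓ : 0 < ℓ := (Real.log_pos one_lt_two).trans_le hlogN
  refine ⟨?_, hT.trans' ?_, hM⟩
  · have hn' : (0 : ℝ) < n := Nat.cast_pos.2 hn
    have hlt : ℓ < max 1 lam ^ 2 * ℓ / eps ^ 2 := by
      rw [lt_div_iff₀ (pow_pos heps 2)]
      calc ℓ * eps ^ 2 < ℓ :=
            mul_lt_of_lt_one_right hℓ (pow_lt_one₀ heps.le heps1 two_ne_zero)
        _ ≤ max 1 lam ^ 2 * ℓ :=
            le_mul_of_one_le_left hℓ.le (one_le_pow₀ (le_max_left _ _))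
    calc Real.log n ≤ Real.log (n / (delta * eps)) :=
          Real.log_le_log hn' ((le_div_iff₀ hde).2 (mul_le_of_le_one_right hn'.le hde1.le))
      _ < 2 * C * (max 1 lam ^ 2 * ℓ / eps ^ 2) := by nlinarith
      _ ≤ T := hT
  · have : 0 ≤ C := zero_le_one.trans hC
    calc C * lam ^ 2 * Real.log (n / (delta * eps)) / eps ^ 2
        ≤ C * lam ^ 2 * (2 * ℓ) / eps ^ 2 := by gcongr
      _ ≤ C * max 1 lam ^ 2 * (2 * ℓ) / eps ^ 2 := by
          gcongr
          exact le_max_right _ _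
      _ = _ := by ring

lemma log_two_mul_div_le {T : ℝ} (hT : 0 < T)
    (hT' : T ≤ 2050 * (max 1 lam ^ 2 * Real.log (2 * N / (delta * eps)) / eps ^ 2)) :
    Real.log (2 * T / delta) ≤ 20 * (max 1 lam ^ 2 * Real.log (2 * N / (delta * eps))) := by
  have hde : 0 < delta * eps := mul_pos hdelta heps
  have hde1 : delta * eps < 1 := mul_lt_one_of_nonneg_of_lt_one_left hdelta.le hdelta1 heps1.le
  have hℓ := log_two_le_log_two_mul_div hN hde hde1
  have hN' : (1 : ℝ) ≤ N := Nat.one_le_cast.2 hN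
  set A := 2 * (N : ℝ) / (delta * eps) with hA
  have hA0 : 0 < A := by positivity
  set Λ := max 1 lam
  have hΛ : 1 ≤ Λ := le_max_left _ _
  have hpoly : 2 * T / delta ≤ 2 ^ 13 * Λ ^ 2 * A ^ 3 := by
    have hinv : 1 / (eps ^ 2 * delta) ≤ A ^ 2 := by
      calc 1 / (eps ^ 2 * delta) ≤ 1 / (delta * eps) ^ 2 := by
            gcongr
            nlinarith [mul_pos (pow_pos heps 2) hdelta]
        _ = (1 / (delta * eps)) ^ 2 := by rw [div_pow, one_pow]
        _ ≤ A ^ 2 := by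
            rw [hA]
            gcongr
            linarith
    calc 2 * T / delta ≤ 2 * (2050 * (Λ ^ 2 * Real.log A / eps ^ 2)) / delta := by gcongr
      _ = 4100 * Λ ^ 2 * Real.log A * (1 / (eps ^ 2 * delta)) := by
          field_simp
          ring
      _ ≤ 2 ^ 13 * Λ ^ 2 * A * A ^ 2 := by
          gcongr
          · exact (Real.log_pos one_lt_two).le.trans hℓ
          · norm_num
          · exact Real.log_le_self hA0.le
      _ = _ := by ring
  have hlog := Real.log_le_log (by positivity) hpoly
  rw [Real.log_mul (by positivity) (by positivity), Real.log_mul (by norm_num) (by positivity),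
    Real.log_pow, Real.log_pow, Real.log_pow] at hlog
  push_cast at hlog
  have hlog2 := Real.log_two_gt_d9
  have hlogΛ := Real.log_le_self (zero_le_one.trans hΛ)
  have hΛ2 : Λ ≤ Λ ^ 2 := le_self_pow₀ hΛ two_ne_zero
  have hΛℓ : Real.log A ≤ Λ ^ 2 * Real.log A :=
    le_mul_of_one_le_left (by linarith) (one_le_pow₀ hΛ)
  nlinarith

lemma exists_sampleSizes (hlam : 0 ≤ lam) {C' : ℝ} (hC' : 30000 ≤ C') :
    ∃ T M : ℕ, SampleSizes 1024 N lam eps delta T M ∧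
      SampleSizes 1024 (2 * N + 1) lam eps delta T M ∧
      (T : ℝ) ≤ C' * max 1 lam ^ 2 * Real.log (2 * N / (delta * eps)) / eps ^ 2 ∧
      (M : ℝ) ≤ C' * Real.log (2 * T / delta) / eps ^ 2 ∧
      (T + M : ℝ) ≤ C' * max 1 lam ^ 2 * Real.log (2 * N / (delta * eps)) / eps ^ 2 := by
  have hℓ := log_two_le_log_two_mul_div hN (mul_pos hdelta heps)
    (mul_lt_one_of_nonneg_of_lt_one_left hdelta.le hdelta1 heps1.le)
  have heps2 : eps ^ 2 ≤ 1 := pow_le_one₀ heps.le heps1.le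
  have hΛ : 1 ≤ max 1 lam ^ 2 := one_le_pow₀ (le_max_left _ _)
  have hlog2 := Real.log_two_gt_d9
  have hC'B : C' * max 1 lam ^ 2 * Real.log (2 * N / (delta * eps)) / eps ^ 2 =
      C' * (max 1 lam ^ 2 * Real.log (2 * N / (delta * eps)) / eps ^ 2) := by ring
  rw [hC'B]
  have hsizes {n T M : ℕ} (hn : 1 ≤ n) (hnN : n ≤ 2 * N + 1) :=
    sampleSizes_of_le hN heps heps1 hdelta hdelta1 hn hnN (C := 1024) (by norm_num) hlam (T := T)
      (M := M)
  have hlogT {T : ℝ} := log_two_mul_div_le hN heps heps1 hdelta hdelta1 (lam := lam) (T := T)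
  set B := max 1 lam ^ 2 * Real.log (2 * N / (delta * eps)) / eps ^ 2 with hB
  have hB2 : 1 / 2 ≤ B := by
    rw [hB, le_div_iff₀ (pow_pos heps 2)]
    nlinarith
  obtain ⟨T, hT, hT'⟩ : ∃ T : ℕ, 2048 * B ≤ T ∧ (T : ℝ) ≤ 2050 * B :=
    ⟨⌈2048 * B⌉₊, Nat.le_ceil _, by
      linarith [Nat.ceil_lt_add_one (show 0 ≤ 2048 * B by linarith)]⟩
  have hTdelta : 1 ≤ T / delta := (one_le_div hdelta).2 (by linarith)
  obtain ⟨M, hM, hM'⟩ := exists_nat_ge_log_div heps heps1 hTdelta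
  rw [← mul_div_assoc] at hM'
  have hMB : (M : ℝ) ≤ 20520 * B := by
    calc (M : ℝ) ≤ 1026 * Real.log (2 * T / delta) / eps ^ 2 := hM'
      _ ≤ 1026 * (20 * (max 1 lam ^ 2 * Real.log (2 * N / (delta * eps)))) / eps ^ 2 := by
          gcongr
          exact hlogT (by linarith) hT'
      _ = 20520 * B := by ring
  refine ⟨T, M, hsizes hN (by omega) (by linarith) hM, hsizes (by omega) le_rfl (by linarith) hM,
    by nlinarith, hM'.trans ?_, by nlinarith⟩
  gcongr
  · exact Real.log_nonneg (by linarith [mul_div_assoc 2 (T : ℝ) delta])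
  · linarith

end SampleSizes

/-! ### Concentration of adaptive sums -/

section Concentration

variable {Ω : Type*}

/-- The sum of `g t (x 0, …, x (t - 1)) (x t)` over `t < T`: every summand may depend on the
earlier entries of the sequence. -/
def adaptiveSum (g : (t : ℕ) → (Fin t → Ω) → Ω → ℝ) (T : ℕ) (x : Fin T → Ω) : ℝ :=
  ∑ t : Fin T, g t (Fin.take t t.is_lt.le x) (x t)

lemma adaptiveSum_zero (g : (t : ℕ) → (Fin t → Ω) → Ω → ℝ) (x : Fin 0 → Ω) :
    adaptiveSum g 0 x = 0 := rfl

lemma adaptiveSum_succ (g : (t : ℕ) → (Fin t → Ω) → Ω → ℝ) (T : ℕ) (x : Fin (T + 1) → Ω) :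
    adaptiveSum g (T + 1) x =
      adaptiveSum g T (Fin.init x) + g T (Fin.init x) (x (Fin.last T)) :=
  Fin.sum_univ_castSucc _

variable [MeasurableSpace Ω]

lemma measurable_init {T : ℕ} : Measurable (Fin.init : (Fin (T + 1) → Ω) → Fin T → Ω) :=
  measurable_pi_lambda _ fun i => measurable_pi_apply i.castSucc

lemma measurable_adaptiveSum {g : (t : ℕ) → (Fin t → Ω) → Ω → ℝ}
    (hg : ∀ t, Measurable fun z : (Fin t → Ω) × Ω => g t z.1 z.2) (T : ℕ) :
    Measurable (adaptiveSum g T) := by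
  refine Finset.measurable_sum _ fun t _ => ?_
  have htake : Measurable fun x : Fin T → Ω => Fin.take t t.is_lt.le x :=
    measurable_pi_lambda _ fun _ => measurable_pi_apply _
  exact (hg t).comp (htake.prodMk (measurable_pi_apply t))

variable (D : Measure Ω) [IsProbabilityMeasure D]

lemma lintegral_pi_init_last {T : ℕ} {F : (Fin T → Ω) × Ω → ℝ≥0∞} (hF : Measurable F) :
    ∫⁻ x, F (Fin.init x, x (Fin.last T)) ∂(Measure.pi fun _ : Fin (T + 1) => D) =
      ∫⁻ p, ∫⁻ ω, F (p, ω) ∂D ∂(Measure.pi fun _ : Fin T => D) := by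
  have h := (measurePreserving_piFinSuccAbove (fun _ : Fin (T + 1) => D)
    (Fin.last T)).lintegral_comp (hF.comp measurable_swap)
  rw [lintegral_prod_symm _ (hF.comp measurable_swap).aemeasurable] at h
  refine Eq.trans (lintegral_congr fun x => ?_) h
  have hinit : Fin.init x = Fin.removeNth (Fin.last T) x := by
    funext i
    simp [Fin.init, Fin.removeNth]
  rw [hinit]
  rfl

lemma lintegral_exp_adaptiveSum_le {g : (t : ℕ) → (Fin t → Ω) → Ω → ℝ}
    (hg : ∀ t, Measurable fun z : (Fin t → Ω) × Ω => g t z.1 z.2) {s : ℝ} {c : ℝ≥0∞}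
    (hc : ∀ t p, ∫⁻ ω, ENNReal.ofReal (Real.exp (s * g t p ω)) ∂D ≤ c) (T : ℕ) :
    ∫⁻ x, ENNReal.ofReal (Real.exp (s * adaptiveSum g T x)) ∂(Measure.pi fun _ : Fin T => D) ≤
      c ^ T := by
  induction T with
  | zero => simp [adaptiveSum_zero]
  | succ T ih =>
    have hsum : Measurable fun p => ENNReal.ofReal (Real.exp (s * adaptiveSum g T p)) :=
      ((measurable_adaptiveSum hg T).const_mul s).exp.ennreal_ofReal
    have hlast : Measurable fun z : (Fin T → Ω) × Ω =>
        ENNReal.ofReal (Real.exp (s * g T z.1 z.2)) :=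
      ((hg T).const_mul s).exp.ennreal_ofReal
    simp only [adaptiveSum_succ, mul_add, Real.exp_add, ENNReal.ofReal_mul (Real.exp_pos _).le]
    rw [lintegral_pi_init_last D (F := fun z =>
      ENNReal.ofReal (Real.exp (s * adaptiveSum g T z.1)) *
        ENNReal.ofReal (Real.exp (s * g T z.1 z.2))) ((hsum.comp measurable_fst).mul hlast)]
    calc _ ≤ ∫⁻ p, ENNReal.ofReal (Real.exp (s * adaptiveSum g T p)) * c
          ∂(Measure.pi fun _ : Fin T => D) := by
          refine lintegral_mono fun p => ?_
          simp only [lintegral_const_mul' _ _ ENNReal.ofReal_ne_top]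
          exact mul_le_mul_right (hc T p) _
      _ ≤ c ^ (T + 1) := by
          rw [lintegral_mul_const _ hsum, pow_succ]
          exact mul_le_mul_left ih _

lemma lintegral_exp_mul_integral_sub_le {f : Ω → ℝ} (hf : AEMeasurable f D) {l b : ℝ}
    (hb : 0 ≤ b) (hbound : ∀ᵐ ω ∂D, f ω ∈ Set.Icc l (l + 2 * b)) (s : ℝ) :
    ∫⁻ ω, ENNReal.ofReal (Real.exp (s * ((∫ ω', f ω' ∂D) - f ω))) ∂D ≤
      ENNReal.ofReal (Real.exp (b ^ 2 * s ^ 2 / 2)) := by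
  have hsub := ProbabilityTheory.hasSubgaussianMGF_of_mem_Icc hf hbound
  have hmgf := hsub.mgf_le (-s)
  have hvar : (((‖l + 2 * b - l‖₊ / 2) ^ 2 : ℝ≥0) : ℝ) = b ^ 2 := by
    rw [add_sub_cancel_left]
    push_cast
    rw [Real.norm_of_nonneg (by positivity), mul_div_cancel_left₀ b two_ne_zero]
  rw [hvar, neg_sq, ProbabilityTheory.mgf] at hmgf
  have hneg (ω) : s * ((∫ ω', f ω' ∂D) - f ω) = -s * (f ω - ∫ ω', f ω' ∂D) := by ring
  simp only [hneg]
  rw [← ofReal_integral_eq_lintegral_ofReal (hsub.integrable_exp_mul (-s))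
    (ae_of_all _ fun _ => (Real.exp_pos _).le)]
  exact ENNReal.ofReal_le_ofReal hmgf

lemma measure_ge_le_lintegral_exp_div {μ : Measure Ω} {f : Ω → ℝ} (hf : Measurable f) {s : ℝ}
    (hs : 0 ≤ s) (r : ℝ) : μ {x | r ≤ f x} ≤
      (∫⁻ x, ENNReal.ofReal (Real.exp (s * f x)) ∂μ) / ENNReal.ofReal (Real.exp (s * r)) := by
  refine (measure_mono fun x (hx : r ≤ f x) => ?_).trans (meas_ge_le_lintegral_div
    (hf.const_mul s).exp.ennreal_ofReal.aemeasurable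
    (ENNReal.ofReal_pos.2 (Real.exp_pos (s * r))).ne' ENNReal.ofReal_ne_top)
  exact ENNReal.ofReal_le_ofReal (Real.exp_le_exp.2 (mul_le_mul_of_nonneg_left hx hs))

/-- Azuma's inequality. -/
lemma measure_adaptiveSum_ge_le {h : (t : ℕ) → (Fin t → Ω) → Ω → ℝ}
    (hh : ∀ t, Measurable fun z : (Fin t → Ω) × Ω => h t z.1 z.2) {l b : ℝ} (hb : 0 < b)
    (hbound : ∀ t p, ∀ᵐ ω ∂D, h t p ω ∈ Set.Icc l (l + 2 * b)) {T : ℕ} (hT : 0 < T) {r : ℝ}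
    (hr : 0 ≤ r) :
    (Measure.pi fun _ : Fin T => D)
      {x | r ≤ adaptiveSum (fun t p ω => (∫ ω', h t p ω' ∂D) - h t p ω) T x} ≤
      ENNReal.ofReal (Real.exp (-(r ^ 2 / (2 * T * b ^ 2)))) := by
  have : (0 : ℝ) < T := Nat.cast_pos.2 hT
  have hg (t : ℕ) : Measurable fun z : (Fin t → Ω) × Ω => (∫ ω', h t z.1 ω' ∂D) - h t z.1 z.2 :=
    ((hh t).stronglyMeasurable.integral_prod_right'.measurable.comp measurable_fst).sub (hh t)
  set s : ℝ := r / (T * b ^ 2)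
  have hmgf := lintegral_exp_adaptiveSum_le D hg (s := s) (fun t p =>
    lintegral_exp_mul_integral_sub_le D ((hh t).comp measurable_prodMk_left).aemeasurable hb.le
      (hbound t p) s) T
  calc _ ≤ _ := measure_ge_le_lintegral_exp_div (measurable_adaptiveSum hg T)
        (show 0 ≤ s by positivity) r
    _ ≤ ENNReal.ofReal (Real.exp (b ^ 2 * s ^ 2 / 2)) ^ T / ENNReal.ofReal (Real.exp (s * r)) :=
        ENNReal.div_le_div_right hmgf _
    _ = ENNReal.ofReal (Real.exp (-(r ^ 2 / (2 * T * b ^ 2)))) := by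
        rw [← ENNReal.ofReal_pow (Real.exp_pos _).le, ← ENNReal.ofReal_div_of_pos (Real.exp_pos _),
          ← Real.exp_nat_mul, ← Real.exp_sub]
        congr 2
        simp only [s]
        field_simp
        ring

lemma measure_sum_integral_sub_ge_le {f : Ω → ℝ} (hf : Measurable f) {l b : ℝ} (hb : 0 < b)
    (hbound : ∀ᵐ ω ∂D, f ω ∈ Set.Icc l (l + 2 * b)) {M : ℕ} (hM : 0 < M) {r : ℝ} (hr : 0 ≤ r) :
    (Measure.pi fun _ : Fin M => D) {x | r ≤ ∑ m, ((∫ ω, f ω ∂D) - f (x m))} ≤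
      ENNReal.ofReal (Real.exp (-(r ^ 2 / (2 * M * b ^ 2)))) :=
  measure_adaptiveSum_ge_le D (h := fun _ _ => f) (fun _ => hf.comp measurable_snd) hb
    (fun _ _ => hbound) hM hr

lemma measure_abs_sum_div_sub_integral_ge_le {f : Ω → ℝ} (hf : Measurable f)
    (hbound : ∀ᵐ ω ∂D, f ω ∈ Set.Icc (0 : ℝ) 1) {M : ℕ} (hM : 0 < M) {τ : ℝ} (hτ : 0 ≤ τ) :
    (Measure.pi fun _ : Fin M => D) {x | τ ≤ |(∑ m, f (x m)) / M - ∫ ω, f ω ∂D|} ≤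
      2 * ENNReal.ofReal (Real.exp (-(2 * M * τ ^ 2))) := by
  have hM' : (0 : ℝ) < M := Nat.cast_pos.2 hM
  have hexp : (M * τ) ^ 2 / (2 * M * (1 / 2 : ℝ) ^ 2) = 2 * M * τ ^ 2 := by
    field_simp
  have hlower := measure_sum_integral_sub_ge_le D hf (l := 0) (b := 1 / 2) (by norm_num)
    (by simpa using hbound) hM (r := M * τ) (by positivity)
  have hupper := measure_sum_integral_sub_ge_le D hf.neg (l := -1) (b := 1 / 2) (by norm_num)
    (by simpa [neg_le] using hbound.mono fun _ => And.symm) hM (r := M * τ) (by positivity)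
  rw [hexp] at hlower hupper
  rw [two_mul]
  refine (measure_mono fun x hx => ?_).trans
    ((measure_union_le _ _).trans (add_le_add hlower hupper))
  have hmean : (∑ m, f (x m)) / M * M = ∑ m, f (x m) := div_mul_cancel₀ _ hM'.ne'
  simp only [Set.mem_union, Set.mem_ofPred_eq, Pi.neg_apply, integral_neg,
    Finset.sum_sub_distrib, Finset.sum_const, Finset.card_univ, Fintype.card_fin, nsmul_eq_mul,
    Finset.sum_neg_distrib]
  rcases le_abs.1 (show τ ≤ |_| from hx) with hx | hx
  · right
    nlinarith
  · left
    nlinarith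

end Concentration

/-! ### The regret of the multiplicative updates -/

section Hedge

variable {n : ℕ}

lemma sum_mul_rpow_le [NeZero n] {β : ℝ} (hβ : 0 ≤ β) {w l : Fin n → ℝ} (hw : ∀ j, 0 < w j)
    (hl : ∀ j, l j ∈ Set.Icc (0 : ℝ) 1) :
    ∑ j, w j * β ^ l j ≤ (∑ j, w j) * Real.exp (-((1 - β) * (normalized w ⬝ᵥ l))) := by
  have hW : 0 < ∑ j, w j := Finset.sum_pos (fun i _ => hw i) Finset.univ_nonempty
  have hdot : (∑ j, w j) * (normalized w ⬝ᵥ l) = ∑ j, w j * l j := by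
    rw [dotProduct, Finset.mul_sum]
    refine Finset.sum_congr rfl fun j _ => ?_
    rw [normalized]
    field_simp
  calc ∑ j, w j * β ^ l j ≤ ∑ j, w j * (1 - (1 - β) * l j) := by
        refine Finset.sum_le_sum fun j _ => mul_le_mul_of_nonneg_left ?_ (hw j).le
        have hbernoulli := rpow_one_add_le_one_add_mul_self (s := β - 1) (by linarith)
          (hl j).1 (hl j).2
        rw [add_sub_cancel] at hbernoulli
        linarith
    _ = (∑ j, w j) * (1 - (1 - β) * (normalized w ⬝ᵥ l)) := by
        rw [mul_sub, mul_left_comm, hdot, Finset.mul_sum, mul_one, ← Finset.sum_sub_distrib]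
        exact Finset.sum_congr rfl fun j _ => by ring
    _ ≤ _ := by
        gcongr
        linarith [Real.add_one_le_exp (-((1 - β) * (normalized w ⬝ᵥ l)))]

lemma neg_add_two_mul_sq_le_log_one_sub {η : ℝ} (hη : η ≤ 1 / 2) :
    -(η + 2 * η ^ 2) ≤ Real.log (1 - η) := by
  have hpos : 0 < 1 - η := by linarith
  refine le_trans ?_ (Real.one_sub_inv_le_log_of_pos hpos)
  have hinv : (1 - η)⁻¹ ≤ 1 + η + 2 * η ^ 2 := by
    rw [inv_le_iff_one_le_mul₀ hpos]
    nlinarith [mul_nonneg (sq_nonneg η) (by linarith : 0 ≤ 1 - 2 * η)]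
  linarith

variable {β : ℝ} (hβ : 0 < β) {T : ℕ} {w : Fin (T + 1) → Fin n → ℝ} {l : Fin T → Fin n → ℝ}
  (hw : ∀ t j, w t.succ j = w t.castSucc j * β ^ l t j)

include hβ hw

lemma multiplicativeWeights_last (j : Fin n) :
    w (Fin.last T) j = w 0 j * β ^ ∑ t, l t j := by
  induction T with
  | zero => simp
  | succ T ih =>
    have hT := ih (w := fun t => w t.castSucc) (l := fun t => l t.castSucc) fun t => hw t.castSucc
    rw [← Fin.succ_last, hw, hT, mul_assoc, ← Real.rpow_add hβ, Fin.sum_univ_castSucc,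
      Fin.castSucc_zero]

lemma multiplicativeWeights_pos (h0 : ∀ j, 0 < w 0 j) (t : Fin (T + 1)) (j : Fin n) :
    0 < w t j := by
  induction t using Fin.induction with
  | zero => exact h0 j
  | succ t ih => exact hw t j ▸ mul_pos ih (Real.rpow_pos_of_pos hβ _)

variable [NeZero n] (hl : ∀ t j, l t j ∈ Set.Icc (0 : ℝ) 1)

include hl

lemma sum_multiplicativeWeights_last_le (h0 : ∀ j, 0 < w 0 j) :
    ∑ j, w (Fin.last T) j ≤
      (∑ j, w 0 j) * Real.exp (-((1 - β) * ∑ t, normalized (w t.castSucc) ⬝ᵥ l t)) := by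
  induction T with
  | zero => simp
  | succ T ih =>
    have hT := ih (w := fun t => w t.castSucc) (l := fun t => l t.castSucc)
      (fun t => hw t.castSucc) (fun t => hl t.castSucc) h0
    have hpos := multiplicativeWeights_pos hβ hw h0 (Fin.last T).castSucc
    rw [← Fin.succ_last]
    simp only [hw]
    refine (sum_mul_rpow_le hβ.le hpos (hl _)).trans
      ((mul_le_mul_of_nonneg_right hT (Real.exp_pos _).le).trans_eq ?_)
    rw [Fin.sum_univ_castSucc, mul_assoc, ← Real.exp_add, Fin.castSucc_zero, mul_add, neg_add]

/-- The total weight is at most `exp (-η · loss of the algorithm)` and at least the weight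
`(1 - η) ^ (loss of j) / n` of a single index `j`. -/
lemma multiplicativeWeights_regret_le {η : ℝ} (hη : 0 < η) (hη2 : η ≤ 1 / 2) (hβη : β = 1 - η)
    (h0 : ∀ j, w 0 j = 1 / n) (j : Fin n) :
    η * (∑ t, (normalized (w t.castSucc) ⬝ᵥ l t - l t j)) ≤ Real.log n + 2 * η ^ 2 * T := by
  have hn : (0 : ℝ) < n := Nat.cast_pos.2 (Nat.pos_of_neZero n)
  have h0pos (j) : 0 < w 0 j := by
    rw [h0]
    positivity
  have hweight : 1 / n * β ^ ∑ t, l t j ≤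
      Real.exp (-(η * ∑ t, normalized (w t.castSucc) ⬝ᵥ l t)) := by
    have htotal := sum_multiplicativeWeights_last_le hβ hw hl h0pos
    simp only [h0, Finset.sum_const, Finset.card_univ, Fintype.card_fin, nsmul_eq_mul,
      mul_one_div_cancel hn.ne', one_mul, hβη, sub_sub_cancel] at htotal
    rw [← h0 j, ← multiplicativeWeights_last hβ hw]
    exact (Finset.single_le_sum (fun i _ => (multiplicativeWeights_pos hβ hw h0pos _ i).le)
      (Finset.mem_univ j)).trans htotal
  have hlog := Real.log_le_log (by positivity) hweight
  rw [Real.log_exp, Real.log_mul (by positivity) (by positivity), Real.log_rpow hβ, one_div,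
    Real.log_inv] at hlog
  have hloss : 0 ≤ ∑ t, l t j := Finset.sum_nonneg fun t _ => (hl t j).1
  have hloss' : ∑ t, l t j ≤ T := by
    simpa using Finset.sum_le_sum fun t (_ : t ∈ Finset.univ) => (hl t j).2
  have hlogβ := neg_add_two_mul_sq_le_log_one_sub hη2
  rw [← hβη] at hlogβ
  rw [Finset.sum_sub_distrib]
  nlinarith [mul_le_mul_of_nonneg_left hlogβ hloss,
    mul_le_mul_of_nonneg_left hloss' (by positivity : 0 ≤ 2 * η ^ 2)]

lemma multiplicativeWeights_regret_stdSimplex_le (h0 : ∀ j, w 0 j = 1 / n) (hn : 2 ≤ n)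
    (hT : 4 * Real.log n ≤ T) (hβη : β = 1 - √(Real.log n / T)) {q : Fin n → ℝ}
    (hq : q ∈ stdSimplex ℝ (Fin n)) :
    ∑ t, (normalized (w t.castSucc) ⬝ᵥ l t - q ⬝ᵥ l t) ≤ 3 * √(T * Real.log n) := by
  have hlog : 0 < Real.log n := Real.log_pos (Nat.one_lt_cast.2 hn)
  have hT0 : (0 : ℝ) < T := by linarith
  set η := √(Real.log n / T) with hη_def
  have hη : 0 < η := Real.sqrt_pos.2 (by positivity)
  have hη2 : η ≤ 1 / 2 := by
    rw [hη_def, Real.sqrt_le_left (by norm_num), div_le_iff₀ hT0]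
    linarith
  have hηT : η ^ 2 * T = Real.log n := by
    rw [hη_def, Real.sq_sqrt (by positivity), div_mul_cancel₀ _ hT0.ne']
  have hηlog : η * √(T * Real.log n) = Real.log n := by
    rw [hη_def, ← Real.sqrt_mul (by positivity), ← mul_assoc, div_mul_cancel₀ _ hT0.ne',
      Real.sqrt_mul_self hlog.le]
  have hregret (j : Fin n) :
      ∑ t, (normalized (w t.castSucc) ⬝ᵥ l t - l t j) ≤ 3 * √(T * Real.log n) := by
    refine le_of_mul_le_mul_left ?_ hη
    have := multiplicativeWeights_regret_le hβ hw hl hη hη2 hβη h0 j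
    linarith
  calc ∑ t, (normalized (w t.castSucc) ⬝ᵥ l t - q ⬝ᵥ l t)
      = ∑ j, q j * ∑ t, (normalized (w t.castSucc) ⬝ᵥ l t - l t j) := by
        simp only [mul_sub, Finset.sum_sub_distrib, dotProduct]
        rw [← Finset.sum_mul, hq.2, one_mul, Finset.sum_comm (f := fun t j => q j * l t j)]
        simp only [Finset.mul_sum]
    _ ≤ ∑ j, q j * (3 * √(T * Real.log n)) :=
        Finset.sum_le_sum fun j _ => mul_le_mul_of_nonneg_left (hregret j) (hq.1 j)
    _ = 3 * √(T * Real.log n) := by rw [← Finset.sum_mul, hq.2, one_mul]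

end Hedge

section Regret

variable {N n : ℕ}

/-- The examples with features in `[-1, 1]` and label in `[0, 1]`; almost all samples of the
distribution are of this form. -/
def bounded (φ : (Fin N → ℝ) → Fin n → ℝ) : Set (Example N) :=
  {s | (∀ j, |φ s.1 j| ≤ 1) ∧ s.2 ∈ Set.Icc (0 : ℝ) 1}

/-- The excess `(σ(u · φ) - y) (u · φ - w · φ)` of `u` over `w` on an example, the quantity that is
linear in the loss vectors and whose expectation bounds the risk of `u`. -/
noncomputable def excess (act : ℝ → ℝ) (φ : (Fin N → ℝ) → Fin n → ℝ) (w u : Fin n → ℝ)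
    (ex : Example N) : ℝ :=
  (act (u ⬝ᵥ φ ex.1) - ex.2) * (u ⬝ᵥ φ ex.1 - w ⬝ᵥ φ ex.1)

variable {P : Params} {φ : (Fin N → ℝ) → Fin n → ℝ}

lemma lossVec_mem_Icc (hact : ∀ z, P.act z ∈ Set.Icc (0 : ℝ) 1) (w : Fin n → ℝ)
    {ex : Example N} (hex : ex ∈ bounded φ) (j : Fin n) :
    lossVec P φ w ex j ∈ Set.Icc (0 : ℝ) 1 := by
  have habs : |(P.act (P.lam * (normalized w ⬝ᵥ φ ex.1)) - ex.2) * φ ex.1 j| ≤ 1 := by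
    rw [abs_mul]
    refine mul_le_one₀ ?_ (abs_nonneg _) (hex.1 j)
    simpa using abs_sub_le_of_le_of_le (hact _).1 (hact _).2 hex.2.1 hex.2.2
  rw [abs_le] at habs
  unfold lossVec
  constructor <;> linarith

variable [NeZero n]

lemma weightsAfter_pos (hbeta : 0 < P.beta) {t : ℕ} (train : Fin t → Example N) (j : Fin n) :
    0 < weightsAfter P φ t train j := by
  induction t with
  | zero => exact one_div_pos.2 (Nat.cast_pos.2 (Nat.pos_of_neZero n))
  | succ t ih => exact mul_pos (ih _) (Real.rpow_pos_of_pos hbeta _)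

lemma excess_eq {q v : Fin n → ℝ} (hq : q ∈ stdSimplex ℝ (Fin n)) (hv : ∀ j, 0 < v j)
    (ex : Example N) :
    excess P.act φ (P.lam • q) (predictor P v) ex =
      2 * P.lam * (normalized v ⬝ᵥ lossVec P φ v ex - q ⬝ᵥ lossVec P φ v ex) := by
  have hloss {p : Fin n → ℝ} (hp : p ∈ stdSimplex ℝ (Fin n)) : p ⬝ᵥ lossVec P φ v ex =
      (1 + (P.act (P.lam * (normalized v ⬝ᵥ φ ex.1)) - ex.2) * (p ⬝ᵥ φ ex.1)) / 2 := by
    set g := P.act (P.lam * (normalized v ⬝ᵥ φ ex.1)) - ex.2 with hg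
    calc p ⬝ᵥ lossVec P φ v ex = ∑ j, (p j + g * (p j * φ ex.1 j)) / 2 :=
          Finset.sum_congr rfl fun j _ => by rw [lossVec, ← hg]; ring
      _ = (1 + g * (p ⬝ᵥ φ ex.1)) / 2 := by
          rw [← Finset.sum_div, Finset.sum_add_distrib, ← Finset.mul_sum, hp.2, dotProduct]
  rw [hloss (normalized_mem_stdSimplex hv), hloss hq, excess, predictor, smul_dotProduct,
    smul_dotProduct, smul_eq_mul, smul_eq_mul]
  ring

lemma adaptiveSum_excess_le (hact : ∀ z, P.act z ∈ Set.Icc (0 : ℝ) 1)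
    (hlam : 0 ≤ P.lam) {T : ℕ} (hn : 2 ≤ n) (hT : 4 * Real.log n ≤ T) (hbeta : 0 < P.beta)
    (hbeta' : P.beta = 1 - √(Real.log n / T)) {train : Fin T → Example N}
    (htrain : ∀ i, train i ∈ bounded φ) {q : Fin n → ℝ} (hq : q ∈ stdSimplex ℝ (Fin n)) :
    adaptiveSum (fun t p => excess P.act φ (P.lam • q) (predictor P (weightsAfter P φ t p))) T
      train ≤ 6 * P.lam * √(T * Real.log n) := by
  have hregret := multiplicativeWeights_regret_stdSimplex_le hbeta
    (w := fun t => weightsAfter P φ t (Fin.take t t.is_le train))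
    (l := fun t => lossVec P φ (weightsAfter P φ t (Fin.take t t.is_lt.le train)) (train t))
    (fun _ _ => rfl) (fun t => lossVec_mem_Icc hact _ (htrain t)) (fun _ => rfl) hn hT hbeta' hq
  simp only [adaptiveSum, excess_eq hq (weightsAfter_pos hbeta _), ← Finset.mul_sum]
  calc _ ≤ 2 * P.lam * (3 * √(T * Real.log n)) := by
        gcongr
        exact hregret
    _ = 6 * P.lam * √(T * Real.log n) := by ring

end Regret

/-! ### The risk in terms of features -/

section Learning

variable {N n : ℕ}

/-- The risk of `u` with respect to the features `φ`. -/
noncomputable def featRisk (act : ℝ → ℝ) (φ : (Fin N → ℝ) → Fin n → ℝ) (w : Fin n → ℝ)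
    (D : Measure (Example N)) (u : Fin n → ℝ) : ℝ :=
  ∫ s, (act (u ⬝ᵥ φ s.1) - act (w ⬝ᵥ φ s.1)) ^ 2 ∂D

/-- The squared loss `(σ(u · φ) - y) ^ 2` of `u` on an example. -/
noncomputable def sqLoss (act : ℝ → ℝ) (φ : (Fin N → ℝ) → Fin n → ℝ) (u : Fin n → ℝ)
    (s : Example N) : ℝ :=
  (act (u ⬝ᵥ φ s.1) - s.2) ^ 2

/-- A distribution of examples with bounded features `φ` and `E[Y | X] = σ(w · φ(X))`.  It covers
both the features `x` and the features `(x, -x, 0)`. -/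
structure FeatureModel (act : ℝ → ℝ) (φ : (Fin N → ℝ) → Fin n → ℝ) (w : Fin n → ℝ)
    (D : Measure (Example N)) : Prop where
  isProbabilityMeasure : IsProbabilityMeasure D
  measurable_features : ∀ j, Measurable fun x => φ x j
  ae_bounded : ∀ᵐ s ∂D, s ∈ bounded φ
  condExp_eq : D[fun s => s.2 | MeasurableSpace.comap Prod.fst inferInstance] =ᵐ[D]
    fun s => act (w ⬝ᵥ φ s.1)

variable {act : ℝ → ℝ} {φ : (Fin N → ℝ) → Fin n → ℝ} {w : Fin n → ℝ} {D : Measure (Example N)}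

lemma abs_dotProduct_le {u x : Fin n → ℝ} (hx : ∀ j, |x j| ≤ 1) : |u ⬝ᵥ x| ≤ ∑ j, |u j| := by
  refine (Finset.abs_sum_le_sum_abs _ _).trans (Finset.sum_le_sum fun j _ => ?_)
  rw [abs_mul]
  exact mul_le_of_le_one_right (abs_nonneg _) (hx j)

lemma abs_smul_dotProduct_le {lam : ℝ} (hlam : 0 ≤ lam) {p x : Fin n → ℝ}
    (hp : p ∈ stdSimplex ℝ (Fin n)) (hx : ∀ j, |x j| ≤ 1) : |(lam • p) ⬝ᵥ x| ≤ lam := by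
  refine (abs_dotProduct_le hx).trans_eq ?_
  simp only [Pi.smul_apply, smul_eq_mul, abs_mul, abs_of_nonneg hlam, abs_of_nonneg (hp.1 _)]
  rw [← Finset.mul_sum, hp.2, mul_one]

lemma measurable_dotProduct_features (hφ : ∀ j, Measurable fun x => φ x j) (u : Fin n → ℝ) :
    Measurable fun s : Example N => u ⬝ᵥ φ s.1 := by
  unfold dotProduct
  fun_prop

lemma sq_sub_le_mul_of_monotone {act : ℝ → ℝ} (hmono : Monotone act) (hlip : LipschitzWith 1 act)
    (x y : ℝ) : (act x - act y) ^ 2 ≤ (act x - act y) * (x - y) := by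
  have hxy : |act x - act y| ≤ |x - y| := by
    simpa [Real.dist_eq] using hlip.dist_le_mul x y
  have hnonneg : 0 ≤ (act x - act y) * (x - y) := by
    rcases le_total x y with h | h
    · exact mul_nonneg_of_nonpos_of_nonpos (sub_nonpos.2 (hmono h)) (sub_nonpos.2 h)
    · exact mul_nonneg (sub_nonneg.2 (hmono h)) (sub_nonneg.2 h)
  rw [← sq_abs, sq, ← abs_of_nonneg hnonneg, abs_mul]
  exact mul_le_mul_of_nonneg_left hxy (abs_nonneg _)

lemma sqLoss_mem_Icc (hact01 : ∀ z, act z ∈ Set.Icc (0 : ℝ) 1) (u : Fin n → ℝ)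
    {s : Example N} (hs : s ∈ bounded φ) :
    sqLoss act φ u s ∈ Set.Icc (0 : ℝ) 1 :=
  ⟨sq_nonneg _, (sq_le_one_iff_abs_le_one _).2 (Real.dist_le_of_mem_Icc_01 (hact01 _) hs.2)⟩

namespace FeatureModel

variable (h : FeatureModel act φ w D)

include h

lemma integrable_of_bound {f : Example N → ℝ} (hf : Measurable f) {B : ℝ}
    (hB : ∀ s ∈ bounded φ, |f s| ≤ B) : Integrable f D := by
  have := h.isProbabilityMeasure
  exact Integrable.of_bound hf.aestronglyMeasurable B (h.ae_bounded.mono hB)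

lemma integral_mul_label {g : (Fin N → ℝ) → ℝ} (hg : Measurable g) {B : ℝ}
    (hB : ∀ s ∈ bounded φ, |g s.1| ≤ B) :
    ∫ s, g s.1 * s.2 ∂D = ∫ s, g s.1 * act (w ⬝ᵥ φ s.1) ∂D := by
  have := h.isProbabilityMeasure
  have hlabel : Integrable (fun s : Example N => s.2) D :=
    h.integrable_of_bound measurable_snd (B := 1) fun s hs => abs_le.2
      ⟨by linarith [hs.2.1], hs.2.2⟩
  have hmul : Integrable ((fun s : Example N => g s.1) * fun s => s.2) D :=
    hlabel.bdd_mul (c := B) (hg.comp measurable_fst).aestronglyMeasurable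
      (h.ae_bounded.mono hB)
  have hpull := condExp_mul_of_stronglyMeasurable_left
    (m := MeasurableSpace.comap (Prod.fst : Example N → Fin N → ℝ) inferInstance)
    (hg.comp (comap_measurable _)).stronglyMeasurable hmul hlabel
  refine (integral_condExp (measurable_fst (α := Fin N → ℝ) (β := ℝ)).comap_le).symm.trans
    (integral_congr_ae ?_)
  filter_upwards [hpull, h.condExp_eq] with s hs hact
  exact hs.trans (congrArg (g s.1 * ·) hact)

lemma measurable_sqLoss (hact : Measurable act) (u : Fin n → ℝ) : Measurable (sqLoss act φ u) :=
  ((hact.comp (measurable_dotProduct_features h.measurable_features u)).sub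
    measurable_snd).pow_const 2

variable (hact01 : ∀ z, act z ∈ Set.Icc (0 : ℝ) 1)

include hact01

lemma integral_sub_mul_residual (hact : Measurable act) {A : Example N → ℝ}
    (hA : Integrable A D) {g : (Fin N → ℝ) → ℝ} (hg : Measurable g) {B : ℝ}
    (hB : ∀ s ∈ bounded φ, |g s.1| ≤ B) :
    ∫ s, (A s - g s.1 * (s.2 - act (w ⬝ᵥ φ s.1))) ∂D = ∫ s, A s ∂D := by
  have hact_meas := hact.comp (measurable_dotProduct_features h.measurable_features w)
  have hg' : Measurable fun s : Example N => g s.1 := hg.comp measurable_fst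
  have hint {y : Example N → ℝ} (hy : Measurable y)
      (hy01 : ∀ s ∈ bounded φ, y s ∈ Set.Icc (0 : ℝ) 1) :
      Integrable (fun s => g s.1 * y s) D :=
    h.integrable_of_bound (hg'.mul hy) (B := B) fun s hs => by
      rw [abs_mul, abs_of_nonneg (hy01 s hs).1]
      exact (mul_le_of_le_one_right (abs_nonneg _) (hy01 s hs).2).trans (hB s hs)
  have hlabel : Integrable (fun s => g s.1 * s.2) D := hint measurable_snd fun s hs => hs.2
  have hpred : Integrable (fun s => g s.1 * act (w ⬝ᵥ φ s.1)) D :=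
    hint hact_meas fun s _ => hact01 _
  simp only [mul_sub]
  rw [integral_sub hA (hlabel.sub' hpred), integral_sub hlabel hpred,
    h.integral_mul_label hg hB, sub_self, sub_zero]

lemma integrable_sq_act_sub_act (hact : Measurable act) (u : Fin n → ℝ) :
    Integrable (fun s : Example N => (act (u ⬝ᵥ φ s.1) - act (w ⬝ᵥ φ s.1)) ^ 2) D := by
  have hmeas (v) := hact.comp (measurable_dotProduct_features h.measurable_features v)
  refine h.integrable_of_bound (B := 1) (((hmeas u).sub (hmeas w)).pow_const 2) fun s _ => ?_
  rw [abs_pow]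
  exact pow_le_one₀ (abs_nonneg _) (Real.dist_le_of_mem_Icc_01 (hact01 _) (hact01 _))

lemma integral_sqLoss (hact : Measurable act) (u : Fin n → ℝ) :
    ∫ s, sqLoss act φ u s ∂D = featRisk act φ w D u + ∫ s, sqLoss act φ w s ∂D := by
  have hmeas (v : Fin n → ℝ) : Measurable fun x => act (v ⬝ᵥ φ x) := by
    have := h.measurable_features
    unfold dotProduct
    fun_prop
  have hsq := h.integrable_sq_act_sub_act hact01 hact u
  have hloss : Integrable (sqLoss act φ w) D :=
    h.integrable_of_bound (h.measurable_sqLoss hact w) (B := 1) fun s hs => by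
      rw [abs_of_nonneg (sqLoss_mem_Icc hact01 w hs).1]
      exact (sqLoss_mem_Icc hact01 w hs).2
  rw [featRisk, ← integral_add hsq hloss, ← h.integral_sub_mul_residual hact01 hact
    (hsq.fun_add hloss) (g := fun x => 2 * (act (u ⬝ᵥ φ x) - act (w ⬝ᵥ φ x))) (B := 2)]
  · refine integral_congr_ae (ae_of_all _ fun s => ?_)
    simp only [sqLoss]
    ring
  · exact ((hmeas u).sub (hmeas w)).const_mul 2
  · intro s _
    have := Real.dist_le_of_mem_Icc_01 (hact01 (u ⬝ᵥ φ s.1)) (hact01 (w ⬝ᵥ φ s.1))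
    rw [Real.dist_eq] at this
    rw [abs_mul, abs_two]
    linarith

lemma featRisk_le_integral_excess (hmono : Monotone act) (hlip : LipschitzWith 1 act)
    (u : Fin n → ℝ) : featRisk act φ w D u ≤ ∫ s, excess act φ w u s ∂D := by
  have hact : Measurable act := hlip.continuous.measurable
  have hmeas (v) := measurable_dotProduct_features h.measurable_features v
  have hdiff (s) (hs : s ∈ bounded φ) :
      |u ⬝ᵥ φ s.1 - w ⬝ᵥ φ s.1| ≤ ∑ j, |u j| + ∑ j, |w j| :=
    (abs_sub _ _).trans (add_le_add (abs_dotProduct_le hs.1) (abs_dotProduct_le hs.1))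
  have hint : Integrable (fun s : Example N => (act (u ⬝ᵥ φ s.1) - act (w ⬝ᵥ φ s.1)) *
      (u ⬝ᵥ φ s.1 - w ⬝ᵥ φ s.1)) D := by
    refine h.integrable_of_bound (B := 1 * (∑ j, |u j| + ∑ j, |w j|))
      (((hact.comp (hmeas u)).sub (hact.comp (hmeas w))).mul ((hmeas u).sub (hmeas w)))
      fun s hs => ?_
    rw [abs_mul]
    exact mul_le_mul (Real.dist_le_of_mem_Icc_01 (hact01 _) (hact01 _)) (hdiff s hs)
      (abs_nonneg _) zero_le_one
  refine (integral_mono (h.integrable_sq_act_sub_act hact01 hact u) hint fun s =>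
    sq_sub_le_mul_of_monotone hmono hlip _ _).trans_eq ?_
  rw [← h.integral_sub_mul_residual hact01 hact hint (g := fun x => u ⬝ᵥ φ x - w ⬝ᵥ φ x) ?_ hdiff]
  · refine integral_congr_ae (ae_of_all _ fun s => ?_)
    simp only [excess]
    ring
  · have := h.measurable_features
    unfold dotProduct
    fun_prop

end FeatureModel

end Learning

section Trajectory

variable {N n : ℕ} {P : Params} {φ : (Fin N → ℝ) → Fin n → ℝ}

lemma mem_visited_iff {T : ℕ} {train : Fin T → Example N} {u : Fin n → ℝ} :
    u ∈ visited P φ T train ↔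
      ∃ t : Fin T, u = predictor P (weightsAfter P φ t (Fin.take t t.is_lt.le train)) := by
  induction T with
  | zero => simp [visited]
  | succ T ih => rw [visited, Set.mem_insert_iff, ih, Fin.exists_fin_succ', or_comm]; rfl

lemma measurable_normalized : Measurable (normalized : (Fin n → ℝ) → Fin n → ℝ) := by
  unfold normalized
  fun_prop

lemma measurable_predictor_dotProduct (hφ : ∀ j, Measurable fun x => φ x j) :
    Measurable fun z : (Fin n → ℝ) × Example N => predictor P z.1 ⬝ᵥ φ z.2.1 := by
  have := measurable_normalized (n := n)
  unfold predictor dotProduct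
  fun_prop

lemma measurable_nextWeights (hact : Measurable P.act) (hφ : ∀ j, Measurable fun x => φ x j) :
    Measurable fun z : (Fin n → ℝ) × Example N => nextWeights P φ z.1 z.2 := by
  have := measurable_normalized (n := n)
  unfold nextWeights lossVec dotProduct
  fun_prop

lemma measurable_weightsAfter (hact : Measurable P.act) (hφ : ∀ j, Measurable fun x => φ x j)
    (t : ℕ) : Measurable (weightsAfter P φ t : (Fin t → Example N) → Fin n → ℝ) := by
  induction t with
  | zero => exact measurable_const
  | succ t ih =>
    exact (measurable_nextWeights hact hφ).comp
      ((ih.comp measurable_init).prodMk (measurable_pi_apply (Fin.last t)))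

end Trajectory

section Events

variable {N n M T : ℕ} {P : Params} {φ : (Fin N → ℝ) → Fin n → ℝ} {D : Measure (Example N)}

lemma FeatureModel.ae_pi_bounded {act : ℝ → ℝ} {w : Fin n → ℝ} (h : FeatureModel act φ w D)
    (T : ℕ) : ∀ᵐ x ∂(Measure.pi fun _ : Fin T => D), ∀ i, x i ∈ bounded φ := by
  have := h.isProbabilityMeasure
  exact Filter.eventually_all.2 fun i =>
    (Measure.quasiMeasurePreserving_eval (μ := fun _ : Fin T => D) i).ae h.ae_bounded

lemma abs_excess_le (hact : ∀ z, P.act z ∈ Set.Icc (0 : ℝ) 1) (hlam : 0 ≤ P.lam)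
    {q p : Fin n → ℝ} (hq : q ∈ stdSimplex ℝ (Fin n)) (hp : p ∈ stdSimplex ℝ (Fin n))
    {ex : Example N} (hex : ex ∈ bounded φ) :
    |excess P.act φ (P.lam • q) (P.lam • p) ex| ≤ 2 * P.lam := by
  rw [excess, abs_mul]
  calc _ ≤ 1 * (P.lam + P.lam) := by
        refine mul_le_mul (Real.dist_le_of_mem_Icc_01 (hact _) hex.2) ?_ (abs_nonneg _) zero_le_one
        exact (abs_sub _ _).trans (add_le_add (abs_smul_dotProduct_le hlam hp hex.1)
          (abs_smul_dotProduct_le hlam hq hex.1))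
    _ = 2 * P.lam := by ring

lemma measurable_excess_weightsAfter (hact : Measurable P.act)
    (hφ : ∀ j, Measurable fun x => φ x j) (w : Fin n → ℝ) (t : ℕ) :
    Measurable fun z : (Fin t → Example N) × Example N =>
      excess P.act φ w (predictor P (weightsAfter P φ t z.1)) z.2 := by
  have hpred : Measurable fun z : (Fin t → Example N) × Example N =>
      predictor P (weightsAfter P φ t z.1) ⬝ᵥ φ z.2.1 :=
    (measurable_predictor_dotProduct hφ).comp
      ((measurable_weightsAfter hact hφ t).prodMap measurable_id)
  have htarget : Measurable fun z : (Fin t → Example N) × Example N => w ⬝ᵥ φ z.2.1 :=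
    (measurable_dotProduct_features hφ w).comp measurable_snd
  unfold excess
  fun_prop

section Candidates

variable [NeZero n] {q : Fin n → ℝ} (h : FeatureModel P.act φ (P.lam • q) D)
  (hact : ∀ z, P.act z ∈ Set.Icc (0 : ℝ) 1) (hlip : LipschitzWith 1 P.act)
  (hq : q ∈ stdSimplex ℝ (Fin n))

include h hact hlip hq

lemma measure_adaptiveSum_excess_ge_le (hlam : 0 < P.lam) (hbeta : 0 < P.beta) (hT : 0 < T)
    {r : ℝ} (hr : 0 ≤ r) :
    (Measure.pi fun _ : Fin T => D)
      {x | r ≤ adaptiveSum (fun t p ex =>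
        (∫ ex', excess P.act φ (P.lam • q) (predictor P (weightsAfter P φ t p)) ex' ∂D) -
          excess P.act φ (P.lam • q) (predictor P (weightsAfter P φ t p)) ex) T x} ≤
      ENNReal.ofReal (Real.exp (-(r ^ 2 / (2 * T * (2 * P.lam) ^ 2)))) := by
  have := h.isProbabilityMeasure
  refine measure_adaptiveSum_ge_le D (l := -(2 * P.lam)) (measurable_excess_weightsAfter
    hlip.continuous.measurable h.measurable_features _) (by positivity) (fun t p => ?_) hT hr
  filter_upwards [h.ae_bounded] with s hs
  have habs := abs_le.1 (abs_excess_le hact hlam.le hq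
    (normalized_mem_stdSimplex (weightsAfter_pos (φ := φ) hbeta p)) hs)
  exact ⟨habs.1, habs.2.trans_eq (by ring)⟩

/-- By the regret bound, the average risk of the candidates is small unless the excess deviates
from its conditional expectation. -/
lemma exists_visited_featRisk_le (hmono : Monotone P.act) (hlam : 0 ≤ P.lam) (hn : 2 ≤ n)
    (hT : 4 * Real.log n ≤ T) (hbeta : 0 < P.beta) (hbeta' : P.beta = 1 - √(Real.log n / T))
    {train : Fin T → Example N} (htrain : ∀ i, train i ∈ bounded φ) {r τ : ℝ}
    (hr : adaptiveSum (fun t p ex =>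
        (∫ ex', excess P.act φ (P.lam • q) (predictor P (weightsAfter P φ t p)) ex' ∂D) -
          excess P.act φ (P.lam • q) (predictor P (weightsAfter P φ t p)) ex) T train ≤ r)
    (hτ : r + 6 * P.lam * √(T * Real.log n) ≤ T * τ) :
    ∃ u ∈ visited P φ T train, featRisk P.act φ (P.lam • q) D u ≤ τ := by
  have hT0 : (0 : ℝ) < T := by linarith [Real.log_pos (Nat.one_lt_cast.2 hn : (1 : ℝ) < n)]
  have : NeZero T := ⟨Nat.cast_ne_zero.1 hT0.ne'⟩
  have hregret := adaptiveSum_excess_le hact hlam hn hT hbeta hbeta' htrain hq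
  obtain ⟨t, -, ht⟩ : ∃ t ∈ (Finset.univ : Finset (Fin T)), featRisk P.act φ (P.lam • q) D
      (predictor P (weightsAfter P φ t (Fin.take t t.is_lt.le train))) ≤ τ := by
    refine Finset.exists_le_of_sum_le Finset.univ_nonempty ?_
    rw [Finset.sum_const, Finset.card_univ, Fintype.card_fin, nsmul_eq_mul]
    refine le_trans ?_ ((add_le_add hr hregret).trans hτ)
    rw [adaptiveSum, adaptiveSum, ← Finset.sum_add_distrib]
    refine Finset.sum_le_sum fun t _ => ?_
    rw [sub_add_cancel]
    exact h.featRisk_le_integral_excess hact hmono hlip _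
  exact ⟨_, mem_visited_iff.2 ⟨t, rfl⟩, ht⟩

lemma measure_forall_visited_lt_featRisk_le (hmono : Monotone P.act) (hlam : 0 < P.lam)
    (heps : 0 < P.eps) (hn : 2 ≤ n) (hT4 : 4 * Real.log n ≤ T) (hbeta : 0 < P.beta)
    (hbeta' : P.beta = 1 - √(Real.log n / T)) {ℓ : ℝ} (hℓ : Real.log n ≤ ℓ)
    (hT : 1024 * P.lam ^ 2 * ℓ / P.eps ^ 2 ≤ T) :
    (Measure.pi fun _ : Fin T => D)
      {x | ∀ u ∈ visited P φ T x, P.eps / 2 < featRisk P.act φ (P.lam • q) D u} ≤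
      ENNReal.ofReal (Real.exp (-(2 * ℓ))) := by
  have hlog : 0 < Real.log n := Real.log_pos (Nat.one_lt_cast.2 hn)
  have hT0 : (0 : ℝ) < T := by linarith
  rw [div_le_iff₀ (by positivity)] at hT
  have hdev := measure_adaptiveSum_excess_ge_le h hact hlip hq hlam hbeta (Nat.cast_pos.1 hT0)
    (r := P.eps * T / 4) (by positivity)
  have hregret : 6 * P.lam * √(T * Real.log n) ≤ P.eps * T / 4 := by
    refine le_trans ?_ (by linarith [mul_pos heps hT0] : 6 * (P.eps * T / 32) ≤ P.eps * T / 4)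
    rw [mul_assoc]
    refine mul_le_mul_of_nonneg_left (abs_le_of_sq_le_sq' ?_ (by positivity)).2 (by norm_num)
    rw [mul_pow, Real.sq_sqrt (by positivity)]
    have := mul_le_mul_of_nonneg_left hℓ (by positivity : 0 ≤ P.lam ^ 2 * T)
    linarith [mul_le_mul_of_nonneg_right hT hT0.le]
  have hexponent : 2 * ℓ ≤ (P.eps * T / 4) ^ 2 / (2 * T * (2 * P.lam) ^ 2) := by
    rw [le_div_iff₀ (by positivity)]
    have := mul_pos (pow_pos heps 2) (pow_pos hT0 2)
    linarith [mul_le_mul_of_nonneg_right hT hT0.le]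
  refine (measure_mono_ae ?_).trans (hdev.trans (ENNReal.ofReal_le_ofReal
    (Real.exp_le_exp.2 (neg_le_neg hexponent))))
  filter_upwards [h.ae_pi_bounded T] with x hx hbad
  refine le_of_not_ge fun hr => ?_
  obtain ⟨u, hu, hrisk⟩ := exists_visited_featRisk_le h hact hlip hq hmono hlam.le hn hT4 hbeta
    hbeta' hx hr (τ := P.eps / 2) (by linarith)
  exact (hbad u hu).not_ge hrisk

end Candidates

lemma measurable_sqLoss_predictor (hact : Measurable P.act)
    (hφ : ∀ j, Measurable fun x => φ x j) :
    Measurable fun z : (Fin n → ℝ) × Example N => sqLoss P.act φ (predictor P z.1) z.2 :=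
  ((hact.comp (measurable_predictor_dotProduct hφ)).sub
    (measurable_snd.comp measurable_snd)).pow_const 2

lemma measurableSet_estimate_ge [IsProbabilityMeasure D] (hact : Measurable P.act)
    (hφ : ∀ j, Measurable fun x => φ x j) (τ : ℝ) :
    MeasurableSet {z : (Fin n → ℝ) × (Fin M → Example N) |
      τ ≤ |empRisk P.act φ z.2 (predictor P z.1) -
        ∫ s, sqLoss P.act φ (predictor P z.1) s ∂D|} := by
  have hloss := measurable_sqLoss_predictor hact hφ
  have hemp : Measurable fun z : (Fin n → ℝ) × (Fin M → Example N) =>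
      empRisk P.act φ z.2 (predictor P z.1) :=
    (Finset.measurable_fun_sum _ fun m _ => hloss.comp
      (measurable_fst.prodMk ((measurable_pi_apply m).comp measurable_snd))).div_const _
  have hmean : Measurable fun z : (Fin n → ℝ) × (Fin M → Example N) =>
      ∫ s, sqLoss P.act φ (predictor P z.1) s ∂D :=
    (hloss.stronglyMeasurable.integral_prod_right' (ν := D)).measurable.comp measurable_fst
  exact measurableSet_le measurable_const (hemp.sub hmean).abs

lemma measure_estimate_ge_le {w : Fin n → ℝ} (h : FeatureModel P.act φ w D)
    (hact : Measurable P.act) (hact01 : ∀ z, P.act z ∈ Set.Icc (0 : ℝ) 1) (hM : 0 < M) {τ : ℝ}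
    (hτ : 0 ≤ τ) {Ω : Type*} [MeasurableSpace Ω] (μ : Measure Ω) [IsProbabilityMeasure μ]
    {v : Ω → Fin n → ℝ} (hv : Measurable v) :
    (μ.prod (Measure.pi fun _ : Fin M => D))
      {s | τ ≤ |empRisk P.act φ s.2 (predictor P (v s.1)) -
        ∫ z, sqLoss P.act φ (predictor P (v s.1)) z ∂D|} ≤
      2 * ENNReal.ofReal (Real.exp (-(2 * M * τ ^ 2))) := by
  have := h.isProbabilityMeasure
  have hmeas : MeasurableSet {s : Ω × (Fin M → Example N) |
      τ ≤ |empRisk P.act φ s.2 (predictor P (v s.1)) -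
        ∫ z, sqLoss P.act φ (predictor P (v s.1)) z ∂D|} :=
    (hv.prodMap measurable_id) (measurableSet_estimate_ge hact h.measurable_features τ)
  have : SigmaFinite (Measure.pi fun _ : Fin M => D) := inferInstance
  rw [Measure.prod_apply hmeas]
  refine (lintegral_mono fun x => measure_abs_sum_div_sub_integral_ge_le D
    (h.measurable_sqLoss hact (predictor P (v x)))
    (h.ae_bounded.mono fun s => sqLoss_mem_Icc hact01 _) hM hτ).trans_eq ?_
  rw [lintegral_const, measure_univ, mul_one]

lemma measure_exists_visited_estimate_ge_le {w : Fin n → ℝ} (h : FeatureModel P.act φ w D)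
    (hact : Measurable P.act) (hact01 : ∀ z, P.act z ∈ Set.Icc (0 : ℝ) 1) (hM : 0 < M) {τ : ℝ}
    (hτ : 0 ≤ τ) :
    ((Measure.pi fun _ : Fin T => D).prod (Measure.pi fun _ : Fin M => D))
      {s | ∃ u ∈ visited P φ T s.1,
        τ ≤ |empRisk P.act φ s.2 u - ∫ s, sqLoss P.act φ u s ∂D|} ≤
      T * (2 * ENNReal.ofReal (Real.exp (-(2 * M * τ ^ 2)))) := by
  have := h.isProbabilityMeasure
  have hweights (t : Fin T) : Measurable fun x : Fin T → Example N =>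
      weightsAfter P φ t (Fin.take t t.is_lt.le x) :=
    (measurable_weightsAfter hact h.measurable_features t).comp
      (measurable_pi_lambda _ fun _ => measurable_pi_apply _)
  refine (measure_mono ?_).trans ((measure_iUnion_fintype_le _ _).trans
    ((Finset.sum_le_sum fun t _ => measure_estimate_ge_le h hact hact01 hM hτ
      (Measure.pi fun _ : Fin T => D) (hweights t)).trans_eq ?_))
  · rintro s ⟨u, hu, hdev⟩
    obtain ⟨t, rfl⟩ := mem_visited_iff.1 hu
    exact Set.mem_iUnion.2 ⟨t, hdev⟩
  · rw [Finset.sum_const, Finset.card_univ, Fintype.card_fin, nsmul_eq_mul]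

end Events

section Sizes

variable {n T M : ℕ} {lam eps delta : ℝ}

lemma numReps_pos {P : Params} (hT : 0 < T) (hM : 0 < M) (hdelta : 0 < P.delta)
    (hdelta1 : P.delta < 1) : 0 < numReps P T M := by
  refine Nat.ceil_pos.2 (mul_pos (by norm_num) (Real.log_pos ?_))
  rw [lt_div_iff₀ hdelta, one_mul]
  exact hdelta1.trans_le (by exact_mod_cast Nat.mul_pos hM hT)

lemma mul_exp_numReps_le {P : Params} (hT : 0 < T) (hM : 0 < M) (hdelta : 0 < P.delta) :
    (T : ℝ≥0∞) * (M * ENNReal.ofReal (Real.exp (-(numReps P T M / 6)))) ≤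
      ENNReal.ofReal P.delta := by
  have hexp : Real.exp (-(numReps P T M / 6)) ≤ P.delta / (M * T) := by
    have hreps : 6 * Real.log (M * T / P.delta) ≤ numReps P T M := Nat.le_ceil _
    rw [← inv_div (M * T : ℝ), ← Real.exp_log (show 0 < M * T / P.delta by positivity),
      ← Real.exp_neg, Real.exp_le_exp]
    linarith
  rw [← ENNReal.ofReal_natCast T, ← ENNReal.ofReal_natCast M, ← ENNReal.ofReal_mul M.cast_nonneg,
    ← ENNReal.ofReal_mul T.cast_nonneg]
  refine ENNReal.ofReal_le_ofReal ?_
  calc (T : ℝ) * (M * Real.exp (-(numReps P T M / 6))) ≤ T * (M * (P.delta / (M * T))) := by gcongr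
    _ = P.delta := by field_simp

lemma exp_neg_two_mul_log {x : ℝ} (hx : 0 < x) : Real.exp (-(2 * Real.log x)) = x⁻¹ ^ 2 := by
  rw [← mul_neg, ← Real.log_inv, two_mul, Real.exp_add, Real.exp_log (inv_pos.2 hx), sq]

lemma exp_neg_two_mul_log_div_le (hn : 2 ≤ n) (heps : 0 < eps) (heps1 : eps < 1)
    (hdelta : 0 < delta) (hdelta1 : delta < 1) :
    Real.exp (-(2 * Real.log (n / (delta * eps)))) ≤ delta / 3 := by
  have hn' : (2 : ℝ) ≤ n := Nat.ofNat_le_cast.2 hn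
  rw [exp_neg_two_mul_log (by positivity), inv_div]
  calc (delta * eps / n) ^ 2 ≤ (delta * 1 / 2) ^ 2 := by gcongr
    _ = delta * delta / 4 := by ring
    _ ≤ delta * 1 / 3 := by
        gcongr
        norm_num
    _ = delta / 3 := by rw [mul_one]

lemma natCast_mul_two_mul_exp_le (hT : (6 : ℝ) ≤ T) (heps : 0 < eps) (hdelta : 0 < delta)
    (hdelta1 : delta < 1) (hM : 1024 * Real.log (T / delta) / eps ^ 2 ≤ M) :
    (T : ℝ≥0∞) * (2 * ENNReal.ofReal (Real.exp (-(2 * M * (eps / 16) ^ 2)))) ≤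
      ENNReal.ofReal (delta / 3) := by
  have hlog : 0 ≤ Real.log (T / delta) := Real.log_nonneg (by rw [le_div_iff₀ hdelta]; linarith)
  have hexp : Real.exp (-(2 * M * (eps / 16) ^ 2)) ≤ (delta / T) ^ 2 := by
    rw [← inv_div (T : ℝ), ← exp_neg_two_mul_log (by positivity), Real.exp_le_exp]
    rw [div_le_iff₀ (by positivity)] at hM
    linarith
  rw [← ENNReal.ofReal_natCast T, ← ENNReal.ofReal_ofNat 2, ← ENNReal.ofReal_mul (by norm_num),
    ← ENNReal.ofReal_mul (by linarith)]
  refine ENNReal.ofReal_le_ofReal ?_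
  calc (T : ℝ) * (2 * Real.exp (-(2 * M * (eps / 16) ^ 2))) ≤ T * (2 * (delta / T) ^ 2) := by gcongr
    _ = 2 * (delta * delta) / T := by field_simp
    _ ≤ 2 * (delta * 1) / 6 := by gcongr
    _ = delta / 3 := by ring

lemma log_natCast_le_log_div (hn : 1 ≤ n) {c : ℝ} (hc : 0 < c) (hc1 : c ≤ 1) :
    Real.log n ≤ Real.log (n / c) :=
  Real.log_le_log (Nat.cast_pos.2 hn) (le_div_self n.cast_nonneg hc hc1)

namespace SampleSizes

lemma pos {C : ℝ} (hS : SampleSizes C n lam eps delta T M) : 0 < T :=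
  Nat.cast_pos.1 ((Real.log_natCast_nonneg n).trans_lt hS.1)

lemma parameters_beta_pos {C : ℝ} (hS : SampleSizes C n lam eps delta T M) (act : ℝ → ℝ) :
    0 < (parameters act lam eps delta n T).beta := by
  have hT : (0 : ℝ) < T := Nat.cast_pos.2 hS.pos
  change 0 < 1 - √(Real.log n / T)
  rw [sub_pos, Real.sqrt_lt' one_pos, div_lt_iff₀ hT, one_pow, one_mul]
  exact hS.1

lemma mul_log_le (hS : SampleSizes 1024 n lam eps delta T M) (heps : 0 < eps)
    (hlam : eps / 2 < lam) (hlog : 0 ≤ Real.log (n / (delta * eps))) :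
    256 * Real.log (n / (delta * eps)) ≤ T := by
  refine le_trans ?_ hS.2.1
  rw [le_div_iff₀ (by positivity)]
  have hsq : (eps / 2) ^ 2 ≤ lam ^ 2 := by gcongr
  linarith [mul_le_mul_of_nonneg_right hsq hlog]

lemma test_pos (hS : SampleSizes 1024 n lam eps delta T M) (heps : 0 < eps) (hdelta : 0 < delta)
    (hdelta1 : delta < 1) : 0 < M := by
  have hT : (1 : ℝ) ≤ T := Nat.one_le_cast.2 hS.pos
  have hlog : 0 < Real.log (T / delta) :=
    Real.log_pos (by rw [lt_div_iff₀ hdelta]; linarith)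
  exact Nat.cast_pos.1 (lt_of_lt_of_le (by positivity) hS.2.2)

end SampleSizes

end Sizes

section Guarantee

variable {N n M T : ℕ} {φ : (Fin N → ℝ) → Fin n → ℝ} {D : Measure (Example N)}

lemma featRisk_le_of_abs_sub_le {act : ℝ → ℝ} {w u : Fin n → ℝ} (h : FeatureModel act φ w D)
    (hlip : LipschitzWith 1 act) {c : ℝ}
    (hu : ∀ s ∈ bounded φ, |u ⬝ᵥ φ s.1 - w ⬝ᵥ φ s.1| ≤ c) :
    featRisk act φ w D u ≤ c ^ 2 := by
  have := h.isProbabilityMeasure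
  have hbound : ∀ᵐ s ∂D, ‖(act (u ⬝ᵥ φ s.1) - act (w ⬝ᵥ φ s.1)) ^ 2‖ ≤ c ^ 2 := by
    filter_upwards [h.ae_bounded] with s hs
    rw [norm_pow, ← dist_eq_norm]
    refine pow_le_pow_left₀ dist_nonneg ((hlip.dist_le_mul _ _).trans ?_) 2
    rw [NNReal.coe_one, one_mul]
    exact hu s hs
  refine (le_abs_self _).trans ((norm_integral_le_of_norm_le_const hbound).trans_eq ?_)
  rw [probReal_univ, mul_one]

section Learn

variable [NeZero n] {access : (Fin N → ℝ) → Fin n → RAM ℝ} {a : ℕ}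
  (hacc : ∀ x, Reads (access x) a (φ x))

include hacc

lemma failProb_learn_featRisk_le {P : Params} {w : Fin n → ℝ}
    (h : FeatureModel P.act φ w D) (hlip : LipschitzWith 1 P.act)
    (hact : ∀ z, P.act z ∈ Set.Icc (0 : ℝ) 1) (hbeta : 0 < P.beta) (hlam : 0 < P.lam)
    (heps : 0 < P.eps) (hT : 0 < T) (hM : 0 < M) (hK : 0 < numReps P T M)
    {train : Fin T → Example N} {test : Fin M → Example N} (htest : ∀ m, test m ∈ bounded φ)
    (hgood : ∃ u ∈ visited P φ T train, featRisk P.act φ w D u ≤ P.eps / 2)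
    (hest : ∀ u ∈ visited P φ T train,
      |empRisk P.act φ test u - ∫ s, sqLoss P.act φ u s ∂D| < P.eps / 16) :
    failProb (learn access P train test) (fun u => featRisk P.act φ w D u ≤ P.eps) ≤
      T * (M * ENNReal.ofReal (Real.exp (-(numReps P T M / 6)))) := by
  refine le_trans (failProb_mono ?_) (failProb_learn_le hacc hT (emp := empRisk P.act φ test)
    (τ := P.eps / 8) fun t x => failProb_approxRisk_le hacc hlip hact hlam heps hM hK htest
      (normalized_mem_stdSimplex (weightsAfter_pos hbeta x)))
  rintro u ⟨hu, hmin⟩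
  obtain ⟨v, hv, hrisk⟩ := hgood
  have hestu := abs_lt.1 (hest u hu)
  have hestv := abs_lt.1 (hest v hv)
  rw [h.integral_sqLoss hact hlip.continuous.measurable] at hestu hestv
  linarith [hmin v hv, hestu.1, hestv.2]

lemma measure_not_failProb_learn_le_add {P : Params} {w : Fin n → ℝ}
    (h : FeatureModel P.act φ w D) (hlip : LipschitzWith 1 P.act)
    (hact : ∀ z, P.act z ∈ Set.Icc (0 : ℝ) 1) (hbeta : 0 < P.beta) (hlam : 0 < P.lam)
    (heps : 0 < P.eps) (hdelta : 0 < P.delta) (hdelta1 : P.delta < 1) (hT : 0 < T) (hM : 0 < M) :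
    ((Measure.pi fun _ : Fin T => D).prod (Measure.pi fun _ : Fin M => D))
      {s | ¬ failProb (learn access P s.1 s.2) (fun u => featRisk P.act φ w D u ≤ P.eps) ≤
        ENNReal.ofReal P.delta} ≤
      (Measure.pi fun _ : Fin T => D)
        {x | ∀ u ∈ visited P φ T x, P.eps / 2 < featRisk P.act φ w D u} +
      ((Measure.pi fun _ : Fin T => D).prod (Measure.pi fun _ : Fin M => D))
        {s | ∃ u ∈ visited P φ T s.1,
          P.eps / 16 ≤ |empRisk P.act φ s.2 u - ∫ s, sqLoss P.act φ u s ∂D|} := by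
  have := h.isProbabilityMeasure
  have : IsProbabilityMeasure (Measure.pi fun _ : Fin M => D) := inferInstance
  have : SigmaFinite (Measure.pi fun _ : Fin M => D) := inferInstance
  have htest : ∀ᵐ s ∂(Measure.pi fun _ : Fin T => D).prod (Measure.pi fun _ : Fin M => D),
      ∀ i, s.2 i ∈ bounded φ :=
    Measure.quasiMeasurePreserving_snd.ae (h.ae_pi_bounded M)
  rw [← mul_one ((Measure.pi fun _ : Fin T => D) _),
    ← measure_univ (μ := Measure.pi fun _ : Fin M => D), ← Measure.prod_prod]
  refine (measure_mono_ae ?_).trans (measure_union_le _ _)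
  filter_upwards [htest] with s hs hfail
  by_contra hcon
  obtain ⟨hgood, hest⟩ := not_or.1 hcon
  simp only [Set.mem_prod, Set.mem_univ, and_true, Set.mem_ofPred_eq, not_forall, not_lt,
    exists_prop] at hgood
  simp only [Set.mem_ofPred_eq, not_exists, not_and, not_le] at hest
  exact hfail ((failProb_learn_featRisk_le hacc h hlip hact hbeta hlam heps hT hM
    (numReps_pos hT hM hdelta hdelta1) hs hgood hest).trans (mul_exp_numReps_le hT hM hdelta))

variable {act : ℝ → ℝ} {lam eps delta : ℝ}

lemma measure_not_failProb_learn_le_of_lt {q : Fin n → ℝ} (h : FeatureModel act φ (lam • q) D)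
    (hmono : Monotone act) (hlip : LipschitzWith 1 act) (hact : ∀ z, act z ∈ Set.Icc (0 : ℝ) 1)
    (hq : q ∈ stdSimplex ℝ (Fin n)) (hn : 2 ≤ n) (heps : 0 < eps) (heps1 : eps < 1)
    (hlam : eps / 2 < lam) (hdelta : 0 < delta) (hdelta1 : delta < 1)
    (hS : SampleSizes 1024 n lam eps delta T M) :
    ((Measure.pi fun _ : Fin T => D).prod (Measure.pi fun _ : Fin M => D))
      {s | ¬ failProb (learn access (parameters act lam eps delta n T) s.1 s.2)
        (fun u => featRisk act φ (lam • q) D u ≤ eps) ≤ ENNReal.ofReal (delta / 3)} ≤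
      ENNReal.ofReal (2 * delta / 3) := by
  have := h.isProbabilityMeasure
  have hlam0 : 0 < lam := (half_pos heps).trans hlam
  have hdelta3 : 0 < delta / 3 := by positivity
  have hM := hS.test_pos heps hdelta hdelta1
  have hbeta := hS.parameters_beta_pos act
  have hlogn : Real.log 2 ≤ Real.log n := Real.log_le_log two_pos (Nat.ofNat_le_cast.2 hn)
  have hlog : Real.log n ≤ Real.log (n / (delta * eps)) :=
    log_natCast_le_log_div (by omega) (mul_pos hdelta heps)
      (mul_le_one₀ hdelta1.le heps.le heps1.le)
  have hT := hS.mul_log_le heps hlam ((Real.log_natCast_nonneg n).trans hlog)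
  have hlog2 := Real.log_two_gt_d9
  set P := parameters act lam eps delta n T
  have hgood := (measure_forall_visited_lt_featRisk_le (P := P) h hact hlip hq hmono hlam0 heps hn
    (by linarith) hbeta rfl hlog hS.2.1).trans
    (ENNReal.ofReal_le_ofReal (exp_neg_two_mul_log_div_le hn heps heps1 hdelta hdelta1))
  have hest := (measure_exists_visited_estimate_ge_le (P := P) (T := T) (τ := eps / 16) h
    hlip.continuous.measurable hact hM (by positivity)).trans
    (natCast_mul_two_mul_exp_le (by linarith) heps hdelta hdelta1 hS.2.2)
  refine (measure_not_failProb_learn_le_add (P := P) hacc h hlip hact hbeta hlam0 heps hdelta3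
    (by linarith : delta / 3 < 1) hS.pos hM).trans ((add_le_add hgood hest).trans_eq ?_)
  rw [← ENNReal.ofReal_add hdelta3.le hdelta3.le]
  ring_nf

lemma failProb_learn_eq_zero (hbeta : 0 < (parameters act lam eps delta n T).beta) (hT : 0 < T)
    {good : (Fin n → ℝ) → Prop} (hgood : ∀ p ∈ stdSimplex ℝ (Fin n), good (lam • p))
    (train : Fin T → Example N) (test : Fin M → Example N) :
    failProb (learn access (parameters act lam eps delta n T) train test) good = 0 := by
  refine ((ensures_learn hacc hT train).mono le_rfl fun u hu => ?_).failProb_eq_zero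
  obtain ⟨t, rfl⟩ := mem_visited_iff.1 hu
  exact hgood _ (normalized_mem_stdSimplex (weightsAfter_pos hbeta _))

lemma measure_not_failProb_learn_le {w : Fin n → ℝ} (h : FeatureModel act φ w D)
    (hmono : Monotone act) (hlip : LipschitzWith 1 act) (hact : ∀ z, act z ∈ Set.Icc (0 : ℝ) 1)
    (hw0 : ∀ j, 0 ≤ w j) (hw : ∑ j, w j = lam) (heps : 0 < eps) (heps1 : eps < 1)
    (hdelta : 0 < delta) (hdelta1 : delta < 1) (hS : SampleSizes 1024 n lam eps delta T M) :
    ((Measure.pi fun _ : Fin T => D).prod (Measure.pi fun _ : Fin M => D))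
      {s | ¬ failProb (learn access (parameters act lam eps delta n T) s.1 s.2)
        (fun u => featRisk act φ w D u ≤ eps) ≤ ENNReal.ofReal (delta / 3)} ≤
      ENNReal.ofReal (2 * delta / 3) := by
  have hlam0 : 0 ≤ lam := hw ▸ Finset.sum_nonneg fun j _ => hw0 j
  by_cases hgood : ∀ p ∈ stdSimplex ℝ (Fin n), featRisk act φ w D (lam • p) ≤ eps
  · simp only [failProb_learn_eq_zero hacc (hS.parameters_beta_pos act) hS.pos
      (good := fun u => featRisk act φ w D u ≤ eps) hgood, zero_le, not_true_eq_false,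
      Set.ofPred_false, measure_empty]
  have hn : 2 ≤ n := by
    by_contra! hn
    obtain rfl : n = 1 := le_antisymm (Nat.le_of_lt_succ hn) (Nat.pos_of_neZero n)
    refine hgood fun p hp => (featRisk_le_of_abs_sub_le h hlip (c := 0) fun s _ => ?_).trans ?_
    · have hpw : lam • p = w := by
        funext j
        rw [Subsingleton.elim j 0, Pi.smul_apply, ← Fin.sum_univ_one p, hp.2, smul_eq_mul, mul_one,
          ← hw, Fin.sum_univ_one]
      rw [hpw, sub_self, abs_zero]
    · exact (zero_pow two_ne_zero).trans_le heps.le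
  have hlt : eps / 2 < lam := by
    by_contra! hle
    refine hgood fun p hp => (featRisk_le_of_abs_sub_le h hlip (c := eps) fun s hs => ?_).trans ?_
    · have hwx := abs_dotProduct_le (u := w) hs.1
      simp only [abs_of_nonneg (hw0 _), hw] at hwx
      exact (abs_sub _ _).trans (by linarith [abs_smul_dotProduct_le hlam0 hp hs.1])
    · exact pow_le_of_le_one heps.le heps1.le two_ne_zero
  have hlam : 0 < lam := (half_pos heps).trans hlt
  have hq : lam⁻¹ • w ∈ stdSimplex ℝ (Fin n) :=
    ⟨fun j => mul_nonneg (inv_nonneg.2 hlam0) (hw0 j), by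
      simp only [Pi.smul_apply, smul_eq_mul]
      rw [← Finset.mul_sum, hw, inv_mul_cancel₀ hlam.ne']⟩
  rw [← smul_inv_smul₀ hlam.ne' w] at h ⊢
  exact measure_not_failProb_learn_le_of_lt hacc h hmono hlip hact hq hn heps heps1 hlt hdelta
    hdelta1 hS

end Learn

lemma le_successProb [IsProbabilityMeasure D]
    {alg : (Fin T → Example N) → (Fin M → Example N) → RAM (Fin N → ℝ)} {good : Set (Fin N → ℝ)}
    {delta : ℝ} (hdelta : 0 < delta) (hdelta1 : delta < 1)
    (h : ((Measure.pi fun _ : Fin T => D).prod (Measure.pi fun _ : Fin M => D))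
      {s | ¬ failProb (alg s.1 s.2) (fun v => v ∈ good) ≤ ENNReal.ofReal (delta / 3)} ≤
      ENNReal.ofReal (2 * delta / 3)) :
    ENNReal.ofReal (1 - delta) ≤ successProb D T M alg good := by
  have : IsProbabilityMeasure (Measure.pi fun _ : Fin M => D) := inferInstance
  unfold successProb
  set μ := (Measure.pi fun _ : Fin T => D).prod (Measure.pi fun _ : Fin M => D)
  have : IsProbabilityMeasure μ := inferInstance
  set bad := {s : (Fin T → Example N) × (Fin M → Example N) |
    ¬ failProb (alg s.1 s.2) (fun v => v ∈ good) ≤ ENNReal.ofReal (delta / 3)}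
  have hbad : MeasurableSet (toMeasurable μ bad) := measurableSet_toMeasurable μ bad
  calc ENNReal.ofReal (1 - delta)
      ≤ ENNReal.ofReal ((1 - delta / 3) * (1 - 2 * delta / 3)) :=
        ENNReal.ofReal_le_ofReal (by linarith [mul_pos hdelta hdelta])
    _ = (1 - ENNReal.ofReal (delta / 3)) * (1 - ENNReal.ofReal (2 * delta / 3)) := by
        rw [ENNReal.ofReal_mul (by linarith), ENNReal.ofReal_sub _ (by positivity),
          ENNReal.ofReal_sub _ (by positivity), ENNReal.ofReal_one]
    _ ≤ (1 - ENNReal.ofReal (delta / 3)) * μ (toMeasurable μ bad)ᶜ := by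
        rw [prob_compl_eq_one_sub hbad, measure_toMeasurable]
        gcongr
    _ = ∫⁻ _ in (toMeasurable μ bad)ᶜ, (1 - ENNReal.ofReal (delta / 3)) ∂μ := by
        rw [setLIntegral_const]
    _ ≤ ∫⁻ s in (toMeasurable μ bad)ᶜ, (alg s.1 s.2).law.toOuterMeasure {r | r.1 ∈ good} ∂μ := by
        refine setLIntegral_mono' hbad.compl fun s hs => ?_
        have hfail : failProb (alg s.1 s.2) (fun v => v ∈ good) ≤ ENNReal.ofReal (delta / 3) :=
          not_not.1 fun hcon => hs (subset_toMeasurable μ bad hcon)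
        exact (tsub_le_tsub_left hfail 1).trans (one_sub_failProb_le _ _)
    _ ≤ _ := setLIntegral_le_lintegral _ _

lemma IsGLM.featureModel {act : ℝ → ℝ} {w : Fin N → ℝ} (h : IsGLM act w D) :
    FeatureModel act (fun x => x) w D := by
  refine ⟨h.isProbabilityMeasure, fun j => measurable_pi_apply j, ?_, h.condExp_eq⟩
  filter_upwards [h.features_mem, h.label_mem] with s hx hy
  exact ⟨fun j => abs_le.2 (hx j), by rcases hy with hy | hy <;> simp [hy]⟩

section Signed

lemma sum_signed (f : Fin (2 * N + 1) → ℝ) :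
    ∑ j, f j = ∑ j : Fin N, (f ⟨j.val, by omega⟩ + f ⟨N + j.val, by omega⟩) +
      f ⟨2 * N, by omega⟩ := by
  rw [← (finCongr (by omega : N + N + 1 = 2 * N + 1)).sum_comp, Fin.sum_univ_castSucc,
    Fin.sum_univ_add, Finset.sum_add_distrib]
  congr 2
  ext
  simp only [finCongr_apply, Fin.val_cast, Fin.val_last]
  omega

lemma signedFeatures_left (x : Fin N → ℝ) (j : Fin N) :
    signedFeatures x ⟨j.val, by omega⟩ = x j :=
  dif_pos j.isLt

lemma signedFeatures_right (x : Fin N → ℝ) (j : Fin N) :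
    signedFeatures x ⟨N + j.val, by omega⟩ = -x j := by
  rw [signedFeatures, dif_neg (Nat.not_lt.2 (Nat.le_add_right _ _)),
    dif_pos (show N + j.val < 2 * N by omega)]
  simp only [Nat.add_sub_cancel_left]

lemma signedFeatures_last (x : Fin N → ℝ) : signedFeatures x ⟨2 * N, by omega⟩ = 0 := by
  rw [signedFeatures, dif_neg (show ¬ 2 * N < N by omega), dif_neg (lt_irrefl _)]

lemma dotProduct_signedFeatures (u : Fin (2 * N + 1) → ℝ) (x : Fin N → ℝ) :
    u ⬝ᵥ signedFeatures x = unsigned u ⬝ᵥ x := by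
  rw [dotProduct, sum_signed, dotProduct, signedFeatures_last, mul_zero, add_zero]
  refine Finset.sum_congr rfl fun j _ => ?_
  rw [signedFeatures_left, signedFeatures_right, unsigned]
  ring

/-- Non-negative coefficients of total weight `lam` on the features `(x, -x, 0)` that represent
the linear form `w`: its positive part, its negative part, and the slack `lam - ‖w‖₁` on the
feature `0`. -/
noncomputable def signedWeights (lam : ℝ) (w : Fin N → ℝ) (j : Fin (2 * N + 1)) : ℝ :=
  if h : j.val < N then max (w ⟨j.val, h⟩) 0
  else if h' : j.val < 2 * N then max (-w ⟨j.val - N, by omega⟩) 0 else lam - ∑ i, |w i|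

lemma signedWeights_left (lam : ℝ) (w : Fin N → ℝ) (j : Fin N) :
    signedWeights lam w ⟨j.val, by omega⟩ = max (w j) 0 :=
  dif_pos j.isLt

lemma signedWeights_right (lam : ℝ) (w : Fin N → ℝ) (j : Fin N) :
    signedWeights lam w ⟨N + j.val, by omega⟩ = max (-w j) 0 := by
  rw [signedWeights, dif_neg (Nat.not_lt.2 (Nat.le_add_right _ _)),
    dif_pos (show N + j.val < 2 * N by omega)]
  simp only [Nat.add_sub_cancel_left]

lemma signedWeights_last (lam : ℝ) (w : Fin N → ℝ) :
    signedWeights lam w ⟨2 * N, by omega⟩ = lam - ∑ i, |w i| := by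
  rw [signedWeights, dif_neg (show ¬ 2 * N < N by omega), dif_neg (lt_irrefl _)]

lemma signedWeights_nonneg {lam : ℝ} {w : Fin N → ℝ} (hw : ∑ j, |w j| ≤ lam)
    (j : Fin (2 * N + 1)) : 0 ≤ signedWeights lam w j := by
  unfold signedWeights
  split_ifs
  exacts [le_max_right _ _, le_max_right _ _, sub_nonneg.2 hw]

lemma sum_signedWeights (lam : ℝ) (w : Fin N → ℝ) : ∑ j, signedWeights lam w j = lam := by
  simp only [sum_signed, signedWeights_left, signedWeights_right, signedWeights_last]
  simp only [max_zero_add_max_neg_zero_eq_abs_self, add_sub_cancel]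

lemma unsigned_signedWeights (lam : ℝ) (w : Fin N → ℝ) :
    unsigned (signedWeights lam w) = w := by
  funext j
  rw [unsigned, signedWeights_left, signedWeights_right]
  exact max_zero_sub_max_neg_zero_eq_self (w j)

lemma IsGLM.featureModel_signed {act : ℝ → ℝ} {w : Fin N → ℝ} (h : IsGLM act w D) (lam : ℝ) :
    FeatureModel act signedFeatures (signedWeights lam w) D := by
  refine ⟨h.isProbabilityMeasure, fun j => ?_, ?_, ?_⟩
  · unfold signedFeatures
    split_ifs
    exacts [measurable_pi_apply _, (measurable_pi_apply _).neg, measurable_const]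
  · filter_upwards [h.features_mem, h.label_mem] with s hx hy
    refine ⟨fun j => ?_, by rcases hy with hy | hy <;> simp [hy]⟩
    unfold signedFeatures
    split_ifs
    · exact abs_le.2 (hx _)
    · exact (abs_neg _).trans_le (abs_le.2 (hx _))
    · exact abs_zero.trans_le zero_le_one
  · simp only [dotProduct_signedFeatures, unsigned_signedWeights]
    exact h.condExp_eq

end Signed

section Success

variable {act : ℝ → ℝ} {w : Fin N → ℝ} {lam eps delta : ℝ}

lemma le_successProb_sparsitron [NeZero N] (h : IsGLM act w D) (hmono : Monotone act)
    (hlip : LipschitzWith 1 act) (hact : ∀ z, act z ∈ Set.Icc (0 : ℝ) 1) (hw0 : ∀ j, 0 ≤ w j)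
    (hw : ∑ j, |w j| = lam) (heps : 0 < eps) (heps1 : eps < 1) (hdelta : 0 < delta)
    (hdelta1 : delta < 1) (hS : SampleSizes 1024 N lam eps delta T M) :
    ENNReal.ofReal (1 - delta) ≤ successProb D T M (sparsitron (parameters act lam eps delta N T))
      {v | risk act w D v ≤ eps} := by
  have := h.isProbabilityMeasure
  simp only [abs_of_nonneg (hw0 _)] at hw
  exact le_successProb hdelta hdelta1 (measure_not_failProb_learn_le reads_plainAccess
    h.featureModel hmono hlip hact hw0 hw heps heps1 hdelta hdelta1 hS)

lemma le_successProb_sparsitronSigned (h : IsGLM act w D) (hmono : Monotone act)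
    (hlip : LipschitzWith 1 act) (hact : ∀ z, act z ∈ Set.Icc (0 : ℝ) 1)
    (hw : ∑ j, |w j| ≤ lam) (heps : 0 < eps) (heps1 : eps < 1) (hdelta : 0 < delta)
    (hdelta1 : delta < 1) (hS : SampleSizes 1024 (2 * N + 1) lam eps delta T M) :
    ENNReal.ofReal (1 - delta) ≤
      successProb D T M (sparsitronSigned (parameters act lam eps delta (2 * N + 1) T))
        {v | risk act w D v ≤ eps} := by
  have := h.isProbabilityMeasure
  have hlearn := measure_not_failProb_learn_le reads_signedAccess (h.featureModel_signed lam)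
    hmono hlip hact (signedWeights_nonneg hw) (sum_signedWeights lam w) heps heps1 hdelta hdelta1
    hS
  refine le_successProb hdelta hdelta1 ((measure_mono fun s hs => ?_).trans hlearn)
  intro hcon
  refine hs ((failProb_bind_le (x := 0) fun u hu => ?_).trans ((add_zero _).trans_le hcon))
  rw [((ensures_unsignedLoop u).mono le_rfl ?_).failProb_eq_zero]
  rintro _ rfl
  simp only [featRisk, dotProduct_signedFeatures, unsigned_signedWeights] at hu
  exact hu

end Success

end Guarantee

end Sparsitron

theorem mainTheorem5 :
    ∃ (C C' : ℝ) (k : ℕ), 0 < C ∧ 0 < C' ∧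
    ∀ (N : ℕ) [NeZero N] (σ : ℝ → ℝ), Monotone σ → LipschitzWith 1 σ →
      (∀ z, σ z ∈ Set.Icc (0 : ℝ) 1) →
    ∀ (lam eps delta : ℝ), 0 ≤ lam → 0 < eps → eps < 1 → 0 < delta → delta < 1 →
      -- number of samples
      (∃ T M : ℕ, SampleSizes C N lam eps delta T M ∧ SampleSizes C (2 * N + 1) lam eps delta T M ∧
        (T : ℝ) ≤ C' * max 1 lam ^ 2 * Real.log (2 * N / (delta * eps)) / eps ^ 2 ∧
        (M : ℝ) ≤ C' * Real.log (2 * T / delta) / eps ^ 2 ∧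
        (T + M : ℝ) ≤ C' * max 1 lam ^ 2 * Real.log (2 * N / (delta * eps)) / eps ^ 2) ∧
    ∀ (T M : ℕ),
      -- learning guarantee
      (∀ (w : Fin N → ℝ) (D : Measure (Example N)), IsGLM σ w D →
        ((∀ j, 0 ≤ w j) → ∑ j, |w j| = lam → SampleSizes C N lam eps delta T M →
          ENNReal.ofReal (1 - delta) ≤
            successProb D T M (sparsitron (parameters σ lam eps delta N T))
              {v | risk σ w D v ≤ eps}) ∧
        (∑ j, |w j| ≤ lam → SampleSizes C (2 * N + 1) lam eps delta T M →
          ENNReal.ofReal (1 - delta) ≤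
            successProb D T M (sparsitronSigned (parameters σ lam eps delta (2 * N + 1) T))
              {v | risk σ w D v ≤ eps})) ∧
      -- run time
      (1 ≤ T → ∀ (train : Fin T → Example N) (test : Fin M → Example N),
        StepsLE (sparsitron (parameters σ lam eps delta N T) train test)
          (polylog C' k N T M lam eps delta * (T * roundCost N M lam eps delta)) ∧
        StepsLE (sparsitronSigned (parameters σ lam eps delta (2 * N + 1) T) train test)
          (polylog C' k N T M lam eps delta * (T * roundCost N M lam eps delta))) ∧
      -- online operation: the first training set is consumed one example at a time
      (1 ≤ T → ∀ (test : Fin M → Example N),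
        (∀ (t : ℕ) (train : Fin (t + 1) → Example N),
          stateAfter plainAccess (parameters σ lam eps delta N T) T test train = (do
            let s ← stateAfter plainAccess (parameters σ lam eps delta N T) T test
              (Fin.init train)
            RAM.exec .index
            oneRound plainAccess (parameters σ lam eps delta N T) T test (train (Fin.last t)) s) ∧
          stateAfter signedAccess (parameters σ lam eps delta (2 * N + 1) T) T test train = (do
            let s ← stateAfter signedAccess (parameters σ lam eps delta (2 * N + 1) T) T test
              (Fin.init train)
            RAM.exec .index
            oneRound signedAccess (parameters σ lam eps delta (2 * N + 1) T) T test
              (train (Fin.last t)) s)) ∧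
        (∀ (ex : Example N) (s : State N),
          StepsLE (oneRound plainAccess (parameters σ lam eps delta N T) T test ex s)
            (polylog C' k N T M lam eps delta * roundCost N M lam eps delta)) ∧
        (∀ (ex : Example N) (s : State (2 * N + 1)),
          StepsLE (oneRound signedAccess (parameters σ lam eps delta (2 * N + 1) T) T test ex s)
            (polylog C' k N T M lam eps delta * roundCost N M lam eps delta))) := by
  refine ⟨1024, 2000000, 2, by norm_num, by norm_num, ?_⟩
  intro N _ σ hmono hlip hact lam eps delta hlam heps heps1 hdelta hdelta1
  have hN : 1 ≤ N := Nat.pos_of_neZero N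
  refine ⟨exists_sampleSizes hN heps heps1 hdelta hdelta1 hlam (by norm_num), fun T M =>
    ⟨fun w D h => ⟨fun hw0 hw hS => ?_, fun hw hS => ?_⟩, fun hT train test => ⟨?_, ?_⟩,
      fun hT test => ⟨fun t train => ⟨stateAfter_succ .., stateAfter_succ ..⟩,
        fun ex s => ?_, fun ex s => ?_⟩⟩⟩
  · exact le_successProb_sparsitron h hmono hlip hact hw0 hw heps heps1 hdelta hdelta1 hS
  · exact le_successProb_sparsitronSigned h hmono hlip hact hw heps heps1 hdelta hdelta1 hS
  · exact stepsLE_sparsitron hT hlam heps heps1 hdelta train test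
  · exact stepsLE_sparsitronSigned hT hlam heps heps1 hdelta train test
  · exact stepsLE_oneRound hN (by omega) hT hlam heps heps1 hdelta reads_plainAccess test ex s
  · exact stepsLE_oneRound hN le_rfl hT hlam heps heps1 hdelta reads_signedAccess test ex s
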